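/- Let $m\ge 2$ be a fixed integer. The $m$-ary search tree of a sequence of $n$ distinct keys is empty if $n=0$; if $1\le n<m$ it is a single root storing all keys; if $n\ge m$ the first $m-1$ keys are stored in the root, and the remaining keys, in their given order, are directed to $m$ ordered subtrees, one for each of the $m$ intervals formed by the sorted root keys, each subtree being built in the same way. Let $K_n$ (key path length) be the sum over all keys, and $N_n$ (node path length) the sum over all nodes, of the distance to the root, in the $m$-ary search tree built from a uniformly random permutation of $n$ elements. Put $H_m=\sum_{j=1}^m \frac1j$ and $\phi=\frac{1}{2(H_m-1)}$. Then the following hold as $n\to\infty$. 1. The correlation coefficient of $K_n$ and $N_n$ satisfies $\rho(K_n,N_n)\to 1$. 2. $\bigl\| N_n-\phi K_n-\mathbb E(N_n-\phi K_n)\bigr\|_2=o(n)$. 3. The recursive distributional equation $$X\stackrel{d}{=}\sum_{r=1}^m V_rX^{(r)}+1+2\phi\sum_{r=1}^m V_r\log V_r$$ has exactly one solution in law with zero mean and finite variance. Here $V_1,\dots,V_m$ are the spacings into which $m-1$ independent uniform random points decompose $[0,1]$, the $X^{(r)}$ are distributed as $X$, and $(V_1,\dots,V_m),X^{(1)},\dots,X^{(m)}$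 are independent. If $K$ has this law, then $$\left(\frac{K_n-\mathbb E(K_n)}{n},\frac{N_n-\mathbb E(N_n)}{n}\right)\stackrel{d}{\longrightarrow}(K,\phi K).$$ -/

import Mathlib

open MeasureTheory ProbabilityTheory Filter
open scoped Topology

/-- An `m`-ary tree whose nodes store finite sets of keys: it is either empty, or it consists of a
root, holding a set of keys, together with an ordered `m`-tuple of `m`-ary trees. -/
inductive MaryTree (m : ℕ) (α : Type) : Type
  | empty : MaryTree m α
  | node (keys : Finset α) (sub : Fin m → MaryTree m α) : MaryTree m α

namespace MaryTree

variable {m : ℕ} {α : Type}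

/-- Sum, over all keys, of the depth of the node that stores the key, when the root of the tree is
regarded as being at depth `d`. -/
def keyDepthSum : MaryTree m α → ℕ → ℕ
  | empty, _ => 0
  | node keys sub, d => keys.card * d + ∑ i, (sub i).keyDepthSum (d + 1)

/-- Sum, over all nodes, of the depth of the node, when the root of the tree is regarded as being
at depth `d`. -/
def nodeDepthSum : MaryTree m α → ℕ → ℕ
  | empty, _ => 0
  | node _ sub, d => d + ∑ i, (sub i).nodeDepthSum (d + 1)

/-- Key path length: the sum over all keys of the distance between the root and the key. -/
def keyPathLength (t : MaryTree m α) : ℕ := t.keyDepthSum 0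

/-- Node path length: the sum over all nodes of the distance between the root and the node. -/
def nodePathLength (t : MaryTree m α) : ℕ := t.nodeDepthSum 0

/-- The `m`-ary search tree built from a sequence of distinct keys. If there are fewer than `m`
keys, all are stored in the root (and the tree is empty if there are none). Otherwise the first
`m - 1` keys are stored in the root, and the remaining keys, kept in their order, are directed to
the `m` subtrees: the `i`-th subtree (`i = 0, …, m - 1`) receives the keys that lie in the `i`-th
of the `m` intervals formed by the sorted root keys, i.e. that exceed exactly `i` root keys. -/
def build [LinearOrder α] (hm : 2 ≤ m) (l : List α) : MaryTree m α :=
  if l.length = 0 then empty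
  else if l.length < m then node l.toFinset fun _ => empty
  else
    node (l.take (m - 1)).toFinset fun i =>
      build hm ((l.drop (m - 1)).filter fun x =>
        ((l.take (m - 1)).toFinset.filter fun r => r < x).card = (i : ℕ))
  termination_by l.length
  decreasing_by
    refine lt_of_le_of_lt (List.length_filter_le _ _) ?_
    rw [List.length_drop]
    omega

end MaryTree

/-- Every set of permutations of `n` elements is measurable. -/
instance permMeasurableSpace (n : ℕ) : MeasurableSpace (Equiv.Perm (Fin n)) := ⊤

instance permDiscreteMeasurableSpace (n : ℕ) : DiscreteMeasurableSpace (Equiv.Perm (Fin n)) :=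
  ⟨fun _ => trivial⟩

/-- The uniform distribution on the `n!` permutations of `n` elements. -/
noncomputable def uniformPerm (n : ℕ) : Measure (Equiv.Perm (Fin n)) := uniformOn Set.univ

instance uniformPerm_isProbabilityMeasure (n : ℕ) : IsProbabilityMeasure (uniformPerm n) :=
  isProbabilityMeasure_uniformOn Set.finite_univ Set.univ_nonempty

/-- The `m`-ary search tree built from the input sequence `σ 0, σ 1, …, σ (n - 1)`. Under
`uniformPerm n` this is the random `m`-ary search tree with `n` keys. -/
def searchTree {m : ℕ} (hm : 2 ≤ m) (n : ℕ) (σ : Equiv.Perm (Fin n)) : MaryTree m (Fin n) :=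
  MaryTree.build hm (List.ofFn σ)

/-- `K_n`: the key path length of the random `m`-ary search tree with `n` keys. -/
noncomputable def KPL {m : ℕ} (hm : 2 ≤ m) (n : ℕ) (σ : Equiv.Perm (Fin n)) : ℝ :=
  ((searchTree hm n σ).keyPathLength : ℝ)

/-- `N_n`: the node path length of the random `m`-ary search tree with `n` keys. -/
noncomputable def NPL {m : ℕ} (hm : 2 ≤ m) (n : ℕ) (σ : Equiv.Perm (Fin n)) : ℝ :=
  ((searchTree hm n σ).nodePathLength : ℝ)

/-- The occupancy constant `φ = 1 / (2 (H_m - 1))`, with `H_m` the `m`-th harmonic number. -/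
noncomputable def occupancy (m : ℕ) : ℝ := 1 / (2 * ((harmonic m : ℝ) - 1))

/-- Pearson's correlation coefficient. -/
noncomputable def correlation {Ω : Type*} [MeasurableSpace Ω] (X Y : Ω → ℝ) (μ : Measure Ω) : ℝ :=
  covariance X Y μ / (√(variance X μ) * √(variance Y μ))

/-- The order statistics of `u 0, …, u (k - 1)`, with the conventions `U_(0) = 0` and
`U_(j) = 1` for `j > k`. -/
noncomputable def orderStat {k : ℕ} (u : Fin k → ℝ) (j : ℕ) : ℝ :=
  if j = 0 then 0 else if h : j - 1 < k then u (Tuple.sort u ⟨j - 1, h⟩) else 1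

/-- The spacings `V_(r+1) = U_(r+1) - U_(r)`, `r = 0, …, m - 1`, into which `m - 1` points
decompose the unit interval. -/
noncomputable def spacing {m : ℕ} (u : Fin (m - 1) → ℝ) (r : Fin m) : ℝ :=
  orderStat u ((r : ℕ) + 1) - orderStat u (r : ℕ)

/-- The law of `m - 1` independent uniform random variables on `[0, 1]`. -/
noncomputable def uniformSample (m : ℕ) : Measure (Fin (m - 1) → ℝ) :=
  Measure.pi fun _ => volume.restrict (Set.Icc (0 : ℝ) 1)

/-- The map `ν ↦ law of ∑ V_r X⁽ʳ⁾ + 1 + 2 φ ∑ V_r log V_r`, where `X⁽¹⁾, …, X⁽ᵐ⁾` have law `ν`,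
`(V_1, …, V_m)` are the spacings of `m - 1` independent uniform points of `[0, 1]`, and
`(V_1, …, V_m), X⁽¹⁾, …, X⁽ᵐ⁾` are independent. -/
noncomputable def keyLawMap (m : ℕ) (ν : Measure ℝ) : Measure ℝ :=
  ((uniformSample m).prod (Measure.pi fun _ : Fin m => ν)).map fun p =>
    (∑ r, spacing p.1 r * p.2 r) + 1
      + 2 * occupancy m * (∑ r : Fin m, spacing p.1 r * Real.log (spacing p.1 r))

/-- `ν` has finite second moment and zero mean, and it solves the recursive distributional equation
`X = ∑ V_r X⁽ʳ⁾ + 1 + 2 φ ∑ V_r log V_r` (in law). -/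
structure IsKeyLimitLaw (m : ℕ) (ν : ProbabilityMeasure ℝ) : Prop where
  memLp : MemLp (fun x : ℝ => x) 2 (ν : Measure ℝ)
  mean_zero : ∫ x, x ∂(ν : Measure ℝ) = 0
  fixed : keyLawMap m (ν : Measure ℝ) = (ν : Measure ℝ)

/-! Given the root keys, the subtrees are independent random search trees (`expect_prod_subtrees`),
and their sizes form a uniform composition of `n - (m - 1)` into `m` parts (`expect_gap`). Hence key
path length, node path length and number of nodes satisfy recursions with the same splitting, and
they differ only in the toll paid at the root: `n - (m - 1)` for the key path length, the number of
nodes outside the root for the node path length, and 1 for the number of nodes.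

Expectations. With θ = (1 - X) d/dX, the recursion for a mean becomes P(θ)F = (toll terms), where
P(z) = z(z+1)⋯(z+m-2) - m!. The number 2 is a simple root with P'(2) = m! (H_m - 1), and all other
roots have real part below 2. So means are determined up to an error of order n^a with a < 1, called
slow here: φ(n+1) for the number of nodes, and 2φ(n+1)(H_{n+1} - 1) + l(n+1) for the key path
length.

Variances. The toll of N - φK is the number of non-root nodes minus φ times the number of non-root
keys. The number of nodes concentrates at φn, so this toll is o(n) in mean square. The quadratic
weight (k+1)(k+2) is contracted by the factor 2/(m+1) ≤ 2/3 when it is summed over the subtrees.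
Therefore Var(N - φK) = o(n²), whereas Var K ≥ cn² because the limit toll of K is not almost surely
zero. The first two claims follow, and the third reduces to the convergence of K alone.

Limit law. Let L(t) be the asymptotic oscillation of the characteristic functions of the centred and
scaled K_n. The recursion gives L(t) ≤ E ∑ L(tV_r), centring and bounded second moments give L(t) ≤
Ct², and iteration with E ∑ V_r² ≤ 2/3 forces L = 0 (`eq_zero_of_le_integral_spacing`). The same
inequality, applied to the difference of two characteristic functions, proves uniqueness. Passing to
the limit in the recursion uses a coupling: the root keys are the cells hit by a uniform sample,
given that these cells are distinct. -/

open scoped BigOperators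

/-! ### Deterministic recursions for the search tree of a list -/

namespace MaryTree

variable {m : ℕ} {α : Type}

/-- The number of keys stored in a tree. -/
def numKeys : MaryTree m α → ℕ
  | empty => 0
  | node keys sub => keys.card + ∑ i, (sub i).numKeys

/-- The number of nodes of a tree. -/
def numNodes : MaryTree m α → ℕ
  | empty => 0
  | node _ sub => 1 + ∑ i, (sub i).numNodes

lemma keyDepthSum_eq (t : MaryTree m α) (d : ℕ) :
    t.keyDepthSum d = t.keyPathLength + d * t.numKeys := by
  unfold keyPathLength
  induction t generalizing d with
  | empty => simp [keyDepthSum, numKeys]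
  | node keys sub ih =>
    simp only [keyDepthSum, numKeys]
    rw [Finset.sum_congr rfl fun i _ => ih i (d + 1), Finset.sum_congr rfl fun i _ => ih i (0 + 1)]
    simp only [Finset.sum_add_distrib, ← Finset.mul_sum]
    ring

lemma nodeDepthSum_eq (t : MaryTree m α) (d : ℕ) :
    t.nodeDepthSum d = t.nodePathLength + d * t.numNodes := by
  unfold nodePathLength
  induction t generalizing d with
  | empty => simp [nodeDepthSum, numNodes]
  | node keys sub ih =>
    simp only [nodeDepthSum, numNodes]
    rw [Finset.sum_congr rfl fun i _ => ih i (d + 1), Finset.sum_congr rfl fun i _ => ih i (0 + 1)]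
    simp only [Finset.sum_add_distrib, ← Finset.mul_sum]
    ring

lemma keyPathLength_node (keys : Finset α) (sub : Fin m → MaryTree m α) :
    (node keys sub).keyPathLength = ∑ i, ((sub i).keyPathLength + (sub i).numKeys) := by
  rw [keyPathLength, keyDepthSum]
  simp [keyDepthSum_eq]

lemma nodePathLength_node (keys : Finset α) (sub : Fin m → MaryTree m α) :
    (node keys sub).nodePathLength = ∑ i, ((sub i).nodePathLength + (sub i).numNodes) := by
  rw [nodePathLength, nodeDepthSum]
  simp [nodeDepthSum_eq]

variable [LinearOrder α]

/-- The keys stored in the root of the search tree of a long enough list. -/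
def rootKeys (m : ℕ) (l : List α) : Finset α := (l.take (m - 1)).toFinset

/-- The number of elements of `R` that are smaller than `x`. -/
def rankIn (R : Finset α) (x : α) : ℕ := (R.filter fun r => r < x).card

/-- The list of the keys that are directed to the `i`-th subtree. -/
def subKeys (m : ℕ) (l : List α) (i : ℕ) : List α :=
  (l.drop (m - 1)).filter fun x => rankIn (rootKeys m l) x = i

lemma build_of_le (hm : 2 ≤ m) {l : List α} (hl : m ≤ l.length) :
    build hm l = node (rootKeys m l) fun i => build hm (subKeys m l i) := by
  rw [build, if_neg (by omega), if_neg (by omega)]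
  rfl

lemma length_subKeys_lt (hm : 2 ≤ m) {l : List α} (hl : m ≤ l.length) (i : ℕ) :
    (subKeys m l i).length < l.length := by
  refine lt_of_le_of_lt (List.length_filter_le _ _) ?_
  rw [List.length_drop]
  omega

lemma nodup_subKeys {l : List α} (hl : l.Nodup) (i : ℕ) : (subKeys m l i).Nodup :=
  (hl.sublist (List.drop_sublist _ _)).filter _

lemma rankIn_le (R : Finset α) (x : α) : rankIn R x ≤ R.card := Finset.card_filter_le _ _

lemma card_rootKeys {l : List α} (hl : l.Nodup) (h : m - 1 ≤ l.length) :
    (rootKeys m l).card = m - 1 := by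
  rw [rootKeys, List.toFinset_card_of_nodup (hl.sublist (List.take_sublist _ _)), List.length_take]
  omega

/-- The rank of a key among the `m - 1` root keys lies between 0 and `m - 1`, so every remaining key
enters exactly one subtree. -/
lemma sum_length_subKeys (hm : 2 ≤ m) {l : List α} (hl : l.Nodup) (h : m ≤ l.length) :
    ∑ i : Fin m, (subKeys m l i).length = l.length - (m - 1) := by
  have hR := card_rootKeys (m := m) hl (by omega)
  have key : ∀ l' : List α, ∑ i : Fin m,
      (l'.filter fun x => rankIn (rootKeys m l) x = (i : ℕ)).length = l'.length := by
    intro l'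
    induction l' with
    | nil => simp
    | cons x l' ih =>
      have hx : rankIn (rootKeys m l) x < m := by
        have := rankIn_le (rootKeys m l) x
        omega
      have : ∀ i : Fin m, ((x :: l').filter fun x => rankIn (rootKeys m l) x = (i : ℕ)).length
          = (if (⟨_, hx⟩ : Fin m) = i then 1 else 0)
            + (l'.filter fun x => rankIn (rootKeys m l) x = (i : ℕ)).length := by
        intro i
        by_cases hi : rankIn (rootKeys m l) x = i
        · simp [hi, add_comm]
        · simp [hi, Fin.ext_iff]
      simp only [this, Finset.sum_add_distrib, ih]
      simp [add_comm]
  have := key (l.drop (m - 1))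
  rw [List.length_drop] at this
  exact this

lemma numKeys_build (hm : 2 ≤ m) {l : List α} (hl : l.Nodup) : (build hm l).numKeys = l.length := by
  induction h : l.length using Nat.strong_induction_on generalizing l with
  | _ n ih =>
    subst h
    by_cases hlm : m ≤ l.length
    · rw [build_of_le hm hlm, numKeys, card_rootKeys hl (by omega),
        Finset.sum_congr rfl fun (i : Fin m) _ =>
          ih _ (length_subKeys_lt hm hlm i) (nodup_subKeys hl i) rfl,
        sum_length_subKeys hm hl hlm]
      omega
    · by_cases h0 : l.length = 0
      · rw [build, if_pos h0, numKeys, h0]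
      · rw [build, if_neg h0, if_pos (by omega), numKeys]
        simp [numKeys, List.toFinset_card_of_nodup hl]

/-- Key path length, node path length and number of nodes of the search tree of a list. -/
def stats (hm : 2 ≤ m) (l : List α) : ℕ × ℕ × ℕ :=
  ((build hm l).keyPathLength, (build hm l).nodePathLength, (build hm l).numNodes)

/-- Moving a subtree below the root deepens all its keys and nodes by one, so it contributes its
numbers of keys and of nodes in addition. The number of keys is the length of the list, hence the
three statistics form a closed system. -/
lemma stats_of_le (hm : 2 ≤ m) {l : List α} (hl : l.Nodup) (h : m ≤ l.length) :
    stats hm l = (∑ i : Fin m, ((stats hm (subKeys m l i)).1 + (subKeys m l i).length),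
      ∑ i : Fin m, ((stats hm (subKeys m l i)).2.1 + (stats hm (subKeys m l i)).2.2),
      1 + ∑ i : Fin m, (stats hm (subKeys m l i)).2.2) := by
  conv_lhs => rw [stats, build_of_le hm h, keyPathLength_node, nodePathLength_node, numNodes]
  simp only [stats, numKeys_build hm (nodup_subKeys hl _)]

lemma stats_of_lt (hm : 2 ≤ m) {l : List α} (h : l.length < m) :
    stats hm l = (0, 0, if l.length = 0 then 0 else 1) := by
  rw [stats, build]
  split_ifs
  · simp [keyPathLength, nodePathLength, keyDepthSum, nodeDepthSum, numNodes]
  · simp [keyPathLength, nodePathLength, keyDepthSum, nodeDepthSum, numNodes]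

lemma subKeys_map {β : Type} [LinearOrder β] {f : α → β} (hf : StrictMono f) (l : List α) (i : ℕ) :
    subKeys m (l.map f) i = (subKeys m l i).map f := by
  have h : ∀ x, rankIn (rootKeys m (l.map f)) (f x) = rankIn (rootKeys m l) x := by
    intro x
    have : rootKeys m (l.map f) = (rootKeys m l).image f := by
      ext y
      simp [rootKeys, ← List.map_take]
    rw [rankIn, this, Finset.filter_image, Finset.card_image_of_injective _ hf.injective]
    simp [rankIn, hf.lt_iff_lt]
  rw [subKeys, ← List.map_drop, List.filter_map]
  simp only [Function.comp_def, h]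
  rfl

/-- The construction only compares keys, so only their relative order matters. This identifies a
subtree on any set of `k` keys with a tree on `Fin k`. -/
lemma stats_map (hm : 2 ≤ m) {β : Type} [LinearOrder β] {f : α → β} (hf : StrictMono f)
    {l : List α} (hl : l.Nodup) : stats hm (l.map f) = stats hm l := by
  induction h : l.length using Nat.strong_induction_on generalizing l with
  | _ n ih =>
    subst h
    by_cases hlm : m ≤ l.length
    · rw [stats_of_le hm hl hlm, stats_of_le hm (hl.map hf.injective) (by simpa using hlm)]
      simp only [subKeys_map hf, List.length_map,
        ih _ (length_subKeys_lt hm hlm _) (nodup_subKeys hl _) rfl]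
    · rw [stats_of_lt hm (by simpa using hlm), stats_of_lt hm (by simpa using hlm)]
      simp

end MaryTree
-- Conditional independence of the subtrees, by shuffling keys within blocks
lemma prod_expect_eq_expect_prod {ι 𝕜 : Type*} [Fintype ι] [DecidableEq ι] [Field 𝕜] [CharZero 𝕜]
    {κ : ι → Type*} [∀ i, Fintype (κ i)] (f : ∀ i, κ i → 𝕜) :
    ∏ i, 𝔼 j, f i j = 𝔼 x : ∀ i, κ i, ∏ i, f i (x i) := by
  simp only [Fintype.expect_eq_sum_div_card, Finset.prod_div_distrib, Fintype.prod_sum,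
    Fintype.card_pi, Nat.cast_prod]

/-- The components at `Sum.inr` receive the constant factor 1 and average out. In the application
`Sum.inl` indexes the subtrees and `Sum.inr` the root keys. -/
lemma expect_prod_comp_inl {ι κ 𝕜 : Type*} [Fintype ι] [Fintype κ] [DecidableEq ι] [DecidableEq κ]
    [Field 𝕜] [CharZero 𝕜] {P : ι ⊕ κ → Type*} [∀ y, Fintype (P y)] [∀ y, Nonempty (P y)]
    (f : ∀ i, P (Sum.inl i) → 𝕜) :
    𝔼 π : (∀ y, P y), ∏ i, f i (π (Sum.inl i)) = ∏ i, 𝔼 p, f i p := by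
  let h : ∀ y, P y → 𝕜 := fun y => match y with
    | Sum.inl i => f i
    | Sum.inr _ => fun _ => 1
  have h1 := prod_expect_eq_expect_prod h
  rw [Fintype.prod_sum_type] at h1
  simp only [Fintype.prod_sum_type, h, Fintype.expect_const, Finset.prod_const_one, mul_one] at h1
  exact h1.symm

namespace MaryTree

variable {m n : ℕ}

/-- The average of a function of the statistics of a uniformly permuted list. -/
lemma expect_stats_map (hm : 2 ≤ m) {𝕜 : Type*} [Field 𝕜] [CharZero 𝕜] {B : Type} [Fintype B]
    [LinearOrder B] {l : List B} (hl : l.Nodup) (hmem : ∀ x, x ∈ l) (G : ℕ × ℕ × ℕ → 𝕜) :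
    𝔼 π : Equiv.Perm B, G (stats hm (l.map π))
      = 𝔼 τ : Equiv.Perm (Fin l.length), G (stats hm (List.ofFn τ)) := by
  have hcard : Fintype.card B = l.length := by
    rw [← List.toFinset_card_of_nodup hl, ← Finset.card_univ]
    congr 1
    ext x
    simp [hmem]
  let e : B ≃o Fin l.length := (monoEquivOfFin B hcard).symm
  let t : Fin l.length ≃ B := hl.getEquivOfForallMemList l hmem
  have ht : List.ofFn t = l := by
    conv_rhs => rw [← List.ofFn_get l]
    rfl
  -- The bijection is `π ↦ e ∘ π ∘ t`: `t` enumerates the list and `e` relabels the values in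
  -- increasing order, which does not affect the statistics.
  refine Fintype.expect_equiv ((Equiv.permCongr t.symm).trans (Equiv.mulLeft (t.trans e.toEquiv)))
    _ _ fun π => ?_
  congr 1
  rw [← stats_map hm e.strictMono (hl.map π.injective)]
  have hπ : l.map π = List.ofFn (π ∘ t) := by rw [← List.map_ofFn, ht]
  rw [hπ, List.map_ofFn]
  congr 2
  ext i
  simp [Equiv.permCongr_apply]

/-- The set of root keys of the search tree built from a permutation. -/
def permRoots (m : ℕ) (σ : Equiv.Perm (Fin n)) : Finset (Fin n) := rootKeys m (List.ofFn σ)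

/-- The number of elements outside of `R` that exceed exactly `r` elements of `R`. -/
def gap (R : Finset (Fin n)) (r : ℕ) : ℕ :=
  (Finset.univ.filter fun k => k ∉ R ∧ rankIn R k = r).card

lemma nodup_ofFn_perm (σ : Equiv.Perm (Fin n)) : (List.ofFn σ).Nodup :=
  List.nodup_ofFn.2 σ.injective

lemma mem_subKeys_ofFn (σ : Equiv.Perm (Fin n)) (r : ℕ) (x : Fin n) :
    x ∈ subKeys m (List.ofFn σ) r ↔ x ∉ permRoots m σ ∧ rankIn (permRoots m σ) x = r := by
  have hx : x ∈ (List.ofFn σ).take (m - 1) ++ (List.ofFn σ).drop (m - 1) := by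
    rw [List.take_append_drop]
    simp only [List.mem_ofFn]
    exact ⟨σ.symm x, by simp⟩
  have hd := nodup_ofFn_perm σ
  rw [← List.take_append_drop (m - 1) (List.ofFn σ), List.nodup_append] at hd
  rw [subKeys, List.mem_filter]
  simp only [decide_eq_true_eq, permRoots]
  refine and_congr_left fun _ => ?_
  rw [rootKeys, List.mem_toFinset]
  rcases List.mem_append.1 hx with h | h
  · exact ⟨fun h' => absurd rfl (hd.2.2 x h x h'), fun h' => absurd h h'⟩
  · exact ⟨fun h' h'' => absurd rfl (hd.2.2 x h'' x h'), fun _ => h⟩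

lemma length_subKeys_ofFn (σ : Equiv.Perm (Fin n)) (r : ℕ) :
    (subKeys m (List.ofFn σ) r).length = gap (permRoots m σ) r := by
  rw [gap, ← List.toFinset_card_of_nodup (nodup_subKeys (nodup_ofFn_perm σ) r)]
  congr 1
  ext x
  simp [mem_subKeys_ofFn]

lemma card_permRoots (hn : m - 1 ≤ n) (σ : Equiv.Perm (Fin n)) : (permRoots m σ).card = m - 1 :=
  card_rootKeys (nodup_ofFn_perm σ) (by simpa using hn)

/-- The block of a key: itself for a root key, and otherwise the index of its subtree. -/
def block (R : Finset (Fin n)) (hR : R.card < m) (k : Fin n) : Fin m ⊕ Fin n :=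
  if k ∈ R then Sum.inr k else Sum.inl ⟨rankIn R k, (rankIn_le R k).trans_lt hR⟩

lemma block_eq_inl {R : Finset (Fin n)} {hR : R.card < m} {k : Fin n} {r : Fin m} :
    block R hR k = Sum.inl r ↔ k ∉ R ∧ rankIn R k = r := by
  unfold block
  split_ifs with h <;> simp [h, Fin.ext_iff]

/-- Each root key is a block of its own, so a permutation that preserves blocks fixes the root keys.
-/
lemma eq_of_block_eq {R : Finset (Fin n)} {hR : R.card < m} {k x : Fin n} (hk : k ∈ R)
    (h : block R hR x = block R hR k) : x = k := by
  unfold block at h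
  rw [if_pos hk] at h
  split_ifs at h with h'
  simpa using h

lemma mem_iff_of_block_eq {R : Finset (Fin n)} {hR : R.card < m} {k x : Fin n}
    (h : block R hR x = block R hR k) : x ∈ R ↔ k ∈ R :=
  ⟨fun hx => (eq_of_block_eq hx h.symm) ▸ hx, fun hk => (eq_of_block_eq hk h) ▸ hk⟩

lemma rankIn_of_block_eq {R : Finset (Fin n)} {hR : R.card < m} {k x : Fin n}
    (h : block R hR x = block R hR k) : rankIn R x = rankIn R k := by
  by_cases hk : k ∈ R
  · rw [eq_of_block_eq hk h]
  · have hx : x ∉ R := fun hx => hk ((mem_iff_of_block_eq h).1 hx)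
    simpa [block, hk, hx] using h

section Shuffle

variable {R : Finset (Fin n)} {hR : R.card < m}

/-- The permutation that permutes each block separately. -/
def shuffle (π : ∀ y, Equiv.Perm {k : Fin n // block R hR k = y}) : Equiv.Perm (Fin n) :=
  Equiv.ofFiberEquiv π

lemma shuffle_apply (π : ∀ y, Equiv.Perm {k : Fin n // block R hR k = y}) {k : Fin n}
    {y : Fin m ⊕ Fin n} (hk : block R hR k = y) : shuffle π k = (π y ⟨k, hk⟩ : Fin n) := by
  subst hk
  rfl

lemma block_shuffle (π : ∀ y, Equiv.Perm {k : Fin n // block R hR k = y}) (k : Fin n) :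
    block R hR (shuffle π k) = block R hR k :=
  Equiv.ofFiberEquiv_map _ _

variable {σ : Equiv.Perm (Fin n)}

/-- Left multiplication changes the values of the input sequence, not the positions; the values in
the first positions are root keys and hence fixed. -/
lemma permRoots_shuffle (hσ : permRoots m σ = R)
    (π : ∀ y, Equiv.Perm {k : Fin n // block R hR k = y}) :
    permRoots m (shuffle π * σ) = R := by
  have h : List.ofFn (shuffle π * σ) = (List.ofFn σ).map (shuffle π) := by
    rw [List.map_ofFn]; rfl
  refine Eq.trans ?_ hσ
  rw [permRoots, permRoots, rootKeys, rootKeys, h, ← List.map_take]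
  congr 1
  conv_rhs => rw [← List.map_id ((List.ofFn σ).take (m - 1))]
  refine List.map_congr_left fun x hx => ?_
  exact eq_of_block_eq (hσ ▸ List.mem_toFinset.2 hx) (block_shuffle π x)

/-- A shuffle leaves every key in its block, so the same positions of the input go to the same
subtree and only the values are permuted. -/
lemma subKeys_shuffle (hσ : permRoots m σ = R)
    (π : ∀ y, Equiv.Perm {k : Fin n // block R hR k = y}) (r : ℕ) :
    subKeys m (List.ofFn (shuffle π * σ)) r = (subKeys m (List.ofFn σ) r).map (shuffle π) := by
  have h : List.ofFn (shuffle π * σ) = (List.ofFn σ).map (shuffle π) := by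
    rw [List.map_ofFn]; rfl
  have h1 := permRoots_shuffle hσ π
  rw [permRoots] at h1 hσ
  rw [subKeys, subKeys, h1, hσ, h, ← List.map_drop, List.filter_map]
  congr 1
  refine List.filter_congr fun x _ => ?_
  simp only [Function.comp_def, rankIn_of_block_eq (block_shuffle π x)]

/-- Averaging over the permutations of a block. -/
lemma expect_stats_shuffle (hm : 2 ≤ m) {𝕜 : Type*} [Field 𝕜] [CharZero 𝕜]
    (hσ : permRoots m σ = R) (G : Fin m → ℕ × ℕ × ℕ → 𝕜) :
    𝔼 π : (∀ y, Equiv.Perm {k : Fin n // block R hR k = y}),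
        ∏ r, G r (stats hm (subKeys m (List.ofFn (shuffle π * σ)) r))
      = ∏ r : Fin m, 𝔼 τ : Equiv.Perm (Fin (gap R r)), G r (stats hm (List.ofFn τ)) := by
  have hmem : ∀ r : Fin m, ∀ x ∈ subKeys m (List.ofFn σ) r, block R hR x = Sum.inl r := by
    intro r x hx
    rw [mem_subKeys_ofFn, hσ] at hx
    exact block_eq_inl.2 hx
  let l : ∀ r : Fin m, List {k : Fin n // block R hR k = Sum.inl r} := fun r =>
    (subKeys m (List.ofFn σ) r).attachWith _ (hmem r)
  have hl : ∀ r, (l r).map Subtype.val = subKeys m (List.ofFn σ) r := fun r =>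
    List.attachWith_map_subtype_val _ 
  have hnd : ∀ r, (l r).Nodup := fun r =>
    List.Nodup.of_map Subtype.val ((hl r).symm ▸ nodup_subKeys (nodup_ofFn_perm σ) r)
  have hlen : ∀ r, (l r).length = gap R r := by
    intro r
    rw [← List.length_map (as := l r) Subtype.val, hl, length_subKeys_ofFn, hσ]
  have hall : ∀ r x, x ∈ l r := by
    intro r x
    have : (x : Fin n) ∈ (l r).map Subtype.val := by
      rw [hl, mem_subKeys_ofFn, hσ]
      exact block_eq_inl.1 x.2
    obtain ⟨y, hy, hyx⟩ := List.mem_map.1 this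
    exact Subtype.ext hyx ▸ hy
  have key : ∀ (π : ∀ y, Equiv.Perm {k : Fin n // block R hR k = y}) (r : Fin m),
      stats hm (subKeys m (List.ofFn (shuffle π * σ)) r)
        = stats hm ((l r).map (π (Sum.inl r))) := by
    intro π r
    rw [subKeys_shuffle hσ, ← hl, ← stats_map hm (Subtype.strictMono_coe _)
      ((hnd r).map (π (Sum.inl r)).injective), List.map_map, List.map_map]
    congr 1
    refine List.map_congr_left fun x _ => ?_
    exact shuffle_apply π x.2
  simp only [key]
  rw [expect_prod_comp_inl (P := fun y => Equiv.Perm {k : Fin n // block R hR k = y})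
    (fun r (p : Equiv.Perm {k : Fin n // block R hR k = Sum.inl r}) => G r (stats hm ((l r).map p)))]
  refine Finset.prod_congr rfl fun r _ => ?_
  have h := expect_stats_map hm (hnd r) (hall r) (G r)
  rw [hlen] at h
  convert h

end Shuffle

/-- **Independence of the subtrees**: given the root keys, the subtrees are independent random
search trees of the respective sizes. -/
theorem expect_prod_subtrees (hm : 2 ≤ m) (hn : m - 1 ≤ n) {𝕜 : Type*} [Field 𝕜] [CharZero 𝕜]
    (g : Finset (Fin n) → Fin m → ℕ × ℕ × ℕ → 𝕜) :
    𝔼 σ : Equiv.Perm (Fin n), ∏ r, g (permRoots m σ) r (stats hm (subKeys m (List.ofFn σ) r))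
      = 𝔼 σ : Equiv.Perm (Fin n), ∏ r : Fin m,
          𝔼 τ : Equiv.Perm (Fin (gap (permRoots m σ) r)),
            g (permRoots m σ) r (stats hm (List.ofFn τ)) := by
  simp only [Fintype.expect_eq_sum_div_card (ι := Equiv.Perm (Fin n))]
  congr 1
  rw [← Finset.sum_fiberwise (s := Finset.univ) (g := permRoots m),
    ← Finset.sum_fiberwise (s := Finset.univ) (g := permRoots m)]
  refine Finset.sum_congr rfl fun R _ => ?_
  by_cases hR : R.card < m
  swap
  · have : Finset.univ.filter (fun σ : Equiv.Perm (Fin n) => permRoots m σ = R) = ∅ := by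
      refine Finset.filter_eq_empty_iff.2 fun σ _ hσ => ?_
      have := card_permRoots hn σ
      rw [hσ] at this
      omega
    simp [this]
  -- Left multiplication by a shuffle is a bijection of the permutations with root set `R`, so the
  -- sum is the same for every `π`.
  have step : ∀ π : (∀ y, Equiv.Perm {k : Fin n // block R hR k = y}),
      ∑ σ with permRoots m σ = R,
          ∏ r, g (permRoots m σ) r (stats hm (subKeys m (List.ofFn σ) r))
        = ∑ σ with permRoots m σ = R,
          ∏ r, g R r (stats hm (subKeys m (List.ofFn (shuffle π * σ)) r)) := by
    intro π
    symm
    refine Finset.sum_bij (fun σ _ => shuffle π * σ) ?_ ?_ ?_ ?_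
    · intro σ hσ
      simp only [Finset.mem_filter, Finset.mem_univ, true_and] at hσ ⊢
      exact permRoots_shuffle hσ π
    · intro a _ b _ h
      exact mul_left_cancel h
    · intro b hb
      simp only [Finset.mem_filter, Finset.mem_univ, true_and] at hb
      refine ⟨(shuffle π)⁻¹ * b, ?_, by simp⟩
      simp only [Finset.mem_filter, Finset.mem_univ, true_and]
      have hinv : (shuffle π)⁻¹ = shuffle (R := R) (hR := hR) fun y => (π y)⁻¹ := by
        refine inv_eq_of_mul_eq_one_left ?_
        ext k
        rw [Equiv.Perm.mul_apply, Equiv.Perm.one_apply,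
          shuffle_apply _ (block_shuffle π k)]
        simp [shuffle_apply π (rfl : block R hR k = _)]
      rw [hinv]
      exact permRoots_shuffle hb _
    · intro σ hσ
      simp only [Finset.mem_filter, Finset.mem_univ, true_and] at hσ
      rw [permRoots_shuffle hσ π]
  have h1 := Fintype.expect_const (ι := ∀ y, Equiv.Perm {k : Fin n // block R hR k = y})
    (∑ σ with permRoots m σ = R,
          ∏ r, g (permRoots m σ) r (stats hm (subKeys m (List.ofFn σ) r)))
  -- The sum may thus be averaged over all `π`. After exchanging the order, the inner average for
  -- fixed `σ` factorizes by `expect_stats_shuffle`.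
  rw [← h1, Finset.expect_congr rfl fun π _ => step π, Finset.expect_sum_comm]
  refine Finset.sum_congr rfl fun σ hσ => ?_
  simp only [Finset.mem_filter, Finset.mem_univ, true_and] at hσ
  rw [expect_stats_shuffle hm hσ, hσ]

end MaryTree
-- Distribution of the root keys and of the subtree sizes
lemma expect_comp_of_transitive {X Y 𝕜 : Type*} [Fintype X] [Nonempty X] [Fintype Y]
    [DecidableEq Y] [Field 𝕜] [CharZero 𝕜] (f : X → Y)
    (hf : ∀ y y', ∃ e : X → X, Function.Injective e ∧ ∀ x, f x = y → f (e x) = y') (h : Y → 𝕜) :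
    𝔼 x, h (f x) = 𝔼 y, h y := by
  -- Injections between any two fibres force all fibres of `f` to have the same size, so the image
  -- of the uniform distribution is uniform.
  have hle : ∀ y y', (Finset.univ.filter fun x => f x = y).card
      ≤ (Finset.univ.filter fun x => f x = y').card := by
    intro y y'
    obtain ⟨e, he, hfe⟩ := hf y y'
    refine Finset.card_le_card_of_injOn e (fun x hx => ?_) he.injOn
    simp only [Finset.coe_filter, Finset.mem_univ, true_and, Set.mem_ofPred_eq] at hx ⊢
    exact hfe x hx
  have x0 : X := Classical.arbitrary X
  set c := (Finset.univ.filter fun x => f x = f x0).card with hc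
  have hcy : ∀ y, (Finset.univ.filter fun x => f x = y).card = c := fun y =>
    le_antisymm (hle _ _) (hle _ _)
  have hc0 : (c : 𝕜) ≠ 0 := by
    rw [Nat.cast_ne_zero, hc]
    exact Finset.card_ne_zero.2 ⟨x0, by simp⟩
  have hsum : ∀ h' : Y → 𝕜, ∑ x, h' (f x) = c * ∑ y, h' y := by
    intro h'
    rw [← Finset.sum_fiberwise (s := Finset.univ) (g := f), Finset.mul_sum]
    refine Finset.sum_congr rfl fun y _ => ?_
    rw [Finset.sum_congr rfl (g := fun _ => h' y), Finset.sum_const, hcy, nsmul_eq_mul]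
    intro x hx
    rw [(Finset.mem_filter.1 hx).2]
  have hcard : (Fintype.card X : 𝕜) = c * Fintype.card Y := by
    simpa using hsum fun _ => 1
  rw [Fintype.expect_eq_sum_div_card, Fintype.expect_eq_sum_div_card, hsum, hcard,
    mul_div_mul_left _ _ hc0]

namespace MaryTree

variable {m n : ℕ}

/-- The first keys of a permutation. -/
def firstKeys (h : m - 1 ≤ n) (σ : Equiv.Perm (Fin n)) : Fin (m - 1) ↪ Fin n :=
  (Fin.castLEEmb h).trans σ.toEmbedding

lemma permRoots_eq_map (h : m - 1 ≤ n) (σ : Equiv.Perm (Fin n)) :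
    permRoots m σ = Finset.univ.map (firstKeys h σ) := by
  symm
  refine Finset.eq_of_subset_of_card_le ?_ ?_
  · intro x hx
    obtain ⟨i, -, rfl⟩ := Finset.mem_map.1 hx
    rw [permRoots, rootKeys, List.mem_toFinset, List.mem_take_iff_getElem]
    exact ⟨i, by simp; omega, by simp [firstKeys]; rfl⟩
  · rw [card_permRoots h, Finset.card_map, Finset.card_univ, Fintype.card_fin]

lemma exists_perm_comp_eq {k : ℕ} (x y : Fin k ↪ Fin n) :
    ∃ π : Equiv.Perm (Fin n), ∀ i, π (x i) = y i := by
  obtain ⟨π, hπ⟩ := Equiv.Perm.exists_extending_pair x y x.injective y.injective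
  exact ⟨π, hπ⟩

/-- The first keys of a uniform permutation form a uniform tuple of distinct elements. -/
lemma expect_firstKeys (h : m - 1 ≤ n) {𝕜 : Type*} [Field 𝕜] [CharZero 𝕜]
    (f : (Fin (m - 1) ↪ Fin n) → 𝕜) :
    𝔼 σ : Equiv.Perm (Fin n), f (firstKeys h σ) = 𝔼 x, f x := by
  refine expect_comp_of_transitive (firstKeys h) (fun x y => ?_) f
  obtain ⟨π, hπ⟩ := exists_perm_comp_eq x y
  refine ⟨fun σ => π * σ, mul_right_injective π, fun σ hσ => ?_⟩
  ext i
  rw [← hπ, ← hσ]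
  rfl

lemma rankIn_orderEmbOfFin {k : ℕ} {R : Finset (Fin n)} (hR : R.card = k) (j : Fin k) :
    rankIn R (R.orderEmbOfFin hR j) = j := by
  have : (R.filter fun r => r < R.orderEmbOfFin hR j)
      = (Finset.Iio j).map (R.orderEmbOfFin hR).toEmbedding := by
    ext x
    simp only [Finset.mem_filter, Finset.mem_map, Finset.mem_Iio]
    constructor
    · rintro ⟨hx, hlt⟩
      rw [← Finset.image_orderEmbOfFin_univ R hR] at hx
      obtain ⟨i, -, rfl⟩ := Finset.mem_image.1 hx
      exact ⟨i, (R.orderEmbOfFin hR).lt_iff_lt.1 hlt, rfl⟩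
    · rintro ⟨i, hi, rfl⟩
      exact ⟨Finset.orderEmbOfFin_mem _ _ _, (R.orderEmbOfFin hR).lt_iff_lt.2 hi⟩
  rw [rankIn, this, Finset.card_map, Fin.card_Iio]

lemma rankIn_mono (R : Finset (Fin n)) {x y : Fin n} (h : x ≤ y) : rankIn R x ≤ rankIn R y :=
  Finset.card_le_card fun _ hr => Finset.mem_filter.2
    ⟨(Finset.mem_filter.1 hr).1, (Finset.mem_filter.1 hr).2.trans_le h⟩

lemma sum_range_gap (R : Finset (Fin n)) (j : ℕ) :
    ∑ i ∈ Finset.range j, gap R i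
      = (Finset.univ.filter fun k => k ∉ R ∧ rankIn R k < j).card := by
  rw [Finset.card_eq_sum_card_fiberwise (f := rankIn R) (t := Finset.range j)]
  · refine Finset.sum_congr rfl fun i hi => ?_
    rw [gap, Finset.filter_filter]
    congr 1
    ext k
    simp only [Finset.mem_filter, Finset.mem_univ, true_and]
    have := Finset.mem_range.1 hi
    constructor
    · rintro ⟨h1, h2⟩; exact ⟨⟨h1, by omega⟩, h2⟩
    · rintro ⟨⟨h1, _⟩, h2⟩; exact ⟨h1, h2⟩
  · intro k hk
    simpa using (Finset.mem_filter.1 hk).2.2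

/-- An element of `Fin n` equals the number of elements below it. Below the `j`-th root key, counted
from 0, lie `j` root keys and the keys of the subtrees `0, …, j`. -/
lemma sum_range_gap_add {k : ℕ} {R : Finset (Fin n)} (hR : R.card = k) (j : Fin k) :
    ∑ i ∈ Finset.range (j + 1), gap R i + j = R.orderEmbOfFin hR j := by
  set y := R.orderEmbOfFin hR j with hy
  have hry := rankIn_orderEmbOfFin hR j
  rw [← hy] at hry
  have hyR : y ∈ R := Finset.orderEmbOfFin_mem _ _ _
  have h1 : (Finset.univ.filter fun k => k ∉ R ∧ rankIn R k < j + 1)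
      = Finset.univ.filter fun x => x ∉ R ∧ x < y := by
    ext x
    simp only [Finset.mem_filter, Finset.mem_univ, true_and]
    refine and_congr_right fun hx => ⟨fun h => ?_, fun h => ?_⟩
    · by_contra hxy
      have hlt : y < x := lt_of_le_of_ne (not_lt.1 hxy) fun h' => hx (h' ▸ hyR)
      have : rankIn R y < rankIn R x := by
        refine Finset.card_lt_card ⟨fun r hr => ?_, fun hsub => ?_⟩
        · exact Finset.mem_filter.2
            ⟨(Finset.mem_filter.1 hr).1, (Finset.mem_filter.1 hr).2.trans hlt⟩
        · exact lt_irrefl y (Finset.mem_filter.1 (hsub (Finset.mem_filter.2 ⟨hyR, hlt⟩))).2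
      omega
    · have := rankIn_mono R h.le
      omega
  rw [sum_range_gap, h1]
  have h2 : (R.filter fun r => r < y).card = j := hry
  rw [← h2, ← Finset.card_union_of_disjoint]
  · have : (Finset.univ.filter fun x => x ∉ R ∧ x < y) ∪ (R.filter fun r => r < y)
        = Finset.Iio y := by
      ext x
      simp only [Finset.mem_union, Finset.mem_filter, Finset.mem_univ, true_and, Finset.mem_Iio]
      tauto
    rw [this, Fin.card_Iio]
  · rw [Finset.disjoint_left]
    intro x hx hx'
    exact (Finset.mem_filter.1 hx).2.1 (Finset.mem_filter.1 hx').1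

lemma sum_gap {R : Finset (Fin n)} {m : ℕ} (hR : R.card < m) :
    ∑ i : Fin m, gap R i = n - R.card := by
  rw [Fin.sum_univ_eq_sum_range (gap R), sum_range_gap]
  have : (Finset.univ.filter fun k => k ∉ R ∧ rankIn R k < m) = Rᶜ := by
    ext x
    have := (rankIn_le R x).trans_lt hR
    simp [this]
  rw [this, Finset.card_compl, Fintype.card_fin]

/-- By `sum_range_gap_add` the sorted root keys are determined by the partial sums of the gaps. -/
lemma eq_of_gap_eq {k : ℕ} {R R' : Finset (Fin n)} (hR : R.card = k) (hR' : R'.card = k)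
    (h : ∀ i < k, gap R i = gap R' i) : R = R' := by
  have : R.orderEmbOfFin hR = R'.orderEmbOfFin hR' := by
    ext j
    rw [← sum_range_gap_add, ← sum_range_gap_add]
    congr 1
    exact Finset.sum_congr rfl fun i hi => h i (by have := Finset.mem_range.1 hi; omega)
  rw [← Finset.image_orderEmbOfFin_univ R hR, ← Finset.image_orderEmbOfFin_univ R' hR', this]

/-- The sizes of the subtrees form a uniform composition of the number of remaining keys. -/
lemma expect_gap (hm : 2 ≤ m) (hn : m - 1 ≤ n) {𝕜 : Type*} [Field 𝕜] [CharZero 𝕜]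
    (f : (Fin m → ℕ) → 𝕜) :
    (n.choose (m - 1) : 𝕜) * 𝔼 σ : Equiv.Perm (Fin n), f (fun r => gap (permRoots m σ) r)
      = ∑ i ∈ Finset.univ.finsuppAntidiag (n - (m - 1)), f i := by
  let F : Equiv.Perm (Fin n) → {R : Finset (Fin n) // R.card = m - 1} := fun σ =>
    ⟨permRoots m σ, card_permRoots hn σ⟩
  have h1 : 𝔼 σ : Equiv.Perm (Fin n), f (fun r => gap (permRoots m σ) r)
      = 𝔼 R : {R : Finset (Fin n) // R.card = m - 1}, f (fun r => gap R.1 r) := by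
    refine expect_comp_of_transitive F (fun R R' => ?_) fun R => f (fun r => gap R.1 r)
    obtain ⟨π, hπ⟩ := exists_perm_comp_eq (R.1.orderEmbOfFin R.2).toEmbedding
      (R'.1.orderEmbOfFin R'.2).toEmbedding
    refine ⟨fun σ => π * σ, mul_right_injective π, fun σ hσ => ?_⟩
    have hσ' : permRoots m σ = R.1 := congrArg Subtype.val hσ
    refine Subtype.ext ?_
    change permRoots m (π * σ) = R'.1
    have h2 : permRoots m (π * σ) = (permRoots m σ).image π := by
      rw [permRoots_eq_map hn, permRoots_eq_map hn, Finset.map_eq_image, Finset.map_eq_image,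
        Finset.image_image]
      rfl
    rw [h2, hσ', ← Finset.image_orderEmbOfFin_univ R'.1 R'.2]
    conv_lhs => rw [← Finset.image_orderEmbOfFin_univ R.1 R.2]
    rw [Finset.image_image]
    exact Finset.image_congr fun i _ => hπ i
  have hcard : Fintype.card {R : Finset (Fin n) // R.card = m - 1} = n.choose (m - 1) := by
    simp
  have hc0 : (n.choose (m - 1) : 𝕜) ≠ 0 := Nat.cast_ne_zero.2 (Nat.choose_pos hn).ne'
  rw [h1, Fintype.expect_eq_sum_div_card, hcard, mul_div_cancel₀ _ hc0]
  let G : {R : Finset (Fin n) // R.card = m - 1} → (Fin m →₀ ℕ) := fun R =>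
    Finsupp.equivFunOnFinite.symm fun r => gap R.1 r
  have hG : Function.Injective G := by
    intro R R' h
    refine Subtype.ext (eq_of_gap_eq R.2 R'.2 fun i hi => ?_)
    exact DFunLike.congr_fun h (⟨i, by omega⟩ : Fin m)
  -- The gap vector is injective on root sets, and stars and bars gives as many compositions as
  -- there are root sets, so it is a bijection.
  have himg : Finset.univ.image G = Finset.univ.finsuppAntidiag (n - (m - 1)) := by
    refine Finset.eq_of_subset_of_card_le (fun i hi => ?_) ?_
    · obtain ⟨R, -, rfl⟩ := Finset.mem_image.1 hi
      rw [Finset.mem_finsuppAntidiag]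
      refine ⟨?_, Finset.subset_univ _⟩
      have := sum_gap (R := R.1) (m := m) (by have := R.2; omega)
      rw [R.2] at this
      exact this
    · rw [Finset.card_image_of_injective _ hG, Finset.card_univ, hcard,
        Finset.card_finsuppAntidiag_nat_eq_choose, Finset.card_univ, Fintype.card_fin]
      refine le_of_eq ?_
      rw [show m + (n - (m - 1)) - 1 = n by omega, Nat.choose_symm hn]
  rw [← himg, Finset.sum_image hG.injOn]
  rfl

-- By symmetry all `m` coordinates contribute equally. Prescribing the sum of the coordinates
-- amounts to extracting a coefficient, and each of the `m - 1` unweighted coordinates supplies a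
-- geometric series.
open PowerSeries in
lemma sum_finsuppAntidiag_sum {𝕜 : Type*} [CommRing 𝕜] (m N : ℕ) (h : ℕ → 𝕜) :
    ∑ i ∈ (Finset.univ : Finset (Fin m)).finsuppAntidiag N, ∑ r, h (i r)
      = m * coeff N (mk h * (mk 1 : 𝕜⟦X⟧) ^ (m - 1)) := by
  rw [Finset.sum_comm]
  have : ∀ r : Fin m, ∑ i ∈ (Finset.univ : Finset (Fin m)).finsuppAntidiag N, h (i r)
      = coeff N (mk h * (mk 1 : 𝕜⟦X⟧) ^ (m - 1)) := by
    intro r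
    have h1 : ∏ s : Fin m, (if s = r then mk h else mk 1 : 𝕜⟦X⟧)
        = mk h * (mk 1 : 𝕜⟦X⟧) ^ (m - 1) := by
      rw [← Finset.mul_prod_erase _ _ (Finset.mem_univ r), if_pos rfl]
      congr 1
      rw [Finset.prod_congr rfl (g := fun _ => (mk 1 : 𝕜⟦X⟧)), Finset.prod_const,
        Finset.card_erase_of_mem (Finset.mem_univ _), Finset.card_univ, Fintype.card_fin]
      intro s hs
      rw [if_neg (Finset.mem_erase.1 hs).1]
    rw [← h1, coeff_prod]
    refine Finset.sum_congr rfl fun i _ => ?_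
    rw [← Finset.mul_prod_erase _ _ (Finset.mem_univ r), if_pos rfl, coeff_mk,
      Finset.prod_eq_one, mul_one]
    intro s hs
    rw [if_neg (Finset.mem_erase.1 hs).1, coeff_mk]
    rfl
  rw [Finset.sum_congr rfl fun r _ => this r]
  simp

open PowerSeries in
/-- The expectation of an additive functional of the subtree sizes in terms of generating
functions. -/
lemma choose_mul_expect_sum_gap (hm : 2 ≤ m) (hn : m - 1 ≤ n) {𝕜 : Type*} [Field 𝕜] [CharZero 𝕜]
    (h : ℕ → 𝕜) :
    (n.choose (m - 1) : 𝕜) * 𝔼 σ : Equiv.Perm (Fin n), ∑ r : Fin m, h (gap (permRoots m σ) r)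
      = m * coeff (n - (m - 1)) (mk h * (mk 1 : 𝕜⟦X⟧) ^ (m - 1)) := by
  rw [expect_gap hm hn fun i => ∑ r, h (i r), sum_finsuppAntidiag_sum]

-- The weight (k+1)(k+2) has generating function 2(1-X)⁻³, so the product with (1-X)^{-(m-1)} is
-- again a power of (1-X) and the weight is reproduced up to a factor. This factor 2/(m+1) < 1 is
-- the contraction constant behind all second moment estimates.
open PowerSeries in
lemma expect_sum_gap_sq (hm : 2 ≤ m) (hn : m - 1 ≤ n) :
    𝔼 σ : Equiv.Perm (Fin n), ∑ r : Fin m,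
        ((gap (permRoots m σ) r + 1 : ℝ) * (gap (permRoots m σ) r + 2))
      = 2 / (m + 1) * ((n + 1) * (n + 2)) := by
  have h := choose_mul_expect_sum_gap (𝕜 := ℝ) hm hn fun k => ((k + 1 : ℝ) * (k + 2))
  have h2 : (mk fun k : ℕ => ((k + 1 : ℝ) * (k + 2))) = 2 * (mk 1 : ℝ⟦X⟧) ^ 3 := by
    rw [mk_one_pow_eq_mk_choose_add ℝ 2]
    ext k
    rw [two_mul, map_add, coeff_mk, coeff_mk, Nat.cast_choose_two]
    push_cast
    ring
  have h3 : 2 * (mk 1 : ℝ⟦X⟧) ^ 3 * (mk 1 : ℝ⟦X⟧) ^ (m - 1) = 2 * (mk 1 : ℝ⟦X⟧) ^ (m + 1 + 1) := by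
    rw [mul_assoc, ← pow_add]
    congr 2
    omega
  rw [h2, h3, mk_one_pow_eq_mk_choose_add, two_mul, map_add, coeff_mk,
    show m + 1 + (n - (m - 1)) = n + 2 by omega] at h
  have hc : ((n + 2).choose (m + 1) : ℝ) * ((m + 1) * m) = (n + 2) * (n + 1) * n.choose (m - 1) := by
    have e1 := Nat.add_one_mul_choose_eq (n + 1) m
    have e2 := Nat.add_one_mul_choose_eq n (m - 1)
    rw [Nat.sub_add_cancel (by omega)] at e2
    have e1' : ((n : ℝ) + 1 + 1) * (n + 1).choose m = (n + 2).choose (m + 1) * (m + 1) := by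
      exact_mod_cast e1
    have e2' : ((n : ℝ) + 1) * n.choose (m - 1) = (n + 1).choose m * m := by exact_mod_cast e2
    linear_combination (-(m : ℝ)) * e1' - (n + 2 : ℝ) * e2'
  have hc0 : (n.choose (m - 1) : ℝ) ≠ 0 := Nat.cast_ne_zero.2 (Nat.choose_pos hn).ne'
  rw [← mul_right_inj' hc0, h]
  field_simp
  linear_combination 2 * hc

end MaryTree
-- The Euler operator and its inversion on slowly growing series
namespace EulerOperator

open PowerSeries Nat

/-- The Euler operator `(1 - X) d/dX` on formal power series. -/
noncomputable def euler : Module.End ℂ ℂ⟦X⟧ where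
  toFun F := (1 - X) * d⁄dX ℂ F
  map_add' F G := by simp [mul_add]
  map_smul' c F := by simp

lemma euler_apply (F : ℂ⟦X⟧) : euler F = (1 - X) * d⁄dX ℂ F := rfl

lemma coeff_euler (F : ℂ⟦X⟧) (n : ℕ) :
    coeff n (euler F) = (n + 1) * coeff (n + 1) F - n * coeff n F := by
  rw [euler_apply, sub_mul, one_mul, map_sub, coeff_derivative]
  cases n with
  | zero => simp
  | succ n => rw [coeff_succ_X_mul, coeff_derivative]; push_cast; ring

/-- Applying θ + k to (1-X)^k F^{(k)} yields (1-X)^{k+1} F^{(k+1)}, since differentiating (1-X)^k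
produces a term that k cancels. So rising factorials in θ are exactly the operators that appear in
the recursion. -/
lemma aeval_euler_ascPochhammer (k : ℕ) (F : ℂ⟦X⟧) :
    Polynomial.aeval euler (ascPochhammer ℂ k) F = (1 - X) ^ k * (d⁄dX ℂ)^[k] F := by
  induction k with
  | zero => simp
  | succ k ih =>
    rw [ascPochhammer_succ_right, mul_comm, map_mul, Module.End.mul_apply, ih, map_add,
      Polynomial.aeval_X, map_natCast, LinearMap.add_apply, euler_apply, Derivation.leibniz,
      derivative_pow, Function.iterate_succ_apply']
    have h1 : d⁄dX ℂ (1 - X : ℂ⟦X⟧) = -1 := by simp [map_sub]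
    rw [h1]
    have h2 : ((k : Module.End ℂ ℂ⟦X⟧) ((1 - X) ^ k * (d⁄dX ℂ)^[k] F))
        = (k : ℂ⟦X⟧) * ((1 - X) ^ k * (d⁄dX ℂ)^[k] F) := by
      rw [Module.End.natCast_apply, nsmul_eq_mul]
    rw [h2]
    simp only [smul_eq_mul]
    rcases Nat.eq_zero_or_pos k with rfl | hk
    · simp
    · obtain ⟨j, rfl⟩ := Nat.exists_eq_add_of_le' hk
      simp only [add_tsub_cancel_right]
      push_cast
      ring

/-- The weight `∏_{k < n} (1 + a / (k + 1))`, of order `n ^ a`. -/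
noncomputable def growth (a : ℝ) (n : ℕ) : ℝ := ∏ k ∈ Finset.range n, (1 + a / (k + 1))

lemma growth_succ (a : ℝ) (n : ℕ) : growth a (n + 1) = growth a n * (1 + a / (n + 1)) :=
  Finset.prod_range_succ _ _

lemma growth_mono {a : ℝ} (ha : 0 ≤ a) : Monotone (growth a) := by
  refine monotone_nat_of_le_succ fun n => ?_
  rw [growth_succ]
  refine le_mul_of_one_le_right (Finset.prod_nonneg fun k _ => by positivity) ?_
  have : 0 ≤ a / (n + 1) := by positivity
  linarith

lemma one_le_growth {a : ℝ} (ha : 0 ≤ a) (n : ℕ) : 1 ≤ growth a n := by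
  have := growth_mono ha (Nat.zero_le n)
  simpa [growth] using this

lemma growth_le_exp {a : ℝ} (ha : 0 ≤ a) (n : ℕ) : growth a n ≤ Real.exp (a * harmonic n) := by
  induction n with
  | zero => simp [growth]
  | succ n ih =>
    have hsplit : a * ((harmonic (n + 1) : ℚ) : ℝ) = a * harmonic n + a * ((n : ℝ) + 1)⁻¹ := by
      rw [harmonic_succ]
      push_cast
      ring
    rw [growth_succ, hsplit, Real.exp_add]
    refine mul_le_mul ih ?_ (by positivity) (Real.exp_pos _).le
    have := Real.add_one_le_exp (a / (n + 1))
    rw [← div_eq_mul_inv]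
    linarith

lemma tendsto_growth_div {a : ℝ} (ha : 0 ≤ a) (ha1 : a < 1) :
    Tendsto (fun n : ℕ => growth a n / (n + 1)) atTop (𝓝 0) := by
  have h1 : Tendsto (fun n : ℕ => Real.exp (a + -((1 - a) * Real.log (n + 1)))) atTop (𝓝 0) := by
    refine Real.tendsto_exp_atBot.comp (tendsto_atBot_add_const_left _ _ ?_)
    refine tendsto_neg_atTop_atBot.comp (Tendsto.const_mul_atTop (by linarith) ?_)
    exact Real.tendsto_log_atTop.comp
      (tendsto_atTop_add_const_right _ _ tendsto_natCast_atTop_atTop)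
  refine squeeze_zero (fun n => ?_) (fun n => ?_) h1
  · have := one_le_growth ha n
    positivity
  · have hn : (0 : ℝ) < n + 1 := by positivity
    rw [div_le_iff₀ hn]
    refine (growth_le_exp ha n).trans ?_
    have hlog : (harmonic n : ℝ) ≤ 1 + Real.log (n + 1) := by
      have h2 := harmonic_le_one_add_log (n + 1)
      have h3 : harmonic n ≤ harmonic (n + 1) := by
        rw [harmonic_succ]
        exact le_add_of_nonneg_right (by positivity)
      have h4 : (harmonic n : ℝ) ≤ harmonic (n + 1) := by exact_mod_cast h3
      push_cast at h2
      linarith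
    have hexp : Real.exp (a + -((1 - a) * Real.log (n + 1))) * (n + 1)
        = Real.exp (a + -((1 - a) * Real.log (n + 1)) + Real.log (n + 1)) := by
      rw [Real.exp_add _ (Real.log _), Real.exp_log hn]
    rw [hexp, Real.exp_le_exp]
    nlinarith

/-- The power series whose coefficients are dominated by a multiple of `growth a`. -/
def slowSeries (a : ℝ) (_ha : 0 ≤ a) : Submodule ℂ ℂ⟦X⟧ where
  carrier := {F | ∃ C : ℝ, ∀ n, ‖coeff n F‖ ≤ C * growth a n}
  zero_mem' := ⟨0, fun n => by simp⟩
  add_mem' := by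
    rintro F G ⟨C, hC⟩ ⟨D, hD⟩
    exact ⟨C + D, fun n => by
      rw [map_add, add_mul]
      exact (norm_add_le _ _).trans (add_le_add (hC n) (hD n))⟩
  smul_mem' := by
    rintro c F ⟨C, hC⟩
    exact ⟨‖c‖ * C, fun n => by
      rw [coeff_smul, norm_smul, mul_assoc]
      exact mul_le_mul_of_nonneg_left (hC n) (norm_nonneg _)⟩

lemma mem_slowSeries_of_eventually_zero {a : ℝ} (ha : 0 ≤ a) {F : ℂ⟦X⟧} (N : ℕ)
    (h : ∀ n, N ≤ n → coeff n F = 0) : F ∈ slowSeries a ha := by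
  refine ⟨∑ k ∈ Finset.range N, ‖coeff k F‖, fun n => ?_⟩
  have h1 := one_le_growth ha n
  have h0 : 0 ≤ ∑ k ∈ Finset.range N, ‖coeff k F‖ := Finset.sum_nonneg fun _ _ => norm_nonneg _
  by_cases hn : n < N
  · have := Finset.single_le_sum (f := fun k => ‖coeff k F‖) (fun _ _ => norm_nonneg _)
      (Finset.mem_range.2 hn)
    nlinarith
  · rw [h n (not_lt.1 hn), norm_zero]
    positivity

/-- For large `n` only the real part of `lam` matters to first order: |n + λ| = n + Re λ + O(1/n).
-/
lemma exists_norm_natCast_add_le (lam : ℂ) {η : ℝ} (hη : 0 < η) :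
    ∃ N : ℕ, ∀ n : ℕ, N ≤ n → ‖(n : ℂ) + lam‖ ≤ n + lam.re + η := by
  -- The first bound gives |λ|² ≤ 2ηn, which suffices when the squares of both sides are compared;
  -- the second makes the right-hand side nonnegative.
  obtain ⟨N, hN⟩ := exists_nat_ge (max (‖lam‖ ^ 2 / (2 * η)) (|lam.re + η|))
  refine ⟨N, fun n hn => ?_⟩
  have hn' : (N : ℝ) ≤ n := by exact_mod_cast hn
  have h1 : ‖lam‖ ^ 2 / (2 * η) ≤ n := (le_max_left _ _).trans (hN.trans hn')
  have h2 : |lam.re + η| ≤ n := (le_max_right _ _).trans (hN.trans hn')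
  rw [div_le_iff₀ (by positivity)] at h1
  have h3 := neg_abs_le (lam.re + η)
  refine abs_le_of_sq_le_sq' ?_ (by linarith) |>.2
  rw [← Complex.normSq_eq_norm_sq, Complex.normSq_apply] at h1 ⊢
  simp only [Complex.add_re, Complex.natCast_re, Complex.add_im, Complex.natCast_im, zero_add]
  nlinarith [sq_nonneg (lam.re + η)]

/-- The operator `euler - lam` can be inverted within the slow series if `lam.re < 1 + a`. -/
lemma mem_slowSeries_of_euler_sub {a : ℝ} (ha : 0 ≤ a) {lam : ℂ} (hlam : lam.re < 1 + a)
    {F : ℂ⟦X⟧} (h : euler F - lam • F ∈ slowSeries a ha) : F ∈ slowSeries a ha := by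
  obtain ⟨C, hC⟩ := h
  have hC0 : 0 ≤ C := by
    have := (norm_nonneg _).trans (hC 0)
    simpa [growth] using this
  set η := (1 + a - lam.re) / 2 with hη_def
  have hη : 0 < η := by rw [hη_def]; linarith
  obtain ⟨N, hN⟩ := exists_norm_natCast_add_le lam hη
  set S := ∑ k ∈ Finset.range (N + 1), ‖coeff k F‖ with hS
  have hS0 : 0 ≤ S := Finset.sum_nonneg fun _ _ => norm_nonneg _
  -- The coefficients satisfy (n+1)F_{n+1} = (n+λ)F_n + G_n with |n+λ| ≤ n+1+a-η. The term `C / η`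
  -- makes the forcing at most ηD·growth, so the total is at most (n+1+a)D·growth, as the growth
  -- recursion requires; `S` covers the indices up to `N`.
  set D := C / η + S with hD
  have hDη : C ≤ η * D := by
    have : η * (C / η) = C := by field_simp
    nlinarith
  have hD0 : 0 ≤ D := by positivity
  have hsmall : ∀ n, n ≤ N → ‖coeff n F‖ ≤ D * growth a n := by
    intro n hn
    have := Finset.single_le_sum (f := fun k => ‖coeff k F‖) (fun _ _ => norm_nonneg _)
      (Finset.mem_range.2 (Nat.lt_succ_of_le hn))
    have h1 := one_le_growth ha n
    have h2 : 0 ≤ C / η := by positivity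
    nlinarith
  refine ⟨D, fun n => ?_⟩
  rcases le_total n N with hn | hn
  · exact hsmall n hn
  induction n, hn using Nat.le_induction with
  | base => exact hsmall N le_rfl
  | succ n hn ih =>
    have hrec : ((n : ℂ) + 1) * coeff (n + 1) F
        = (n + lam) * coeff n F + coeff n (euler F - lam • F) := by
      rw [map_sub, coeff_euler, coeff_smul]
      ring
    have hn1 : (0 : ℝ) < n + 1 := by positivity
    have hnorm : ((n : ℝ) + 1) * ‖coeff (n + 1) F‖
        ≤ (n + lam.re + η) * (D * growth a n) + C * growth a n := by
      have e1 : ((n : ℝ) + 1) * ‖coeff (n + 1) F‖ = ‖((n : ℂ) + 1) * coeff (n + 1) F‖ := by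
        rw [norm_mul]
        congr 1
        have : ((n : ℂ) + 1) = ((n + 1 : ℕ) : ℂ) := by push_cast; ring
        rw [this, Complex.norm_natCast]
        push_cast; ring
      rw [e1, hrec]
      refine (norm_add_le _ _).trans (add_le_add ?_ (hC n))
      rw [norm_mul]
      exact mul_le_mul (hN n hn) ih (norm_nonneg _) ((norm_nonneg _).trans (hN n hn))
    have hg := one_le_growth ha n
    have hfin : ((n : ℝ) + 1) * (D * growth a (n + 1)) = (n + 1 + a) * (D * growth a n) := by
      rw [growth_succ]
      field_simp
    have : ((n : ℝ) + 1) * ‖coeff (n + 1) F‖ ≤ (n + 1) * (D * growth a (n + 1)) := by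
      rw [hfin]
      refine hnorm.trans ?_
      have : η = 1 + a - lam.re - η := by rw [hη_def]; ring
      have h5 : (n + lam.re + η) + η = n + 1 + a := by linarith
      rw [← h5]
      nlinarith
    exact le_of_mul_le_mul_left this hn1

lemma mem_slowSeries_of_aeval_prod {a : ℝ} (ha : 0 ≤ a) (s : Multiset ℂ)
    (hs : ∀ lam ∈ s, lam.re < 1 + a) {F : ℂ⟦X⟧}
    (h : Polynomial.aeval euler (s.map fun lam => Polynomial.X - Polynomial.C lam).prod F
      ∈ slowSeries a ha) : F ∈ slowSeries a ha := by
  induction s using Multiset.induction with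
  | empty => simpa using h
  | cons lam s ih =>
    refine ih (fun l hl => hs l (Multiset.mem_cons_of_mem hl)) ?_
    refine mem_slowSeries_of_euler_sub ha (hs lam (Multiset.mem_cons_self _ _)) ?_
    rw [Multiset.map_cons, Multiset.prod_cons, map_mul, Module.End.mul_apply] at h
    simpa [Algebra.algebraMap_eq_smul_one] using h

/-- The indicial polynomial of the recurrence. -/
noncomputable def indicial (m : ℕ) : Polynomial ℂ :=
  ascPochhammer ℂ (m - 1) - Polynomial.C (m ! : ℂ)

lemma eval_ascPochhammer_eq_prod (k : ℕ) (z : ℂ) :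
    (ascPochhammer ℂ k).eval z = ∏ j ∈ Finset.range k, (z + j) := by
  induction k with
  | zero => simp
  | succ k ih => rw [ascPochhammer_succ_eval, ih, Finset.prod_range_succ]

lemma prod_range_two_add (k : ℕ) : ∏ j ∈ Finset.range k, (2 + j : ℝ) = (k + 1)! := by
  induction k with
  | zero => simp
  | succ k ih => rw [Finset.prod_range_succ, ih, Nat.factorial_succ (k + 1)]; push_cast; ring

lemma eval_two_ascPochhammer (k : ℕ) : (ascPochhammer ℂ k).eval 2 = ((k + 1)! : ℂ) := by
  rw [eval_ascPochhammer_eq_prod]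
  have := congrArg (fun x : ℝ => (x : ℂ)) (prod_range_two_add k)
  push_cast at this
  exact this

/-- If Re λ ≥ 2, then |λ+j| ≥ 2+j for all j, and the product of these lower bounds is already m!. At
j = 0 equality holds only for λ = 2. -/
lemma re_lt_two_of_isRoot {m : ℕ} (hm : 2 ≤ m) {lam : ℂ} (h : (indicial m).IsRoot lam)
    (h2 : lam ≠ 2) : lam.re < 2 := by
  by_contra hre
  rw [not_lt] at hre
  rw [Polynomial.IsRoot, indicial, Polynomial.eval_sub, Polynomial.eval_C, sub_eq_zero,
    eval_ascPochhammer_eq_prod] at h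
  have hnorm := congrArg norm h
  rw [norm_prod, Complex.norm_natCast] at hnorm
  have hm1 : m - 1 + 1 = m := by omega
  have hlt : ∏ j ∈ Finset.range (m - 1), (2 + j : ℝ)
      < ∏ j ∈ Finset.range (m - 1), ‖lam + (j : ℂ)‖ := by
    have hj : ∀ j : ℕ, (2 + j : ℝ) ≤ ‖lam + (j : ℂ)‖ := fun j => by
      have := Complex.re_le_norm (lam + j)
      simp only [Complex.add_re, Complex.natCast_re] at this
      linarith
    refine Finset.prod_lt_prod (fun j _ => by positivity) (fun j _ => hj j)
      ⟨0, Finset.mem_range.2 (by omega), ?_⟩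
    refine lt_of_le_of_ne (hj 0) fun he => h2 ?_
    simp only [Nat.cast_zero, add_zero] at he
    have h3 := Complex.re_le_norm lam
    have hre2 : lam.re = 2 := le_antisymm (by linarith) hre
    have h4 := Complex.normSq_eq_norm_sq lam
    rw [← he, Complex.normSq_apply, hre2] at h4
    have him : lam.im = 0 := by nlinarith
    exact Complex.ext (by simpa using hre2) (by simpa using him)
  rw [prod_range_two_add, hm1, hnorm] at hlt
  exact lt_irrefl _ hlt

/-- The logarithmic derivative at 2 is 1/2 + 1/3 + ⋯ + 1/(k+1). Through this value the harmonic
number enters the constant φ. -/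
lemma derivative_ascPochhammer_eval_two (k : ℕ) :
    (Polynomial.derivative (ascPochhammer ℂ k)).eval 2
      = (k + 1)! * ((harmonic (k + 1) : ℂ) - 1) := by
  induction k with
  | zero => simp
  | succ k ih =>
    rw [ascPochhammer_succ_right, Polynomial.derivative_mul, Polynomial.eval_add,
      Polynomial.eval_mul, Polynomial.eval_mul, ih, eval_two_ascPochhammer, harmonic_succ (k + 1),
      Nat.factorial_succ (k + 1)]
    simp only [Polynomial.eval_add, Polynomial.eval_X, Polynomial.eval_natCast,
      Polynomial.derivative_add, Polynomial.derivative_X, Polynomial.derivative_natCast, add_zero,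
      Polynomial.eval_one]
    have : ((k : ℂ) + 2) ≠ 0 := by
      have : ((k + 2 : ℕ) : ℂ) ≠ 0 := Nat.cast_ne_zero.2 (by omega)
      exact_mod_cast this
    push_cast
    have e : ((k : ℂ) + 1 + 1) = k + 2 := by ring
    rw [e]
    field_simp
    ring

/-- The indicial polynomial with the root `2` split off. -/
noncomputable def cofactor (m : ℕ) : Polynomial ℂ :=
  indicial m /ₘ (Polynomial.X - Polynomial.C 2)

variable {m : ℕ}

lemma sub_two_mul_cofactor (hm : 2 ≤ m) :
    (Polynomial.X - Polynomial.C 2) * cofactor m = indicial m := by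
  rw [cofactor, Polynomial.mul_divByMonic_eq_iff_isRoot, Polynomial.IsRoot, indicial,
    Polynomial.eval_sub, Polynomial.eval_C, eval_two_ascPochhammer, Nat.sub_add_cancel (by omega),
    sub_self]

lemma cofactor_eval_two (hm : 2 ≤ m) :
    (cofactor m).eval 2 = m ! * ((harmonic m : ℂ) - 1) := by
  have h := congrArg (fun p => (Polynomial.derivative p).eval 2) (sub_two_mul_cofactor hm)
  simp only [Polynomial.derivative_mul, Polynomial.derivative_sub, Polynomial.derivative_X,
    Polynomial.derivative_C, indicial, derivative_ascPochhammer_eval_two, Polynomial.eval_add,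
    Polynomial.eval_mul, Polynomial.eval_sub, Polynomial.eval_X, Polynomial.eval_C,
    Polynomial.eval_one, Polynomial.eval_zero, Nat.sub_add_cancel (show 1 ≤ m by omega)] at h
  simpa using h

lemma one_lt_harmonic (hm : 2 ≤ m) : (1 : ℝ) < harmonic m := by
  obtain ⟨k, rfl⟩ := Nat.exists_eq_add_of_le' hm
  have : (1 : ℚ) < harmonic (k + 2) := by
    induction k with
    | zero => norm_num [harmonic, Finset.sum_range_succ]
    | succ k ih =>
      rw [show k + 1 + 2 = (k + 2) + 1 by ring, harmonic_succ]
      exact (ih (by omega)).trans_le (le_add_of_nonneg_right (by positivity))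
  exact_mod_cast this

lemma cofactor_eval_two_ne_zero (hm : 2 ≤ m) : (cofactor m).eval 2 ≠ 0 := by
  rw [cofactor_eval_two hm]
  refine mul_ne_zero (Nat.cast_ne_zero.2 (Nat.factorial_ne_zero m)) ?_
  have := one_lt_harmonic hm
  have h2 : ((harmonic m : ℝ) - 1 : ℝ) ≠ 0 := by linarith
  exact_mod_cast h2

lemma cofactor_monic (hm : 2 ≤ m) : (cofactor m).Monic := by
  have h1 : (indicial m).Monic := by
    refine (monic_ascPochhammer ℂ (m - 1)).sub_of_left ?_
    refine Polynomial.degree_C_le.trans_lt ?_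
    rw [Polynomial.degree_eq_natDegree (monic_ascPochhammer ℂ _).ne_zero, ascPochhammer_natDegree]
    exact_mod_cast (by omega : 0 < m - 1)
  rw [← sub_two_mul_cofactor hm] at h1
  exact (Polynomial.monic_X_sub_C 2).of_mul_monic_left h1

/-- There are only finitely many roots to consider, so the strict bounds on their real parts hold
with a common margin. -/
lemma exists_exponent (s : Finset ℂ) (h : ∀ z ∈ s, z.re < 2) :
    ∃ a : ℝ, 0 ≤ a ∧ a < 1 ∧ ∀ z ∈ s, z.re < 1 + a := by
  induction s using Finset.induction with
  | empty => exact ⟨0, le_rfl, one_pos, by simp⟩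
  | insert x s hx ih =>
    obtain ⟨a, h0, h1, h2⟩ := ih fun z hz => h z (Finset.mem_insert_of_mem hz)
    have hx2 := h x (Finset.mem_insert_self _ _)
    refine ⟨max a (x.re / 2), le_max_of_le_left h0, max_lt h1 (by linarith), fun z hz => ?_⟩
    rcases Finset.mem_insert.1 hz with rfl | hz
    · have := le_max_right a (z.re / 2)
      linarith
    · have := le_max_left a (x.re / 2)
      linarith [h2 z hz]

/-- There is an exponent `a < 1` for which the cofactor can be inverted on slow series. -/
lemma exists_exponent_cofactor (hm : 2 ≤ m) : ∃ a : ℝ, ∃ ha : 0 ≤ a, a < 1 ∧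
    ∀ F : ℂ⟦X⟧, Polynomial.aeval euler (cofactor m) F ∈ slowSeries a ha → F ∈ slowSeries a ha := by
  obtain ⟨a, ha, ha1, h⟩ := exists_exponent (cofactor m).roots.toFinset fun z hz => by
    rw [Multiset.mem_toFinset, Polynomial.mem_roots (cofactor_monic hm).ne_zero] at hz
    -- A root of the cofactor is a root of the indicial polynomial, and it differs from 2 because 2
    -- is a simple root.
    refine re_lt_two_of_isRoot hm ?_ fun h2 => cofactor_eval_two_ne_zero hm (h2 ▸ hz)
    rw [← sub_two_mul_cofactor hm, Polynomial.IsRoot, Polynomial.eval_mul, hz.eq_zero, mul_zero]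
  refine ⟨a, ha, ha1, fun F hF => ?_⟩
  refine mem_slowSeries_of_aeval_prod ha (cofactor m).roots
    (fun z hz => h z (Multiset.mem_toFinset.2 hz)) ?_
  rwa [← (IsAlgClosed.splits (cofactor m)).eq_prod_roots_of_monic (cofactor_monic hm)]

lemma euler_sub_two_mem {a : ℝ} {ha : 0 ≤ a} (hm : 2 ≤ m)
    (hinv : ∀ F : ℂ⟦X⟧, Polynomial.aeval euler (cofactor m) F ∈ slowSeries a ha →
      F ∈ slowSeries a ha) {F : ℂ⟦X⟧}
    (hF : Polynomial.aeval euler (indicial m) F ∈ slowSeries a ha) :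
    euler F - (2 : ℂ) • F ∈ slowSeries a ha := by
  refine hinv _ ?_
  rw [← sub_two_mul_cofactor hm, mul_comm, map_mul, Module.End.mul_apply] at hF
  simpa [Algebra.algebraMap_eq_smul_one, ofNat_smul_eq_nsmul] using hF

/-- This exhibits growth/((n+1)(n+2)) as a telescoping difference, which sums the increments of
coefficient/(n+1) in closed form. -/
lemma growth_div_sub {a : ℝ} (n : ℕ) :
    growth a n / (n + 1) - growth a (n + 1) / ((n + 1 : ℕ) + 1)
      = (1 - a) * (growth a n / ((n + 1) * (n + 2))) := by
  rw [growth_succ]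
  push_cast
  have h1 : (n : ℝ) + 1 ≠ 0 := by positivity
  have h2 : (n : ℝ) + 2 ≠ 0 := by positivity
  have h3 : (n : ℝ) + 1 + 1 ≠ 0 := by positivity
  field_simp
  ring

/-- A series that is slow after applying `euler - 2` is linear up to a slow error. -/
lemma exists_linear_of_euler_sub_two_mem {a : ℝ} {ha : 0 ≤ a} (ha1 : a < 1) {F : ℂ⟦X⟧}
    (hF : euler F - (2 : ℂ) • F ∈ slowSeries a ha) :
    ∃ l : ℂ, F - l • mk (fun n : ℕ => (n + 1 : ℂ)) ∈ slowSeries a ha := by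
  obtain ⟨C, hC⟩ := hF
  have ha1' : 0 < 1 - a := by linarith
  set r : ℕ → ℝ := fun n => growth a n / (n + 1) with hr
  set e : ℕ → ℂ := fun n => coeff n F / (n + 1) with he
  -- Dividing by n+1, the solution of the homogeneous equation, turns θ - 2 into a plain difference
  -- operator. The quotients `e` are Cauchy, and `l` will be their limit.
  have hstep : ∀ n, ‖e (n + 1) - e n‖ ≤ C / (1 - a) * (r n - r (n + 1)) := by
    intro n
    have h1 : ((n : ℂ) + 1) ≠ 0 := by exact_mod_cast (Nat.succ_ne_zero n)
    have h2 : ((n : ℂ) + 2) ≠ 0 := by exact_mod_cast (Nat.succ_ne_zero (n + 1))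
    have h3 : e (n + 1) - e n
        = coeff n (euler F - (2 : ℂ) • F) / ((n + 1 : ℕ) * (n + 2 : ℕ) : ℂ) := by
      rw [map_sub, coeff_euler, coeff_smul]
      simp only [he]
      push_cast
      have h4 : (n : ℂ) + 1 + 1 = n + 2 := by ring
      rw [h4, smul_eq_mul]
      field_simp
      ring
    rw [h3, norm_div, norm_mul, Complex.norm_natCast, Complex.norm_natCast]
    have h5 := growth_div_sub (a := a) n
    have h6 : r n - r (n + 1) = (1 - a) * (growth a n / ((n + 1) * (n + 2))) := by
      rw [← h5]
    have h7 : C / (1 - a) * ((1 - a) * (growth a n / ((n + 1) * (n + 2))))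
        = C * growth a n / ((n + 1) * (n + 2)) := by
      field_simp
    rw [h6, h7]
    push_cast
    exact div_le_div_of_nonneg_right (hC n) (by positivity)
  set D := C / (1 - a) with hD
  have hD0 : 0 ≤ D := by
    have := (norm_nonneg _).trans (hC 0)
    have : 0 ≤ C := by simpa [growth] using this
    positivity
  have hr0 : ∀ n, 0 ≤ r n := fun n => by
    have := one_le_growth ha n
    simp only [hr]
    positivity
  have hdiff : ∀ n k, n ≤ k → ‖e k - e n‖ ≤ D * (r n - r k) := by
    intro n k hk
    induction k, hk using Nat.le_induction with
    | base => simp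
    | succ k hk ih =>
      have : e (k + 1) - e n = (e (k + 1) - e k) + (e k - e n) := by ring
      rw [this]
      refine (norm_add_le _ _).trans ((add_le_add (hstep k) ih).trans (le_of_eq ?_))
      ring
  have hdiff' : ∀ n k, n ≤ k → ‖e k - e n‖ ≤ D * r n := fun n k hk =>
    (hdiff n k hk).trans (mul_le_mul_of_nonneg_left (by linarith [hr0 k]) hD0)
  have hrlim : Tendsto r atTop (𝓝 0) := tendsto_growth_div ha ha1
  have hcauchy : CauchySeq e := by
    refine cauchySeq_of_le_tendsto_0 (fun N => 2 * (D * r N)) (fun n k N hn hk => ?_) ?_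
    · rw [dist_eq_norm, show e n - e k = (e n - e N) - (e k - e N) by ring]
      refine (norm_sub_le _ _).trans ?_
      have := hdiff' N n hn
      have := hdiff' N k hk
      linarith
    · simpa using (hrlim.const_mul D).const_mul 2
  obtain ⟨l, hl⟩ := cauchySeq_tendsto_of_complete hcauchy
  have hlim : ∀ n, ‖l - e n‖ ≤ D * r n := fun n =>
    le_of_tendsto ((hl.sub_const (e n)).norm) (eventually_atTop.2 ⟨n, fun k hk => hdiff' n k hk⟩)
  refine ⟨l, D, fun n => ?_⟩
  have h1 : ((n : ℂ) + 1) ≠ 0 := by exact_mod_cast (Nat.succ_ne_zero n)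
  have h2 : coeff n (F - l • mk fun n : ℕ => (n + 1 : ℂ)) = -(((n + 1 : ℕ) : ℂ) * (l - e n)) := by
    rw [map_sub, coeff_smul, coeff_mk]
    simp only [he]
    push_cast
    rw [smul_eq_mul]
    field_simp
    ring
  rw [h2, norm_neg, norm_mul, Complex.norm_natCast]
  have h3 := mul_le_mul_of_nonneg_left (hlim n) (Nat.cast_nonneg (α := ℝ) (n + 1))
  refine h3.trans (le_of_eq ?_)
  simp only [hr]
  push_cast
  field_simp

end EulerOperator
-- Transfer theorems: from tolls to expectations
namespace EulerOperator

open PowerSeries Nat MaryTree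

lemma aeval_apply_of_eigen {F : ℂ⟦X⟧} {lam : ℂ} (h : euler F = lam • F) (p : Polynomial ℂ) :
    Polynomial.aeval euler p F = p.eval lam • F := by
  induction p using Polynomial.induction_on' with
  | add p q hp hq => rw [map_add, LinearMap.add_apply, hp, hq, Polynomial.eval_add, add_smul]
  | monomial n c =>
    have : ∀ k : ℕ, (euler ^ k) F = lam ^ k • F := by
      intro k
      induction k with
      | zero => simp
      | succ k ih => rw [_root_.pow_succ', Module.End.mul_apply, ih, map_smul, h, smul_smul, _root_.pow_succ]
    rw [Polynomial.aeval_monomial, Polynomial.eval_monomial, Module.End.mul_apply, this,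
      Module.algebraMap_end_apply, smul_smul]

lemma euler_mk_succ : euler (mk fun n : ℕ => (n + 1 : ℂ)) = (2 : ℂ) • mk fun n : ℕ => (n + 1 : ℂ) := by
  ext n
  rw [coeff_euler, coeff_smul, coeff_mk, coeff_mk, smul_eq_mul]
  push_cast
  ring

lemma euler_mk_one : euler (mk 1) = (1 : ℂ) • mk 1 := by
  ext n
  rw [coeff_euler, coeff_smul, coeff_mk, coeff_mk]
  simp

lemma one_sub_X_pow_mem {a : ℝ} (ha : 0 ≤ a) (k : ℕ) : ((1 - X) ^ k : ℂ⟦X⟧) ∈ slowSeries a ha := by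
  have : ((1 - X) ^ k : ℂ⟦X⟧) = (((1 - Polynomial.X) ^ k : Polynomial ℂ) : ℂ⟦X⟧) := by simp
  refine mem_slowSeries_of_eventually_zero ha (((1 - Polynomial.X) ^ k : Polynomial ℂ).natDegree + 1)
    fun n hn => ?_
  rw [this, Polynomial.coeff_coe]
  exact Polynomial.coeff_eq_zero_of_natDegree_lt hn

variable {m : ℕ}

/-- The recurrence for the expectation of an additive functional, as a differential equation. -/
lemma aeval_indicial_of_recurrence (hm : 2 ≤ m) {d t : ℕ → ℂ}
    (h : ∀ n, m ≤ n →
      d n = 𝔼 σ : Equiv.Perm (Fin n), ∑ r : Fin m, d (gap (permRoots m σ) r) + t n) :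
    Polynomial.aeval euler (indicial m) (mk d - mk t)
      = (m ! : ℂ) • mk t
        + ((m - 1)! * (d (m - 1) - t (m - 1)) - m ! * d 0) • (1 - X) ^ (m - 1) := by
  have hfac : (m ! : ℂ) = (m - 1)! * m := by
    have := Nat.mul_factorial_pred (show m ≠ 0 by omega)
    rw [← this]; push_cast; ring
  -- The coefficient of index `N` on the left concerns `N + (m - 1)` keys. For `N ≥ 1` the
  -- recurrence applies; for `N = 0` the index `m - 1` precedes its range, and the constant term
  -- makes up for the initial values.
  have hder : (d⁄dX ℂ)^[m - 1] (mk d - mk t) = (m ! : ℂ) • (mk d * (mk 1) ^ (m - 1))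
      + C ((m - 1)! * (d (m - 1) - t (m - 1)) - m ! * d 0) := by
    ext N
    rw [coeff_iterate_derivative, Nat.ascFactorial_eq_factorial_mul_choose, map_sub, coeff_mk,
      coeff_mk, map_add, coeff_smul]
    rcases Nat.eq_zero_or_pos N with rfl | hN
    · simp
    · have h1 := choose_mul_expect_sum_gap hm (show m - 1 ≤ N + (m - 1) by omega) d
      rw [Nat.add_sub_cancel] at h1
      rw [h (N + (m - 1)) (by omega), add_sub_cancel_right, coeff_C, if_neg (by omega), add_zero,
        smul_eq_mul, hfac, mul_assoc, ← h1]
      push_cast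
      ring
  -- Multiplication by (1-X)^{m-1} cancels the `m - 1` geometric series and leaves m! times the
  -- series of `d` itself.
  have h1X : ((1 - X) ^ (m - 1) : ℂ⟦X⟧) * (mk 1) ^ (m - 1) = 1 := by
    rw [← mul_pow, mul_comm, mk_one_mul_one_sub_eq_one, one_pow]
  have hC : ∀ (c : ℂ) (F : ℂ⟦X⟧), F * C c = c • F := fun c F => by
    rw [smul_eq_C_mul, mul_comm]
  have hsub : Polynomial.aeval euler (indicial m) = Polynomial.aeval euler (ascPochhammer ℂ (m - 1))
      - Polynomial.aeval euler (Polynomial.C (m ! : ℂ)) := by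
    rw [indicial, map_sub]
  rw [hsub, LinearMap.sub_apply, aeval_euler_ascPochhammer, hder, Polynomial.aeval_C,
    Module.algebraMap_end_apply, mul_add, hC, mul_smul_comm, mul_left_comm, h1X, mul_one, smul_sub]
  abel

/-- The exponent that governs the error terms in the asymptotics of expectations. -/
noncomputable def slowExponent (hm : 2 ≤ m) : ℝ := (exists_exponent_cofactor hm).choose

lemma slowExponent_nonneg (hm : 2 ≤ m) : 0 ≤ slowExponent hm :=
  (exists_exponent_cofactor hm).choose_spec.choose

lemma slowExponent_lt_one (hm : 2 ≤ m) : slowExponent hm < 1 :=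
  (exists_exponent_cofactor hm).choose_spec.choose_spec.1

/-- The order of the error terms in the asymptotics of expectations. -/
noncomputable def slow (hm : 2 ≤ m) : ℕ → ℝ := growth (slowExponent hm)

lemma slow_mono (hm : 2 ≤ m) : Monotone (slow hm) := growth_mono (slowExponent_nonneg hm)

lemma one_le_slow (hm : 2 ≤ m) (n : ℕ) : 1 ≤ slow hm n := one_le_growth (slowExponent_nonneg hm) n

lemma tendsto_slow_div (hm : 2 ≤ m) : Tendsto (fun n : ℕ => slow hm n / (n + 1)) atTop (𝓝 0) :=
  tendsto_growth_div (slowExponent_nonneg hm) (slowExponent_lt_one hm)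

lemma exists_linear (hm : 2 ≤ m) {F : ℂ⟦X⟧} (hF : Polynomial.aeval euler (indicial m) F
      ∈ slowSeries (slowExponent hm) (slowExponent_nonneg hm)) :
    ∃ l : ℂ, F - l • mk (fun n : ℕ => (n + 1 : ℂ))
      ∈ slowSeries (slowExponent hm) (slowExponent_nonneg hm) :=
  exists_linear_of_euler_sub_two_mem (slowExponent_lt_one hm)
    (euler_sub_two_mem hm (exists_exponent_cofactor hm).choose_spec.choose_spec.2 hF)

lemma euler_mem (hm : 2 ≤ m) {F : ℂ⟦X⟧} (hF : Polynomial.aeval euler (indicial m) F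
      ∈ slowSeries (slowExponent hm) (slowExponent_nonneg hm))
    (hF' : F ∈ slowSeries (slowExponent hm) (slowExponent_nonneg hm)) :
    euler F ∈ slowSeries (slowExponent hm) (slowExponent_nonneg hm) := by
  have h := euler_sub_two_mem hm (exists_exponent_cofactor hm).choose_spec.choose_spec.2 hF
  have h2 := Submodule.add_mem _ h (Submodule.smul_mem _ (2 : ℂ) hF')
  rwa [sub_add_cancel] at h2

lemma exists_re_bound (hm : 2 ≤ m) {d : ℕ → ℝ} {f : ℕ → ℝ} {l : ℂ}
    (h : mk (fun n => ((d n - f n : ℝ) : ℂ)) - l • mk (fun n : ℕ => (n + 1 : ℂ))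
      ∈ slowSeries (slowExponent hm) (slowExponent_nonneg hm)) :
    ∃ C : ℝ, ∀ n, |d n - f n - l.re * (n + 1)| ≤ C * slow hm n := by
  obtain ⟨C, hC⟩ := h
  refine ⟨C, fun n => ?_⟩
  refine le_trans ?_ (hC n)
  rw [map_sub, coeff_smul, coeff_mk, coeff_mk]
  refine le_trans (le_of_eq ?_) (Complex.abs_re_le_norm _)
  congr 1
  have : ((n : ℂ) + 1) = ((n + 1 : ℝ) : ℂ) := by push_cast; ring
  rw [this, Complex.sub_re, smul_eq_mul, Complex.re_mul_ofReal, Complex.ofReal_re]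

lemma recurrence_ofReal {d t : ℕ → ℝ} (h : ∀ n, m ≤ n →
      d n = 𝔼 σ : Equiv.Perm (Fin n), ∑ r : Fin m, d (gap (permRoots m σ) r) + t n) :
    ∀ n, m ≤ n → (d n : ℂ)
      = 𝔼 σ : Equiv.Perm (Fin n), ∑ r : Fin m, (d (gap (permRoots m σ) r) : ℂ) + (t n : ℂ) := by
  intro n hn
  rw [h n hn]
  simp only [Fintype.expect_eq_sum_div_card]
  push_cast
  rfl

/-- **Transfer**: a slow toll leads to a linear expectation with a slow error. -/
theorem exists_linear_of_slow_toll (hm : 2 ≤ m) {d t : ℕ → ℝ} (h : ∀ n, m ≤ n →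
      d n = 𝔼 σ : Equiv.Perm (Fin n), ∑ r : Fin m, d (gap (permRoots m σ) r) + t n)
    {C : ℝ} (ht : ∀ n, |t n| ≤ C * slow hm n) :
    ∃ l C : ℝ, ∀ n, |d n - l * (n + 1)| ≤ C * slow hm n := by
  have hT : mk (fun n => (t n : ℂ)) ∈ slowSeries (slowExponent hm) (slowExponent_nonneg hm) :=
    ⟨C, fun n => by rw [coeff_mk, Complex.norm_real]; exact ht n⟩
  have h1 := aeval_indicial_of_recurrence hm (recurrence_ofReal h)
  obtain ⟨l, hl⟩ := exists_linear hm (h1 ▸ Submodule.add_mem _ (Submodule.smul_mem _ _ hT)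
    (Submodule.smul_mem _ _ (one_sub_X_pow_mem _ _)))
  have h2 := Submodule.add_mem _ hl hT
  obtain ⟨C', hC'⟩ := exists_re_bound hm (d := d) (f := fun _ => 0) (l := l) (by
    convert h2 using 1
    simp only [sub_zero]
    abel)
  exact ⟨l.re, C', fun n => by simpa using hC' n⟩

/-- **Transfer** for the toll `n - (m - 1)`. -/
theorem exists_harmonic_of_linear_toll (hm : 2 ≤ m) {d : ℕ → ℝ} (h : ∀ n, m ≤ n →
      d n = 𝔼 σ : Equiv.Perm (Fin n), ∑ r : Fin m, d (gap (permRoots m σ) r) + (n - (m - 1))) :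
    ∃ l C : ℝ, ∀ n, |d n - 2 * occupancy m * ((n + 1) * (harmonic (n + 1) - 1)) - l * (n + 1)|
      ≤ C * slow hm n := by
  have hH := one_lt_harmonic hm
  set ph : ℂ := ((2 * occupancy m : ℝ) : ℂ) with hph
  have hphH : ph * ((harmonic m : ℂ) - 1) = 1 := by
    have : 2 * occupancy m * ((harmonic m : ℝ) - 1) = 1 := by
      have : (harmonic m : ℝ) - 1 ≠ 0 := by linarith
      rw [occupancy]
      field_simp
    rw [hph]
    exact_mod_cast this
  set f : ℕ → ℂ := fun n => (n + 1) * ((harmonic (n + 1) : ℂ) - 1) with hf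
  set g : ℂ⟦X⟧ := mk fun n : ℕ => (n + 1 : ℂ) with hg
  -- The series `f` is the resonant solution: (θ - 2)f = g while θg = 2g. Hence P(θ)f = P'(2)g =
  -- m!(H_m - 1)g, and the multiple 2φ = 1/(H_m - 1) of `f` accounts for the toll n+1.
  have hfg : euler (mk f) - (2 : ℂ) • mk f = g := by
    ext n
    rw [map_sub, coeff_euler, coeff_smul, coeff_mk, coeff_mk, hg, coeff_mk, smul_eq_mul, hf]
    simp only
    rw [harmonic_succ (n + 1)]
    have : ((n : ℂ) + 2) ≠ 0 := by exact_mod_cast (Nat.succ_ne_zero (n + 1))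
    have h4 : (n : ℂ) + 1 + 1 = n + 2 := by ring
    push_cast
    rw [h4]
    field_simp
    ring
  have hPf : Polynomial.aeval euler (indicial m) (mk f) = (m ! * ((harmonic m : ℂ) - 1)) • g := by
    rw [← sub_two_mul_cofactor hm, mul_comm, map_mul, Module.End.mul_apply]
    have : Polynomial.aeval euler (Polynomial.X - Polynomial.C (2 : ℂ)) (mk f) = g := by
      rw [← hfg]
      simp [Algebra.algebraMap_eq_smul_one, ofNat_smul_eq_nsmul]
    rw [this, aeval_apply_of_eigen euler_mk_succ, cofactor_eval_two hm]
  have h1 := aeval_indicial_of_recurrence hm (recurrence_ofReal (t := fun n => n - (m - 1)) h)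
  -- The toll is (n+1) - m: the first part is resonant, the constant part is slow.
  have hT : mk (fun n : ℕ => ((n - (m - 1) : ℝ) : ℂ)) = g - (m : ℂ) • mk 1 := by
    ext n
    rw [coeff_mk, map_sub, hg, coeff_mk, coeff_smul, coeff_mk]
    push_cast
    simp
    ring
  have hPg : Polynomial.aeval euler (indicial m) g = 0 := by
    rw [hg, aeval_apply_of_eigen euler_mk_succ, ← sub_two_mul_cofactor hm]
    simp
  have hone : (mk 1 : ℂ⟦X⟧) ∈ slowSeries (slowExponent hm) (slowExponent_nonneg hm) :=
    ⟨1, fun n => by simpa using one_le_growth (slowExponent_nonneg hm) n⟩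
  set c : ℂ := ((m - 1)! * (((d (m - 1) : ℝ) : ℂ) - ((((m - 1 : ℕ) : ℝ) - (m - 1) : ℝ) : ℂ))
    - m ! * ((d 0 : ℝ) : ℂ)) with hc
  have hP : Polynomial.aeval euler (indicial m) (mk (fun n => (d n : ℂ)) - ph • mk f)
      ∈ slowSeries (slowExponent hm) (slowExponent_nonneg hm) := by
    have e1 : mk (fun n => (d n : ℂ)) - ph • mk f
        = (mk (fun n => (d n : ℂ)) - mk (fun n : ℕ => ((n - (m - 1) : ℝ) : ℂ)))
          + g - (m : ℂ) • mk 1 - ph • mk f := by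
      rw [hT]; abel
    rw [e1, map_sub, map_sub, map_add, h1, hPg, map_smul, map_smul, hPf, smul_smul,
      show ph * (m ! * ((harmonic m : ℂ) - 1)) = m ! * (ph * ((harmonic m : ℂ) - 1)) by ring, hphH,
      mul_one, aeval_apply_of_eigen euler_mk_one, hT]
    have e2 : ∀ (x y z : ℂ⟦X⟧) (k : ℂ),
        k • (g - x) + y + 0 - z - k • g = y - k • x - z := by
      intro x y z k
      rw [smul_sub]; abel
    rw [e2]
    refine Submodule.sub_mem _ (Submodule.sub_mem _ ?_ ?_) ?_
    · exact Submodule.smul_mem _ _ (one_sub_X_pow_mem _ _)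
    · exact Submodule.smul_mem _ _ (Submodule.smul_mem _ _ hone)
    · exact Submodule.smul_mem _ _ (Submodule.smul_mem _ _ hone)
  obtain ⟨l, hl⟩ := exists_linear hm hP
  obtain ⟨C', hC'⟩ := exists_re_bound hm (d := d)
    (f := fun n => 2 * occupancy m * ((n + 1) * (harmonic (n + 1) - 1))) (l := l) (by
      convert hl using 2
      ext n
      rw [coeff_mk, map_sub, coeff_smul, coeff_mk, coeff_mk, hf, hph]
      push_cast
      simp)
  exact ⟨l.re, C', hC'⟩

/-! ### A linear functional that determines the leading coefficient -/

section Homogeneous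

/-- The partial sums of the functional `F ↦ ∑ F_n / ((n + 1) (n + 2))`. -/
noncomputable def partialSum (F : ℂ⟦X⟧) (N : ℕ) : ℂ :=
  ∑ n ∈ Finset.range N, coeff n F / ((n + 1) * (n + 2))

/-- A telescoping sum. Formally the functional is F ↦ ∫₀¹ (1-x)F(x) dx, and the identity is
integration by parts. -/
lemma partialSum_euler_sub (F : ℂ⟦X⟧) (N : ℕ) :
    partialSum (euler F - (2 : ℂ) • F) N = coeff N F / (N + 1) - coeff 0 F := by
  induction N with
  | zero => simp [partialSum]
  | succ N ih =>
    rw [partialSum, Finset.sum_range_succ, ← partialSum, ih, map_sub, coeff_euler, coeff_smul]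
    have h1 : ((N : ℂ) + 1) ≠ 0 := by exact_mod_cast (Nat.succ_ne_zero N)
    have h2 : ((N : ℂ) + 2) ≠ 0 := by exact_mod_cast (Nat.succ_ne_zero (N + 1))
    have h4 : (N : ℂ) + 1 + 1 = N + 2 := by ring
    push_cast
    rw [h4, smul_eq_mul]
    field_simp
    ring

lemma partialSum_add (F G : ℂ⟦X⟧) (N : ℕ) :
    partialSum (F + G) N = partialSum F N + partialSum G N := by
  simp [partialSum, add_div, Finset.sum_add_distrib]

lemma partialSum_smul (c : ℂ) (F : ℂ⟦X⟧) (N : ℕ) :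
    partialSum (c • F) N = c * partialSum F N := by
  simp [partialSum, Finset.mul_sum, mul_div_assoc]

lemma tendsto_coeff_div {a : ℝ} {ha : 0 ≤ a} (ha1 : a < 1) {F : ℂ⟦X⟧} (hF : F ∈ slowSeries a ha) :
    Tendsto (fun n : ℕ => coeff n F / (n + 1)) atTop (𝓝 0) := by
  obtain ⟨C, hC⟩ := hF
  refine squeeze_zero_norm (fun n => ?_) (by simpa using (tendsto_growth_div ha ha1).const_mul C)
  have : ‖((n : ℂ) + 1)‖ = n + 1 := by
    have : ((n : ℂ) + 1) = ((n + 1 : ℕ) : ℂ) := by push_cast; ring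
    rw [this, Complex.norm_natCast]; push_cast; ring
  rw [norm_div, this, ← mul_div_assoc]
  exact div_le_div_of_nonneg_right (hC n) (by positivity)

/-- A slow solution of the homogeneous equation satisfies a linear relation between its first
coefficients. -/
lemma sum_coeff_eq_zero (hm : 2 ≤ m) {F : ℂ⟦X⟧}
    (hF : F ∈ slowSeries (slowExponent hm) (slowExponent_nonneg hm))
    (hP : Polynomial.aeval euler (indicial m) F = 0) :
    ∑ j ∈ Finset.range (m - 1), coeff j F / ((j + 1) * (j + 2)) = 0 := by
  set G : ℕ → ℂ⟦X⟧ := fun k => Polynomial.aeval euler (ascPochhammer ℂ k) F with hG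
  -- Writing θ + k as (θ - 2) + (k + 2) makes `partialSum_euler_sub` applicable at each stage.
  have hGsucc : ∀ k, G (k + 1) = (euler (G k) - (2 : ℂ) • G k) + ((k : ℂ) + 2) • G k := by
    intro k
    simp only [hG]
    rw [ascPochhammer_succ_right, mul_comm, map_mul, Module.End.mul_apply, map_add,
      Polynomial.aeval_X, map_natCast, LinearMap.add_apply, Module.End.natCast_apply, add_smul,
      Nat.cast_smul_eq_nsmul]
    abel
  have hmem : ∀ k, G k ∈ slowSeries (slowExponent hm) (slowExponent_nonneg hm)
      ∧ Polynomial.aeval euler (indicial m) (G k) = 0 := by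
    intro k
    induction k with
    | zero => simpa [hG] using ⟨hF, hP⟩
    | succ k ih =>
      refine ⟨?_, ?_⟩
      · rw [hGsucc]
        exact Submodule.add_mem _ (Submodule.sub_mem _ (euler_mem hm (by rw [ih.2]; simp) ih.1)
          (Submodule.smul_mem _ _ ih.1)) (Submodule.smul_mem _ _ ih.1)
      · simp only [hG]
        rw [← Module.End.mul_apply, ← map_mul, mul_comm, map_mul, Module.End.mul_apply, hP, map_zero]
  have hG0 : ∀ k, coeff 0 (G k) = k ! * coeff k F := by
    intro k
    simp only [hG]
    rw [aeval_euler_ascPochhammer]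
    simp [constantCoeff_iterate_derivative]
  -- Only the difference is tracked, so that no convergence of the partial sums themselves is
  -- needed. The boundary terms of index `N` vanish in the limit since each `G k` is slow.
  have hlim : ∀ k, Tendsto (fun N => partialSum (G k) N - (k + 1)! * partialSum F N) atTop
      (𝓝 (-((k + 1)! * ∑ j ∈ Finset.range k, coeff j F / ((j + 1) * (j + 2))))) := by
    intro k
    induction k with
    | zero => simp [hG]
    | succ k ih =>
      have h1 := ((tendsto_coeff_div (slowExponent_lt_one hm) (hmem k).1).sub_const
        (coeff 0 (G k))).add (ih.const_mul ((k : ℂ) + 2))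
      refine (h1.congr fun N => ?_).trans (le_of_eq ?_)
      · rw [hGsucc, partialSum_add, partialSum_euler_sub, partialSum_smul,
          Nat.factorial_succ (k + 1)]
        push_cast
        ring
      · congr 1
        rw [hG0, Finset.sum_range_succ, Nat.factorial_succ (k + 1), Nat.factorial_succ k]
        have h1 : ((k : ℂ) + 1) ≠ 0 := by exact_mod_cast (Nat.succ_ne_zero k)
        have h2 : ((k : ℂ) + 2) ≠ 0 := by exact_mod_cast (Nat.succ_ne_zero (k + 1))
        push_cast
        field_simp
        ring
  have h1 := hlim (m - 1)
  -- The homogeneous equation says that the compared quantities agree identically for `k = m - 1`,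
  -- so the limit found above must be zero.
  have h2 : G (m - 1) = (m ! : ℂ) • F := by
    rw [indicial, map_sub, LinearMap.sub_apply, Polynomial.aeval_C, Module.algebraMap_end_apply,
      sub_eq_zero] at hP
    exact hP
  rw [h2, Nat.sub_add_cancel (by omega)] at h1
  simp only [partialSum_smul, sub_self] at h1
  have h3 := tendsto_nhds_unique h1 tendsto_const_nhds
  have h4 : (m ! : ℂ) ≠ 0 := Nat.cast_ne_zero.2 (Nat.factorial_ne_zero m)
  simpa [h4] using h3

end Homogeneous

/-- **Transfer** for the number of nodes. -/
theorem occupancy_of_unit_toll (hm : 2 ≤ m) {s : ℕ → ℝ} (h : ∀ n, m ≤ n →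
      s n = 𝔼 σ : Equiv.Perm (Fin n), ∑ r : Fin m, s (gap (permRoots m σ) r) + 1)
    (h0 : s 0 = 0) (h1 : ∀ n, 1 ≤ n → n < m → s n = 1) :
    ∃ C : ℝ, ∀ n, |s n - occupancy m * (n + 1)| ≤ C * slow hm n := by
  have hm1 : (m : ℝ) - 1 ≠ 0 := by
    have : (2 : ℝ) ≤ m := by exact_mod_cast hm
    linarith
  -- The shift c = 1/(m-1) solves mc = c + 1 and thereby absorbs the unit toll.
  set d : ℕ → ℝ := fun n => s n + 1 / (m - 1) with hd
  have hrec : ∀ n, m ≤ n →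
      d n = 𝔼 σ : Equiv.Perm (Fin n), ∑ r : Fin m, d (gap (permRoots m σ) r) + 0 := by
    intro n hn
    simp only [hd, Finset.sum_add_distrib, Finset.expect_add_distrib, Fintype.expect_const]
    rw [h n hn]
    simp only [Finset.sum_const, Finset.card_univ, Fintype.card_fin, nsmul_eq_mul]
    field_simp
    ring
  have hP := aeval_indicial_of_recurrence hm (recurrence_ofReal (t := fun _ => 0) hrec)
  -- With these initial values the polynomial inhomogeneity cancels, so `d` solves the homogeneous
  -- equation exactly.
  have hdm : d (m - 1) = m * d 0 := by
    simp only [hd]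
    rw [h0, h1 (m - 1) (by omega) (by omega)]
    field_simp
    ring
  have hfac : (m ! : ℂ) = (m - 1)! * m := by
    have := Nat.mul_factorial_pred (show m ≠ 0 by omega)
    rw [← this]; push_cast; ring
  have hz : mk (fun _ : ℕ => ((0 : ℝ) : ℂ)) = 0 := by ext; simp
  rw [hz, sub_zero, smul_zero, zero_add, hdm, hfac] at hP
  rw [show ((m - 1)! * (((m * d 0 : ℝ) : ℂ) - ((0 : ℝ) : ℂ)) - (m - 1)! * m * ((d 0 : ℝ) : ℂ) : ℂ) = 0
    by push_cast; ring, zero_smul] at hP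
  obtain ⟨l, hl⟩ := exists_linear hm (by rw [hP]; exact Submodule.zero_mem _)
  have hPg : Polynomial.aeval euler (indicial m) (mk fun n : ℕ => (n + 1 : ℂ)) = 0 := by
    rw [aeval_apply_of_eigen euler_mk_succ, ← sub_two_mul_cofactor hm]
    simp
  -- Subtracting the linear part leaves a slow homogeneous solution, whose first coefficients
  -- satisfy a linear relation. This is one equation for `l`.
  have hsum := sum_coeff_eq_zero hm hl (by rw [map_sub, map_smul, hP, hPg]; simp)
  have hterm : ∀ j ∈ Finset.range (m - 1),
      coeff j (mk (fun n => (d n : ℂ)) - l • mk fun n : ℕ => (n + 1 : ℂ)) / ((j + 1) * (j + 2))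
        = ((d j / ((j + 1) * (j + 2)) : ℝ) : ℂ) - l * (((j : ℝ) + 2)⁻¹ : ℝ) := by
    intro j _
    rw [map_sub, coeff_smul, coeff_mk, coeff_mk, smul_eq_mul]
    have h1 : ((j : ℂ) + 1) ≠ 0 := by exact_mod_cast (Nat.succ_ne_zero j)
    have h2 : ((j : ℂ) + 2) ≠ 0 := by exact_mod_cast (Nat.succ_ne_zero (j + 1))
    push_cast
    field_simp
  rw [Finset.sum_congr rfl hterm, Finset.sum_sub_distrib, ← Finset.mul_sum, ← Complex.ofReal_sum,
    ← Complex.ofReal_sum] at hsum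
  have hs1 : ∀ k : ℕ, k + 1 < m → ∑ j ∈ Finset.range (k + 1), d j / (((j : ℝ) + 1) * (j + 2))
      = 1 / (2 * (m - 1)) + m / (m - 1) * (1 / 2 - 1 / (k + 2)) := by
    intro k hk
    induction k with
    | zero => simp [hd, h0]; ring
    | succ k ih =>
      rw [Finset.sum_range_succ, ih (by omega)]
      simp only [hd]
      rw [h1 (k + 1) (by omega) (by omega)]
      push_cast
      field_simp
      ring
  have hs2 : ∀ k : ℕ, ∑ j ∈ Finset.range k, ((j : ℝ) + 2)⁻¹ = harmonic (k + 1) - 1 := by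
    intro k
    induction k with
    | zero => simp
    | succ k ih =>
      rw [Finset.sum_range_succ, ih, harmonic_succ (k + 1)]
      push_cast
      ring
  obtain ⟨k, rfl⟩ := Nat.exists_eq_add_of_le' hm
  rw [show k + 2 - 1 = k + 1 by omega, hs1 k (by omega), hs2 (k + 1)] at hsum
  have hH := one_lt_harmonic hm
  -- The relation reads 1/2 = l (H_m - 1).
  have hl' : l = (occupancy (k + 2) : ℂ) := by
    have e1 : (1 / (2 * (((k + 2 : ℕ) : ℝ) - 1)) + ((k + 2 : ℕ) : ℝ) / (((k + 2 : ℕ) : ℝ) - 1)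
        * (1 / 2 - 1 / (k + 2)) : ℝ) = 1 / 2 := by
      push_cast
      have : (k : ℝ) + 2 - 1 ≠ 0 := by push_cast at hm1; exact hm1
      field_simp
      ring
    rw [e1, sub_eq_zero] at hsum
    have h3 : (((harmonic (k + 1 + 1) : ℝ) - 1 : ℝ) : ℂ) ≠ 0 := by
      have : (harmonic (k + 1 + 1) : ℝ) - 1 ≠ 0 := by
        rw [show k + 1 + 1 = k + 2 by ring]; linarith
      exact_mod_cast this
    have h4 : l = ((1 / 2 : ℝ) : ℂ) / (((harmonic (k + 1 + 1) : ℝ) - 1 : ℝ) : ℂ) := by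
      rw [hsum, mul_div_assoc, div_self h3, mul_one]
    rw [h4, occupancy, ← Complex.ofReal_div]
    congr 1
    rw [show k + 1 + 1 = k + 2 by ring, div_div]
  obtain ⟨C, hC⟩ := exists_re_bound hm (d := d) (f := fun _ => 0) (l := l) (by
    simpa using hl)
  refine ⟨C + 1 / (((k + 2 : ℕ) : ℝ) - 1), fun n => ?_⟩
  have h5 := hC n
  rw [hl', Complex.ofReal_re] at h5
  have h6 := one_le_slow hm n
  have h7 : (0 : ℝ) ≤ 1 / (((k + 2 : ℕ) : ℝ) - 1) := by
    push_cast
    have : (0 : ℝ) ≤ (k : ℝ) + 2 - 1 := by linarith [(Nat.cast_nonneg k : (0 : ℝ) ≤ k)]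
    positivity
  have h8 : s n - occupancy (k + 2) * (n + 1)
      = (d n - 0 - occupancy (k + 2) * (n + 1)) - 1 / (((k + 2 : ℕ) : ℝ) - 1) := by
    simp only [hd]; ring
  rw [h8, add_mul]
  refine (abs_sub _ _).trans (add_le_add h5 ?_)
  rw [abs_of_nonneg h7]
  nlinarith

end EulerOperator
-- Recursions for means and variances
namespace MaryTree

open EulerOperator

variable {m n : ℕ}

lemma sum_gap_permRoots (hm : 2 ≤ m) (hn : m ≤ n) (σ : Equiv.Perm (Fin n)) :
    ∑ r : Fin m, gap (permRoots m σ) r = n - (m - 1) := by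
  have hc := card_permRoots (show m - 1 ≤ n by omega) σ
  rw [sum_gap (by omega), hc]

lemma gap_le (R : Finset (Fin n)) (r : ℕ) : gap R r ≤ n := by
  refine (Finset.card_filter_le _ _).trans ?_
  simp

lemma gap_lt (hm : 2 ≤ m) (hn : m ≤ n) (σ : Equiv.Perm (Fin n)) (r : Fin m) :
    gap (permRoots m σ) r < n := by
  have h := sum_gap_permRoots hm hn σ
  have h2 := Finset.single_le_sum (f := fun r : Fin m => gap (permRoots m σ) r)
    (fun _ _ => Nat.zero_le _) (Finset.mem_univ r)
  omega

lemma sum_gap_add_one (hm : 2 ≤ m) (hn : m ≤ n) (σ : Equiv.Perm (Fin n)) :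
    ∑ r : Fin m, ((gap (permRoots m σ) r : ℝ) + 1) = n + 1 := by
  have h := sum_gap_permRoots hm hn σ
  have h2 : ((∑ r : Fin m, gap (permRoots m σ) r : ℕ) : ℝ) = ((n - (m - 1) : ℕ) : ℝ) := by rw [h]
  rw [Nat.cast_sub (by omega), Nat.cast_sub (by omega)] at h2
  push_cast at h2
  rw [Finset.sum_add_distrib, h2]
  simp only [Finset.sum_const, Finset.card_univ, Fintype.card_fin, nsmul_eq_mul, mul_one]
  ring

/-- Independence of the subtrees with all factors but one equal to 1; conditioning on the root keys
remains possible since `G` may depend on them. -/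
lemma expect_subtree (hm : 2 ≤ m) (hn : m ≤ n) {𝕜 : Type*} [Field 𝕜] [CharZero 𝕜] (r : Fin m)
    (G : Finset (Fin n) → ℕ × ℕ × ℕ → 𝕜) :
    𝔼 σ : Equiv.Perm (Fin n), G (permRoots m σ) (stats hm (subKeys m (List.ofFn σ) r))
      = 𝔼 σ : Equiv.Perm (Fin n), 𝔼 τ : Equiv.Perm (Fin (gap (permRoots m σ) r)),
          G (permRoots m σ) (stats hm (List.ofFn τ)) := by
  have h := expect_prod_subtrees hm (show m - 1 ≤ n by omega)
    (fun R s x => if s = r then G R x else (1 : 𝕜))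
  have e : ∀ (s : Fin m) (R : Finset (Fin n)),
      𝔼 τ : Equiv.Perm (Fin (gap R s)), (if s = r then G R (stats hm (List.ofFn τ)) else (1 : 𝕜))
        = if s = r then 𝔼 τ : Equiv.Perm (Fin (gap R s)), G R (stats hm (List.ofFn τ)) else 1 := by
    intro s R
    split_ifs <;> simp
  simp only [e, Finset.prod_ite_eq', Finset.mem_univ, if_true] at h
  exact h

lemma expect_subtree_mul (hm : 2 ≤ m) (hn : m ≤ n) {𝕜 : Type*} [Field 𝕜] [CharZero 𝕜]
    {r s : Fin m} (hrs : r ≠ s) (G H : Finset (Fin n) → ℕ × ℕ × ℕ → 𝕜) :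
    𝔼 σ : Equiv.Perm (Fin n), (G (permRoots m σ) (stats hm (subKeys m (List.ofFn σ) r))
        * H (permRoots m σ) (stats hm (subKeys m (List.ofFn σ) s)))
      = 𝔼 σ : Equiv.Perm (Fin n), ((𝔼 τ : Equiv.Perm (Fin (gap (permRoots m σ) r)),
          G (permRoots m σ) (stats hm (List.ofFn τ)))
        * (𝔼 τ : Equiv.Perm (Fin (gap (permRoots m σ) s)),
          H (permRoots m σ) (stats hm (List.ofFn τ)))) := by
  have h := expect_prod_subtrees hm (show m - 1 ≤ n by omega)
    (fun R t x => (if t = r then G R x else (1 : 𝕜)) * (if t = s then H R x else 1))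
  have e : ∀ (t : Fin m) (R : Finset (Fin n)),
      𝔼 τ : Equiv.Perm (Fin (gap R t)), ((if t = r then G R (stats hm (List.ofFn τ)) else (1 : 𝕜))
          * (if t = s then H R (stats hm (List.ofFn τ)) else 1))
        = (if t = r then 𝔼 τ : Equiv.Perm (Fin (gap R t)), G R (stats hm (List.ofFn τ)) else 1)
          * (if t = s then 𝔼 τ : Equiv.Perm (Fin (gap R t)), H R (stats hm (List.ofFn τ)) else 1)
        := by
    intro t R
    by_cases h1 : t = r
    · subst h1
      simp [hrs]
    · simp only [h1, if_false, one_mul]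
      split_ifs <;> simp
  simp only [e, Finset.prod_mul_distrib, Finset.prod_ite_eq', Finset.mem_univ, if_true] at h
  exact h

/-- The expectation of a functional of the random search tree with `n` keys. -/
noncomputable def meanStat (hm : 2 ≤ m) (f : ℕ × ℕ × ℕ → ℝ) (n : ℕ) : ℝ :=
  𝔼 σ : Equiv.Perm (Fin n), f (stats hm (List.ofFn σ))

/-- The variance of a functional of the random search tree with `n` keys. -/
noncomputable def varStat (hm : 2 ≤ m) (f : ℕ × ℕ × ℕ → ℝ) (n : ℕ) : ℝ :=
  𝔼 σ : Equiv.Perm (Fin n), (f (stats hm (List.ofFn σ)) - meanStat hm f n) ^ 2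

lemma varStat_nonneg (hm : 2 ≤ m) (f : ℕ × ℕ × ℕ → ℝ) (n : ℕ) : 0 ≤ varStat hm f n :=
  Finset.expect_nonneg fun _ _ => sq_nonneg _

section Recursion

variable (hm : 2 ≤ m) (hn : m ≤ n) {f : ℕ × ℕ × ℕ → ℝ} {T : Equiv.Perm (Fin n) → ℝ}
  (h : ∀ σ : Equiv.Perm (Fin n), f (stats hm (List.ofFn σ))
    = ∑ r : Fin m, f (stats hm (subKeys m (List.ofFn σ) r)) + T σ)

include hn h in
lemma meanStat_rec : meanStat hm f n
    = 𝔼 σ : Equiv.Perm (Fin n), ∑ r : Fin m, meanStat hm f (gap (permRoots m σ) r)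
      + 𝔼 σ : Equiv.Perm (Fin n), T σ := by
  rw [meanStat, Finset.expect_congr rfl fun σ _ => h σ, Finset.expect_add_distrib,
    Finset.expect_sum_comm, Finset.expect_sum_comm]
  congr 1
  exact Finset.sum_congr rfl fun r _ => expect_subtree hm hn r fun _ x => f x

/-- The centered sum of the functional over the subtrees. -/
noncomputable def centeredSum (f : ℕ × ℕ × ℕ → ℝ) (σ : Equiv.Perm (Fin n)) : ℝ :=
  ∑ r : Fin m, (f (stats hm (subKeys m (List.ofFn σ) r)) - meanStat hm f (gap (permRoots m σ) r))

lemma expect_sub_meanStat (f : ℕ × ℕ × ℕ → ℝ) (k : ℕ) :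
    𝔼 τ : Equiv.Perm (Fin k), (f (stats hm (List.ofFn τ)) - meanStat hm f k) = 0 := by
  rw [Finset.expect_sub_distrib, Fintype.expect_const, meanStat, sub_self]

-- Given the root keys the subtrees have mean zero after centring, so their sum is orthogonal to
-- every function of the root keys.
include hn in
lemma expect_centeredSum_mul (f : ℕ × ℕ × ℕ → ℝ) (c : Finset (Fin n) → ℝ) :
    𝔼 σ : Equiv.Perm (Fin n), centeredSum hm f σ * c (permRoots m σ) = 0 := by
  simp only [centeredSum, Finset.sum_mul, Finset.expect_sum_comm]
  refine Finset.sum_eq_zero fun r _ => ?_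
  rw [expect_subtree hm hn r fun R x => (f x - meanStat hm f (gap R r)) * c R]
  refine Finset.expect_eq_zero fun σ _ => ?_
  rw [← Finset.expect_mul, expect_sub_meanStat, zero_mul]

-- The mixed terms vanish by conditional independence and centring.
include hn in
lemma expect_centeredSum_sq (f : ℕ × ℕ × ℕ → ℝ) :
    𝔼 σ : Equiv.Perm (Fin n), centeredSum hm f σ ^ 2
      = 𝔼 σ : Equiv.Perm (Fin n), ∑ r : Fin m, varStat hm f (gap (permRoots m σ) r) := by
  simp only [centeredSum, sq, Finset.sum_mul_sum, Finset.expect_sum_comm]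
  refine Finset.sum_congr rfl fun r _ => ?_
  rw [Finset.sum_eq_single r]
  · rw [expect_subtree hm hn r fun R x =>
      (f x - meanStat hm f (gap R r)) * (f x - meanStat hm f (gap R r))]
    simp only [varStat, sq]
  · intro s _ hs
    rw [expect_subtree_mul hm hn hs.symm (fun R x => f x - meanStat hm f (gap R r))
      (fun R x => f x - meanStat hm f (gap R s))]
    refine Finset.expect_eq_zero fun σ _ => ?_
    rw [expect_sub_meanStat, zero_mul]
  · simp

include h in
lemma sub_meanStat_eq (σ : Equiv.Perm (Fin n)) :
    f (stats hm (List.ofFn σ)) - meanStat hm f n = centeredSum hm f σ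
      + (T σ + ∑ r : Fin m, meanStat hm f (gap (permRoots m σ) r) - meanStat hm f n) := by
  rw [h σ, centeredSum, Finset.sum_sub_distrib]
  ring

-- The toll `T` need not be a function of the root keys, so orthogonality is not available, and
-- (x+y)² ≤ (5/4)x² + 5y² is used instead. The loss is harmless because 5/4 · 2/3 = 5/6 is still
-- below 1.
include hn h in
lemma varStat_rec_le : varStat hm f n
    ≤ 5 / 4 * 𝔼 σ : Equiv.Perm (Fin n), ∑ r : Fin m, varStat hm f (gap (permRoots m σ) r)
      + 5 * 𝔼 σ : Equiv.Perm (Fin n),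
        (T σ + ∑ r : Fin m, meanStat hm f (gap (permRoots m σ) r) - meanStat hm f n) ^ 2 := by
  rw [← expect_centeredSum_sq hm hn, Finset.mul_expect, Finset.mul_expect,
    ← Finset.expect_add_distrib]
  refine Finset.expect_le_expect fun σ _ => ?_
  rw [sub_meanStat_eq hm h σ]
  nlinarith [sq_nonneg (centeredSum hm f σ - 4 * (T σ
    + ∑ r : Fin m, meanStat hm f (gap (permRoots m σ) r) - meanStat hm f n))]

-- For a toll that depends on the root keys only, orthogonality splits the variance into the part of
-- the subtrees, which is dropped, and the part of the toll.
include hn h in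
lemma le_varStat {c : Finset (Fin n) → ℝ} (hT : ∀ σ, T σ = c (permRoots m σ)) :
    𝔼 σ : Equiv.Perm (Fin n),
        (T σ + ∑ r : Fin m, meanStat hm f (gap (permRoots m σ) r) - meanStat hm f n) ^ 2
      ≤ varStat hm f n := by
  have h1 := expect_centeredSum_mul hm hn f fun R =>
    2 * (c R + ∑ r : Fin m, meanStat hm f (gap R r) - meanStat hm f n)
  have h2 : varStat hm f n = 𝔼 σ : Equiv.Perm (Fin n), (centeredSum hm f σ ^ 2
      + (centeredSum hm f σ * (2 * (c (permRoots m σ)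
          + ∑ r : Fin m, meanStat hm f (gap (permRoots m σ) r) - meanStat hm f n))
        + (T σ + ∑ r : Fin m, meanStat hm f (gap (permRoots m σ) r) - meanStat hm f n) ^ 2)) := by
    refine Finset.expect_congr rfl fun σ _ => ?_
    rw [sub_meanStat_eq hm h σ, hT]
    ring
  rw [h2, Finset.expect_add_distrib, Finset.expect_add_distrib, h1, zero_add]
  exact le_add_of_nonneg_left (Finset.expect_nonneg fun _ _ => sq_nonneg _)

end Recursion

/-! ### Contraction of quadratically growing sequences -/

section SecondMoment

/-- The quadratic weight, which is multiplied by `2 / (m + 1)` by the recursion. -/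
def quad (n : ℕ) : ℝ := (n + 1) * (n + 2)

lemma quad_pos (n : ℕ) : 0 < quad n := by unfold quad; positivity

lemma expect_sum_quad_le (hm : 2 ≤ m) (hn : m ≤ n) :
    𝔼 σ : Equiv.Perm (Fin n), ∑ r : Fin m, quad (gap (permRoots m σ) r) ≤ 2 / 3 * quad n := by
  have h := expect_sum_gap_sq hm (show m - 1 ≤ n by omega)
  simp only [quad]
  rw [h]
  have : (2 : ℝ) ≤ m := by exact_mod_cast hm
  refine mul_le_mul_of_nonneg_right ?_ (quad_pos n).le
  rw [div_le_div_iff₀ (by linarith) (by norm_num)]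
  linarith

lemma expect_sum_le_of_le (hm : 2 ≤ m) (hn : m ≤ n) {q : ℕ → ℝ} {M A : ℝ} (hM : 0 ≤ M)
    (hq : ∀ k < n, q k ≤ M * quad k + A) :
    𝔼 σ : Equiv.Perm (Fin n), ∑ r : Fin m, q (gap (permRoots m σ) r)
      ≤ 2 / 3 * M * quad n + m * A := by
  have h1 : 𝔼 σ : Equiv.Perm (Fin n), ∑ r : Fin m, q (gap (permRoots m σ) r)
      ≤ 𝔼 σ : Equiv.Perm (Fin n), (M * ∑ r : Fin m, quad (gap (permRoots m σ) r) + m * A) := by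
    refine Finset.expect_le_expect fun σ _ => ?_
    refine (Finset.sum_le_sum fun r _ => hq _ (gap_lt hm hn σ r)).trans (le_of_eq ?_)
    rw [Finset.sum_add_distrib, ← Finset.mul_sum]
    simp
  rw [Finset.expect_add_distrib, Fintype.expect_const, ← Finset.mul_expect] at h1
  have := mul_le_mul_of_nonneg_left (expect_sum_quad_le hm hn) hM
  linarith

variable (hm : 2 ≤ m) {q β : ℕ → ℝ} (hq0 : ∀ n, 0 ≤ q n)
  (hq : ∀ n, m ≤ n →
    q n ≤ 5 / 4 * 𝔼 σ : Equiv.Perm (Fin n), ∑ r : Fin m, q (gap (permRoots m σ) r) + β n)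

include hm hq0 hq in
lemma exists_le_quad {C : ℝ} (hβ : ∀ n, β n ≤ C * quad n) : ∃ M, 0 ≤ M ∧ ∀ n, q n ≤ M * quad n := by
  set S := ∑ k ∈ Finset.range m, q k with hS
  have hS0 : 0 ≤ S := Finset.sum_nonneg fun _ _ => hq0 _
  -- One step gives (5/6)M + C, which is at most M once M ≥ 6|C|; `S` covers the indices below `m`.
  set M := S + 6 * |C| with hM
  have hM0 : 0 ≤ M := by positivity
  refine ⟨M, hM0, fun n => ?_⟩
  induction n using Nat.strong_induction_on with
  | _ n ih =>
    rcases lt_or_ge n m with hn | hn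
    · have h1 := Finset.single_le_sum (f := q) (fun k _ => hq0 k) (Finset.mem_range.2 hn)
      have h2 : 1 ≤ quad n := by
        unfold quad
        nlinarith [(Nat.cast_nonneg n : (0 : ℝ) ≤ n)]
      have : 0 ≤ |C| := abs_nonneg C
      nlinarith
    · have h1 := expect_sum_le_of_le (q := q) hm hn hM0 (A := 0) fun k hk => by simpa using ih k hk
      have h2 := hq n hn
      have h3 := hβ n
      have h4 := quad_pos n
      have h5 := le_abs_self C
      nlinarith

-- Each use of the recursion multiplies the constant by 5/6 and adds ε, where 6ε is the fixed point.
-- Small indices cost only an additive constant, which is negligible against the quadratic weight.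
include hm hq0 hq in
lemma tendsto_div_quad {C : ℝ} (hC : ∀ n, β n ≤ C * quad n)
    (hβ : Tendsto (fun n => β n / quad n) atTop (𝓝 0)) :
    Tendsto (fun n => q n / quad n) atTop (𝓝 0) := by
  obtain ⟨M, hM, hqM⟩ := exists_le_quad hm hq0 hq hC
  have key : ∀ ε : ℝ, 0 < ε → ∀ k : ℕ, ∃ A : ℝ, ∀ n, q n ≤ ((5 / 6) ^ k * M + 6 * ε) * quad n + A := by
    intro ε hε k
    induction k with
    | zero =>
      refine ⟨0, fun n => (hqM n).trans ?_⟩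
      have := quad_pos n
      have := mul_pos hε this
      rw [pow_zero]
      nlinarith
    | succ k ih =>
      obtain ⟨A, hA⟩ := ih
      obtain ⟨N, hN⟩ := eventually_atTop.1 (hβ.eventually (gt_mem_nhds hε))
      set S := ∑ j ∈ Finset.range (m + N), q j with hS
      have hS0 : 0 ≤ S := Finset.sum_nonneg fun _ _ => hq0 _
      set K : ℝ := (5 / 6) ^ k * M + 6 * ε with hK
      have hK0 : 0 ≤ K := by positivity
      refine ⟨S + 5 / 4 * (m * |A|), fun n => ?_⟩
      have hquad := quad_pos n
      have e1 : (5 / 6 : ℝ) ^ (k + 1) * M + 6 * ε = 5 / 6 * K + ε := by rw [hK]; ring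
      rw [e1]
      rcases lt_or_ge n (m + N) with hn | hn
      · have h1 := Finset.single_le_sum (f := q) (fun k _ => hq0 k) (Finset.mem_range.2 hn)
        have h2 : 0 ≤ (5 / 6 * K + ε) * quad n := by positivity
        have h3 : 0 ≤ 5 / 4 * (m * |A|) := by positivity
        linarith
      · have h1 := expect_sum_le_of_le (q := q) (n := n) hm (by omega) hK0 (A := |A|) fun k _ =>
          (hA k).trans (by linarith [le_abs_self A])
        have h2 := hq n (by omega)
        have h3 := (div_lt_iff₀ hquad).1 (hN n (by omega))
        nlinarith
  rw [Metric.tendsto_atTop]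
  intro ε hε
  obtain ⟨k, hk⟩ := exists_pow_lt_of_lt_one (show (0 : ℝ) < ε / 4 / (M + 1) by positivity)
    (show (5 / 6 : ℝ) < 1 by norm_num)
  obtain ⟨A, hA⟩ := key (ε / 24) (by positivity) k
  obtain ⟨N, hN⟩ := exists_nat_gt (|A| / (ε / 4))
  refine ⟨N, fun n hn => ?_⟩
  have hquad := quad_pos n
  rw [Real.dist_0_eq_abs, abs_of_nonneg (div_nonneg (hq0 n) hquad.le), div_lt_iff₀ hquad]
  have h1 : (5 / 6 : ℝ) ^ k * M ≤ ε / 4 := by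
    have h2 : (5 / 6 : ℝ) ^ k * (M + 1) < ε / 4 := (lt_div_iff₀ (by positivity)).1 hk
    have : (0 : ℝ) < (5 / 6 : ℝ) ^ k := by positivity
    linarith
  have h3 : |A| < ε / 4 * quad n := by
    rw [div_lt_iff₀ (by positivity)] at hN
    have : (N : ℝ) ≤ n := by exact_mod_cast hn
    have h4 : (n : ℝ) ≤ quad n := by
      unfold quad
      nlinarith [(Nat.cast_nonneg n : (0 : ℝ) ≤ n)]
    have : (N : ℝ) * (ε / 4) ≤ quad n * (ε / 4) :=
      mul_le_mul_of_nonneg_right (by linarith) (by positivity)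
    linarith
  have h5 := hA n
  have h6 := le_abs_self A
  nlinarith

end SecondMoment

end MaryTree
-- Asymptotics of the tolls and of the variances
lemma abs_harmonic_sub_log_le (k : ℕ) :
    |(harmonic (k + 1) : ℝ) - Real.eulerMascheroniConstant - Real.log (k + 1)| ≤ 1 / (k + 1) := by
  have h1 := Real.eulerMascheroniSeq_lt_eulerMascheroniConstant (k + 1)
  have h2 := Real.eulerMascheroniConstant_lt_eulerMascheroniSeq' (k + 1)
  rw [Real.eulerMascheroniSeq] at h1
  rw [Real.eulerMascheroniSeq', if_neg (Nat.succ_ne_zero k)] at h2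
  push_cast at h1 h2
  have hk : (0 : ℝ) < k + 1 := by positivity
  have h3 : Real.log ((k : ℝ) + 1 + 1) - Real.log (k + 1) ≤ 1 / (k + 1) := by
    rw [← Real.log_div (by positivity) hk.ne']
    refine (Real.log_le_sub_one_of_pos (by positivity)).trans (le_of_eq ?_)
    field_simp
    ring
  rw [abs_le]
  have : 0 ≤ 1 / ((k : ℝ) + 1) := by positivity
  constructor <;> linarith

/-- Euler's constant cancels in the difference, and the two remaining errors are at most 1/(k+1)
each. -/
lemma abs_mul_harmonic_sub_le {k n : ℕ} (h : k ≤ n) :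
    |(k + 1 : ℝ) * (harmonic (k + 1) - harmonic (n + 1))
      - (n + 1) * ((k + 1) / (n + 1) * Real.log ((k + 1) / (n + 1)))| ≤ 2 := by
  have h1 := abs_harmonic_sub_log_le k
  have h2 := abs_harmonic_sub_log_le n
  have hk : (0 : ℝ) < k + 1 := by positivity
  have hn : (0 : ℝ) < n + 1 := by positivity
  have hkn : (k : ℝ) + 1 ≤ n + 1 := by exact_mod_cast Nat.succ_le_succ h
  have e : (k + 1 : ℝ) * (harmonic (k + 1) - harmonic (n + 1))
      - (n + 1) * ((k + 1) / (n + 1) * Real.log ((k + 1) / (n + 1)))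
      = (k + 1) * (((harmonic (k + 1) : ℝ) - Real.eulerMascheroniConstant - Real.log (k + 1))
        - ((harmonic (n + 1) : ℝ) - Real.eulerMascheroniConstant - Real.log (n + 1))) := by
    rw [Real.log_div hk.ne' hn.ne']
    field_simp
    ring
  rw [e, abs_mul, abs_of_pos hk]
  have h3 : 1 / ((n : ℝ) + 1) ≤ 1 / (k + 1) := one_div_le_one_div_of_le hk hkn
  have h4 := (abs_sub _ _).trans (add_le_add h1 (h2.trans h3))
  refine (mul_le_mul_of_nonneg_left h4 hk.le).trans (le_of_eq ?_)
  field_simp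
  ring

/-- The entropy functional `∑ y_r log y_r`. -/
noncomputable def entropySum {m : ℕ} (y : Fin m → ℝ) : ℝ := ∑ r, y r * Real.log (y r)

/-- The toll function `1 + 2 φ ∑ y_r log y_r` of the limit equation. -/
noncomputable def limitToll {m : ℕ} (y : Fin m → ℝ) : ℝ := 1 + 2 * occupancy m * entropySum y

lemma occupancy_pos {m : ℕ} (hm : 2 ≤ m) : 0 < occupancy m := by
  have := EulerOperator.one_lt_harmonic hm
  rw [occupancy]
  have : (0 : ℝ) < harmonic m - 1 := by linarith
  positivity

namespace MaryTree

open EulerOperator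

variable {m n : ℕ}

/-- The key path length. -/
def keyStat : ℕ × ℕ × ℕ → ℝ := fun x => x.1

/-- The number of nodes. -/
def sizeStat : ℕ × ℕ × ℕ → ℝ := fun x => x.2.2

/-- The combination `N - φ K` of node and key path length. -/
noncomputable def diffStat (m : ℕ) : ℕ × ℕ × ℕ → ℝ := fun x => x.2.1 - occupancy m * x.1

/-- The relative sizes of the subtrees. -/
noncomputable def proportion (R : Finset (Fin n)) (r : Fin m) : ℝ := (gap R r + 1) / (n + 1)

lemma sum_length_cast (hm : 2 ≤ m) (hn : m ≤ n) (σ : Equiv.Perm (Fin n)) :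
    ∑ r : Fin m, ((subKeys m (List.ofFn σ) r).length : ℝ) = n - (m - 1) := by
  have h := sum_gap_add_one hm hn σ
  simp only [length_subKeys_ofFn]
  rw [Finset.sum_add_distrib] at h
  simp only [Finset.sum_const, Finset.card_univ, Fintype.card_fin, nsmul_eq_mul, mul_one] at h
  linarith

lemma keyStat_rec (hm : 2 ≤ m) (hn : m ≤ n) (σ : Equiv.Perm (Fin n)) :
    keyStat (stats hm (List.ofFn σ))
      = ∑ r : Fin m, keyStat (stats hm (subKeys m (List.ofFn σ) r)) + (n - (m - 1)) := by
  rw [stats_of_le hm (nodup_ofFn_perm σ) (by simpa using hn), ← sum_length_cast hm hn σ]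
  simp only [keyStat]
  push_cast
  rw [Finset.sum_add_distrib]

lemma sizeStat_rec (hm : 2 ≤ m) (hn : m ≤ n) (σ : Equiv.Perm (Fin n)) :
    sizeStat (stats hm (List.ofFn σ))
      = ∑ r : Fin m, sizeStat (stats hm (subKeys m (List.ofFn σ) r)) + 1 := by
  rw [stats_of_le hm (nodup_ofFn_perm σ) (by simpa using hn)]
  simp only [sizeStat]
  push_cast
  rw [add_comm]

/-- The choice of φ makes this toll small: the number of nodes is φ(n+1) on average, so only its
fluctuations and a slow term remain. -/
lemma diffStat_rec (hm : 2 ≤ m) (hn : m ≤ n) (σ : Equiv.Perm (Fin n)) :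
    diffStat m (stats hm (List.ofFn σ))
      = ∑ r : Fin m, diffStat m (stats hm (subKeys m (List.ofFn σ) r))
        + (sizeStat (stats hm (List.ofFn σ)) - 1 - occupancy m * (n - (m - 1))) := by
  rw [sizeStat_rec hm hn σ]
  have h := keyStat_rec hm hn σ
  simp only [diffStat, keyStat, sizeStat] at h ⊢
  rw [h]
  conv_lhs => rw [stats_of_le hm (nodup_ofFn_perm σ) (by simpa using hn)]
  push_cast
  simp only [Finset.sum_add_distrib, Finset.sum_sub_distrib, ← Finset.mul_sum]
  ring

lemma exists_meanStat_sizeStat (hm : 2 ≤ m) :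
    ∃ C : ℝ, ∀ n, |meanStat hm sizeStat n - occupancy m * (n + 1)| ≤ C * slow hm n := by
  refine occupancy_of_unit_toll hm (fun n hn => ?_) ?_ fun n hn hnm => ?_
  · simpa using meanStat_rec hm hn (T := fun _ => 1) (sizeStat_rec hm hn)
  · simp [meanStat, stats_of_lt hm (l := []) (by simp; omega), sizeStat]
  · have : n ≠ 0 := by omega
    simp [meanStat, stats_of_lt hm (l := List.ofFn _) (by simpa using hnm), sizeStat, this]

lemma exists_meanStat_keyStat (hm : 2 ≤ m) : ∃ l C : ℝ, ∀ n, |meanStat hm keyStat n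
      - 2 * occupancy m * ((n + 1) * (harmonic (n + 1) - 1)) - l * (n + 1)| ≤ C * slow hm n := by
  refine exists_harmonic_of_linear_toll hm fun n hn => ?_
  simpa using meanStat_rec hm hn (T := fun _ => (n - (m - 1) : ℝ)) (keyStat_rec hm hn)

lemma exists_meanStat_diffStat (hm : 2 ≤ m) :
    ∃ l C : ℝ, ∀ n, |meanStat hm (diffStat m) n - l * (n + 1)| ≤ C * slow hm n := by
  obtain ⟨C, hC⟩ := exists_meanStat_sizeStat hm
  refine exists_linear_of_slow_toll hm
    (t := fun n => meanStat hm sizeStat n - 1 - occupancy m * (n - (m - 1))) (fun n hn => ?_)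
    (C := C + |occupancy m * m - 1|) fun n => ?_
  · rw [meanStat_rec hm hn (diffStat_rec hm hn)]
    congr 1
    rw [Finset.expect_sub_distrib, Finset.expect_sub_distrib, Fintype.expect_const,
      Fintype.expect_const]
    rfl
  · have h1 := one_le_slow hm n
    have e : meanStat hm sizeStat n - 1 - occupancy m * (n - (m - 1))
        = (meanStat hm sizeStat n - occupancy m * (n + 1)) + (occupancy m * m - 1) := by ring
    rw [e, add_mul]
    refine (abs_add_le _ _).trans (add_le_add (hC n) ?_)
    exact le_mul_of_one_le_right (abs_nonneg _) h1

lemma sum_slow_gap_le (hm : 2 ≤ m) (R : Finset (Fin n)) :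
    ∑ r : Fin m, slow hm (gap R r) ≤ m * slow hm n := by
  refine (Finset.sum_le_sum fun (r : Fin m) _ => slow_mono hm (gap_le R r)).trans (le_of_eq ?_)
  simp

lemma nonneg_of_le_slow {hm : 2 ≤ m} {C : ℝ} {x : ℕ → ℝ} (h : ∀ n, |x n| ≤ C * slow hm n) :
    0 ≤ C := by
  have := (abs_nonneg _).trans (h 0)
  have h1 := one_le_slow hm 0
  by_contra hC
  nlinarith

lemma abs_sum_error_le {hm : 2 ≤ m} {C : ℝ} {x : ℕ → ℝ} (h : ∀ n, |x n| ≤ C * slow hm n)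
    (R : Finset (Fin n)) : |∑ r : Fin m, x (gap R r) - x n| ≤ C * (m + 1) * slow hm n := by
  have hC := nonneg_of_le_slow h
  refine (abs_sub _ _).trans ?_
  have h1 : |∑ r : Fin m, x (gap R r)| ≤ C * (m * slow hm n) := by
    refine (Finset.abs_sum_le_sum_abs _ _).trans ?_
    refine (Finset.sum_le_sum fun (r : Fin m) _ => h (gap R r)).trans ?_
    rw [← Finset.mul_sum]
    exact mul_le_mul_of_nonneg_left (sum_slow_gap_le hm R) hC
  have := h n
  linarith

/-- If the expectation is linear up to a slow error, then the toll of the centered functional is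
slow. -/
lemma abs_sum_mean_sub_le (hm : 2 ≤ m) (hn : m ≤ n) {μ : ℕ → ℝ} {l C : ℝ}
    (h : ∀ n, |μ n - l * (n + 1)| ≤ C * slow hm n) (σ : Equiv.Perm (Fin n)) :
    |∑ r : Fin m, μ (gap (permRoots m σ) r) - μ n| ≤ C * (m + 1) * slow hm n := by
  have h1 := abs_sum_error_le h (permRoots m σ)
  refine le_trans (le_of_eq ?_) h1
  congr 1
  have h2 := sum_gap_add_one hm hn σ
  rw [Finset.sum_sub_distrib, ← Finset.mul_sum, h2]
  ring

/-- The toll of the centered and rescaled key path length. -/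
noncomputable def keyToll (hm : 2 ≤ m) (R : Finset (Fin n)) : ℝ :=
  (n - (m - 1)) + ∑ r : Fin m, meanStat hm keyStat (gap R r) - meanStat hm keyStat n

/-- Since ∑(gap + 1) = n + 1, linear terms in the expectation cancel. The terms (k+1)H_{k+1} combine
with those of the root to the entropy of the proportions. -/
lemma exists_keyToll (hm : 2 ≤ m) : ∃ C : ℝ, ∀ n, m ≤ n → ∀ σ : Equiv.Perm (Fin n),
    |keyToll hm (permRoots m σ) - (n + 1) * limitToll (proportion (m := m) (permRoots m σ))|
      ≤ C * slow hm n := by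
  obtain ⟨l, C, hC⟩ := exists_meanStat_keyStat hm
  -- The three errors come from `n - (m - 1)` against `n + 1`, from harmonic numbers against
  -- logarithms, and from the expectations in the `m` subtrees and the whole tree.
  refine ⟨m + 2 * occupancy m * (2 * m) + C * (m + 1), fun n hn σ => ?_⟩
  set R := permRoots m σ with hR
  have hsum := sum_gap_add_one hm hn σ
  rw [← hR] at hsum
  have h1 := abs_sum_error_le hC R
  have hφ := occupancy_pos hm
  have h2 : |∑ r : Fin m, (((gap R r + 1 : ℝ) * (harmonic (gap R r + 1) - harmonic (n + 1)))
      - (n + 1) * (proportion R r * Real.log (proportion R r)))| ≤ 2 * m := by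
    refine (Finset.abs_sum_le_sum_abs _ _).trans ?_
    refine (Finset.sum_le_sum fun (r : Fin m) _ =>
      abs_mul_harmonic_sub_le (gap_le R r)).trans (le_of_eq ?_)
    simp [mul_comm]
  have e : keyToll hm R - (n + 1) * limitToll (proportion (m := m) R)
      = -(m : ℝ) + 2 * occupancy m * (∑ r : Fin m, (((gap R r + 1 : ℝ)
          * (harmonic (gap R r + 1) - harmonic (n + 1)))
          - (n + 1) * (proportion R r * Real.log (proportion R r))))
        + (∑ r : Fin m, (meanStat hm keyStat (gap R r) - 2 * occupancy m * (((gap R r : ℕ) + 1)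
            * (harmonic (gap R r + 1) - 1)) - l * ((gap R r : ℕ) + 1))
          - (meanStat hm keyStat n - 2 * occupancy m * ((n + 1) * (harmonic (n + 1) - 1))
            - l * (n + 1))) := by
    have e1 : ∑ r : Fin m, ((gap R r + 1 : ℝ) * (harmonic (gap R r + 1) - harmonic (n + 1)))
        = ∑ r : Fin m, ((gap R r + 1 : ℝ) * (harmonic (gap R r + 1) - 1))
          - (n + 1) * (harmonic (n + 1) - 1) := by
      rw [← hsum, Finset.sum_mul, ← Finset.sum_sub_distrib]
      exact Finset.sum_congr rfl fun r _ => by ring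
    simp only [Finset.sum_sub_distrib, ← Finset.mul_sum]
    rw [e1, hsum, keyToll, limitToll, entropySum]
    ring
  rw [e]
  have hs := one_le_slow hm n
  have hm0 : (0 : ℝ) ≤ m := Nat.cast_nonneg m
  refine (abs_add_le _ _).trans ?_
  refine (add_le_add (abs_add_le _ _) h1).trans ?_
  rw [abs_neg, abs_of_nonneg hm0, abs_mul, abs_of_pos (by positivity : 0 < 2 * occupancy m)]
  have h3 := mul_le_mul_of_nonneg_left h2 (by positivity : 0 ≤ 2 * occupancy m)
  have h4 : (m + 2 * occupancy m * (2 * m)) * 1 ≤ (m + 2 * occupancy m * (2 * m)) * slow hm n :=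
    mul_le_mul_of_nonneg_left hs (by positivity)
  linarith

lemma abs_entropySum_le {y : Fin m → ℝ} (h0 : ∀ r, 0 ≤ y r) (h1 : ∀ r, y r ≤ 1) :
    |entropySum y| ≤ m := by
  refine (Finset.abs_sum_le_sum_abs _ _).trans ?_
  have : ∀ r : Fin m, |y r * Real.log (y r)| ≤ 1 := by
    intro r
    rcases (h0 r).eq_or_lt with h | h
    · simp [← h]
    · have := Real.abs_log_mul_self_lt (y r) h (h1 r)
      rw [mul_comm]
      exact this.le
  refine (Finset.sum_le_sum fun r _ => this r).trans (le_of_eq ?_)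
  simp

lemma abs_limitToll_le (hm : 2 ≤ m) {y : Fin m → ℝ} (h0 : ∀ r, 0 ≤ y r) (h1 : ∀ r, y r ≤ 1) :
    |limitToll y| ≤ 1 + 2 * occupancy m * m := by
  have hφ := occupancy_pos hm
  refine (abs_add_le _ _).trans ?_
  rw [abs_one, abs_mul, abs_of_pos (by positivity : 0 < 2 * occupancy m)]
  have := mul_le_mul_of_nonneg_left (abs_entropySum_le h0 h1) (by positivity : 0 ≤ 2 * occupancy m)
  linarith

lemma proportion_nonneg (R : Finset (Fin n)) (r : Fin m) : 0 ≤ proportion R r := by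
  unfold proportion; positivity

lemma proportion_le_one (R : Finset (Fin n)) (r : Fin m) : proportion R r ≤ 1 := by
  unfold proportion
  rw [div_le_one (by positivity)]
  have : (gap R r : ℝ) ≤ n := by exact_mod_cast gap_le R r
  linarith

lemma slow_le (hm : 2 ≤ m) : ∃ C : ℝ, 0 ≤ C ∧ ∀ n : ℕ, slow hm n ≤ C * (n + 1) := by
  obtain ⟨C, hC⟩ := (tendsto_slow_div hm).bddAbove_range
  have h : ∀ n : ℕ, slow hm n ≤ C * (n + 1) := fun n => by
    have := hC ⟨n, rfl⟩
    rwa [div_le_iff₀ (by positivity)] at this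
  refine ⟨C, ?_, h⟩
  have h1 := h 0
  have h2 := one_le_slow hm 0
  simp at h1
  linarith

lemma exists_abs_keyToll_le (hm : 2 ≤ m) : ∃ C : ℝ, 0 ≤ C ∧ ∀ n, m ≤ n →
    ∀ σ : Equiv.Perm (Fin n), |keyToll hm (permRoots m σ)| ≤ C * (n + 1) := by
  obtain ⟨C, hC⟩ := exists_keyToll hm
  obtain ⟨D, hD0, hD⟩ := slow_le hm
  have hφ := occupancy_pos hm
  refine ⟨1 + 2 * occupancy m * m + |C| * D, by positivity, fun n hn σ => ?_⟩
  have h1 := hC n hn σ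
  have h2 := abs_limitToll_le hm (proportion_nonneg (m := m) (permRoots m σ))
    (proportion_le_one _)
  have hn0 : (0 : ℝ) < n + 1 := by positivity
  have h3 : |(n + 1) * limitToll (proportion (m := m) (permRoots m σ))|
      ≤ (n + 1) * (1 + 2 * occupancy m * m) := by
    rw [abs_mul, abs_of_pos hn0]
    exact mul_le_mul_of_nonneg_left h2 hn0.le
  have h4 : C * slow hm n ≤ |C| * (D * (n + 1)) :=
    (mul_le_mul_of_nonneg_right (le_abs_self C) (by linarith [one_le_slow hm n])).trans
      (mul_le_mul_of_nonneg_left (hD n) (abs_nonneg C))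
  have h5 := abs_sub_abs_le_abs_sub (keyToll hm (permRoots m σ))
    ((n + 1) * limitToll (proportion (m := m) (permRoots m σ)))
  linarith

lemma varStat_keyStat_le (hm : 2 ≤ m) :
    ∃ M : ℝ, 0 ≤ M ∧ ∀ n, varStat hm keyStat n ≤ M * quad n := by
  obtain ⟨C, hC0, hC⟩ := exists_abs_keyToll_le hm
  refine exists_le_quad hm (varStat_nonneg hm keyStat)
    (β := fun n => 5 * C ^ 2 * quad n) (fun n hn => ?_) (C := 5 * C ^ 2) fun n => le_rfl
  refine (varStat_rec_le hm hn (keyStat_rec hm hn)).trans (add_le_add le_rfl ?_)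
  rw [mul_assoc]
  refine mul_le_mul_of_nonneg_left ?_ (by norm_num)
  refine Finset.expect_le Finset.univ_nonempty fun σ _ => ?_
  have h1 := hC n hn σ
  rw [keyToll] at h1
  have h2 := sq_le_sq' (neg_le_of_abs_le h1) (le_of_abs_le h1)
  refine h2.trans ?_
  unfold quad
  rw [mul_pow]
  refine mul_le_mul_of_nonneg_left ?_ (sq_nonneg C)
  nlinarith [(Nat.cast_nonneg n : (0 : ℝ) ≤ n)]

lemma tendsto_slow_sq_div (hm : 2 ≤ m) :
    Tendsto (fun n => slow hm n ^ 2 / quad n) atTop (𝓝 0) := by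
  have h := (tendsto_slow_div hm).pow 2
  rw [zero_pow two_ne_zero] at h
  refine squeeze_zero (fun n => div_nonneg (sq_nonneg _) (quad_pos n).le) (fun n => ?_) h
  rw [div_pow]
  refine div_le_div_of_nonneg_left (sq_nonneg _) (by positivity) ?_
  unfold quad
  nlinarith [(Nat.cast_nonneg n : (0 : ℝ) ≤ n)]

lemma slow_sq_le (hm : 2 ≤ m) : ∃ C : ℝ, ∀ n, slow hm n ^ 2 ≤ C * quad n := by
  obtain ⟨C, hC⟩ := (tendsto_slow_sq_div hm).bddAbove_range
  exact ⟨C, fun n => (div_le_iff₀ (quad_pos n)).1 (hC ⟨n, rfl⟩)⟩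

/-- The centred toll is deterministic given the root keys and of slow order, so its square is
negligible against the quadratic weight. -/
lemma tendsto_varStat_sizeStat (hm : 2 ≤ m) :
    Tendsto (fun n => varStat hm sizeStat n / quad n) atTop (𝓝 0) := by
  obtain ⟨C, hC⟩ := exists_meanStat_sizeStat hm
  obtain ⟨D, hD⟩ := slow_sq_le hm
  set K : ℝ := 1 + C * (m + 1) with hK
  have hC0 := nonneg_of_le_slow hC
  refine tendsto_div_quad hm (varStat_nonneg hm sizeStat)
    (β := fun n => 5 * K ^ 2 * slow hm n ^ 2) (fun n hn => ?_) (C := 5 * K ^ 2 * D)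
    (fun n => ?_) ?_
  · refine (varStat_rec_le hm hn (T := fun _ => 1) (sizeStat_rec hm hn)).trans (add_le_add le_rfl ?_)
    rw [mul_assoc]
    refine mul_le_mul_of_nonneg_left ?_ (by norm_num)
    refine Finset.expect_le Finset.univ_nonempty fun σ _ => ?_
    have h1 := abs_sum_mean_sub_le hm hn hC σ
    have h2 := one_le_slow hm n
    rw [← mul_pow, sq_le_sq, abs_of_nonneg (by positivity : 0 ≤ K * slow hm n), add_sub_assoc]
    refine (abs_add_le _ _).trans ?_
    rw [abs_one, hK]
    nlinarith
  · rw [mul_assoc (5 * K ^ 2) D]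
    exact mul_le_mul_of_nonneg_left (hD n) (by positivity)
  · simpa [mul_div_assoc] using (tendsto_slow_sq_div hm).const_mul (5 * K ^ 2)

lemma tendsto_varStat_diffStat (hm : 2 ≤ m) :
    Tendsto (fun n => varStat hm (diffStat m) n / quad n) atTop (𝓝 0) := by
  obtain ⟨C, hC⟩ := exists_meanStat_sizeStat hm
  obtain ⟨l, C', hC'⟩ := exists_meanStat_diffStat hm
  have hC0 := nonneg_of_le_slow hC
  have hC0' := nonneg_of_le_slow hC'
  set K : ℝ := C + |occupancy m * m - 1| + C' * (m + 1) with hK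
  have hK0 : 0 ≤ K := by positivity
  have hS := tendsto_varStat_sizeStat hm
  -- The toll is the fluctuation of the number of nodes plus a slow remainder bounded by K·slow.
  -- Squaring the sum costs a factor 2, and `varStat_rec_le` a factor 5.
  have hlim : Tendsto (fun n => (10 * varStat hm sizeStat n + 10 * K ^ 2 * slow hm n ^ 2) / quad n)
      atTop (𝓝 0) := by
    have := (hS.const_mul 10).add ((tendsto_slow_sq_div hm).const_mul (10 * K ^ 2))
    simpa [add_div, mul_div_assoc] using this
  obtain ⟨D, hD⟩ := hlim.bddAbove_range
  refine tendsto_div_quad hm (varStat_nonneg hm _)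
    (β := fun n => 10 * varStat hm sizeStat n + 10 * K ^ 2 * slow hm n ^ 2) (fun n hn => ?_)
    (C := D) (fun n => (div_le_iff₀ (quad_pos n)).1 (hD ⟨n, rfl⟩)) hlim
  refine (varStat_rec_le hm hn (diffStat_rec hm hn)).trans (add_le_add le_rfl ?_)
  have h1 : ∀ σ : Equiv.Perm (Fin n), (sizeStat (stats hm (List.ofFn σ)) - 1
      - occupancy m * (n - (m - 1)) + ∑ r : Fin m, meanStat hm (diffStat m) (gap (permRoots m σ) r)
      - meanStat hm (diffStat m) n) ^ 2
      ≤ 2 * (sizeStat (stats hm (List.ofFn σ)) - meanStat hm sizeStat n) ^ 2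
        + 2 * K ^ 2 * slow hm n ^ 2 := by
    intro σ
    set Z := (meanStat hm sizeStat n - occupancy m * (n + 1)) + (occupancy m * m - 1)
      + (∑ r : Fin m, meanStat hm (diffStat m) (gap (permRoots m σ) r)
        - meanStat hm (diffStat m) n) with hZ
    have hZ1 : |Z| ≤ K * slow hm n := by
      have e1 := hC n
      have e2 := abs_sum_mean_sub_le hm hn hC' σ
      have e3 : |occupancy m * m - 1| ≤ |occupancy m * m - 1| * slow hm n :=
        le_mul_of_one_le_right (abs_nonneg _) (one_le_slow hm n)
      refine (abs_add_le _ _).trans ((add_le_add (abs_add_le _ _) e2).trans ?_)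
      rw [hK]
      linarith
    have hZ2 : Z ^ 2 ≤ K ^ 2 * slow hm n ^ 2 := by
      rw [← mul_pow]
      exact sq_le_sq' (neg_le_of_abs_le hZ1) (le_of_abs_le hZ1)
    have e : sizeStat (stats hm (List.ofFn σ)) - 1
      - occupancy m * (n - (m - 1)) + ∑ r : Fin m, meanStat hm (diffStat m) (gap (permRoots m σ) r)
      - meanStat hm (diffStat m) n
      = (sizeStat (stats hm (List.ofFn σ)) - meanStat hm sizeStat n) + Z := by rw [hZ]; ring
    rw [e]
    nlinarith [sq_nonneg (sizeStat (stats hm (List.ofFn σ)) - meanStat hm sizeStat n - Z)]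
  have h2 := Finset.expect_le_expect (s := Finset.univ) fun σ _ => h1 σ
  rw [Finset.expect_add_distrib, Fintype.expect_const, ← Finset.mul_expect] at h2
  rw [varStat]
  linarith

end MaryTree
-- Coupling of the root keys with a uniform sample
namespace MaryTree

variable {m n : ℕ}

instance uniformSample_isProbabilityMeasure (m : ℕ) : IsProbabilityMeasure (uniformSample m) := by
  have : IsProbabilityMeasure ((volume : Measure ℝ).restrict (Set.Icc 0 1)) := ⟨by simp⟩
  unfold uniformSample
  infer_instance

lemma uniformSample_eq_restrict (m : ℕ) :
    uniformSample m = (volume : Measure (Fin (m - 1) → ℝ)).restrict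
      (Set.univ.pi fun _ => Set.Icc 0 1) := by
  rw [uniformSample, volume_pi, Measure.restrict_pi_pi]

lemma ae_mem_Ioo (m : ℕ) : ∀ᵐ u ∂uniformSample m, ∀ i, u i ∈ Set.Ioo (0 : ℝ) 1 := by
  rw [uniformSample, ae_all_iff]
  intro i
  have h : ∀ᵐ x ∂(volume : Measure ℝ).restrict (Set.Icc (0 : ℝ) 1), x ∈ Set.Ioo (0 : ℝ) 1 := by
    rw [← Measure.restrict_congr_set Ioo_ae_eq_Icc]
    exact ae_restrict_mem measurableSet_Ioo
  exact (Measure.tendsto_eval_ae_ae (μ := fun _ : Fin (m - 1) => _)).eventually h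

lemma ae_injective (m : ℕ) : ∀ᵐ u ∂uniformSample m, Function.Injective u := by
  rw [uniformSample_eq_restrict]
  refine ae_restrict_of_ae ?_
  have h : ∀ i j : Fin (m - 1), i ≠ j → ∀ᵐ u : Fin (m - 1) → ℝ, u i ≠ u j := by
    intro i j hij
    let S : Submodule ℝ (Fin (m - 1) → ℝ) :=
      LinearMap.ker (LinearMap.proj i - LinearMap.proj (R := ℝ) (φ := fun _ => ℝ) j)
    have hS : S ≠ ⊤ := by
      intro h
      have : Pi.single i (1 : ℝ) ∈ S := h ▸ Submodule.mem_top
      simp [S, hij.symm] at this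
    have := Measure.addHaar_submodule (volume : Measure (Fin (m - 1) → ℝ)) S hS
    rw [ae_iff]
    convert this using 2
    ext u
    simp [S, sub_eq_zero]
  have h2 : ∀ᵐ u : Fin (m - 1) → ℝ, ∀ i j, i ≠ j → u i ≠ u j := by
    simp only [ae_all_iff]
    exact h
  filter_upwards [h2] with u hu i j hij
  by_contra hne
  exact hu i j hne hij

/-- The index of the cell of `[0, 1)` that contains `x`, among `n + 1` cells of equal length. -/
noncomputable def cell (n : ℕ) (x : ℝ) : Fin (n + 1) := Fin.ofNat (n + 1) ⌊((n + 1 : ℕ) : ℝ) * x⌋₊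

lemma measurable_cell (n : ℕ) : Measurable (cell n) :=
  (measurable_of_countable (fun k : ℕ => Fin.ofNat (n + 1) k)).comp
    (Nat.measurable_floor.comp (measurable_const_mul _))

/-- On `[0, 1)` the reduction modulo `n + 1` in `cell` has no effect; the endpoint 1 is a null set.
-/
lemma val_cell {x : ℝ} (hx : x ∈ Set.Ico (0 : ℝ) 1) : (cell n x : ℕ) = ⌊((n + 1 : ℕ) : ℝ) * x⌋₊ := by
  have : ⌊((n + 1 : ℕ) : ℝ) * x⌋₊ < n + 1 := by
    rw [Nat.floor_lt (by have := hx.1; positivity)]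
    have := hx.2
    have h : (0 : ℝ) < (n + 1 : ℕ) := by positivity
    nlinarith
  simp only [cell, Fin.val_ofNat]
  exact Nat.mod_eq_of_lt this

lemma map_cell_singleton (n : ℕ) (i : Fin (n + 1)) :
    ((volume : Measure ℝ).restrict (Set.Icc 0 1)).map (cell n) {i}
      = ENNReal.ofReal (1 / (n + 1 : ℕ)) := by
  have hn : (0 : ℝ) < (n + 1 : ℕ) := by positivity
  have hi : ((i : ℕ) : ℝ) + 1 ≤ (n + 1 : ℕ) := by exact_mod_cast i.2
  rw [Measure.map_apply (measurable_cell n) (measurableSet_singleton _),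
    ← Measure.restrict_congr_set Ico_ae_eq_Icc, Measure.restrict_apply' measurableSet_Ico]
  have : cell n ⁻¹' {i} ∩ Set.Ico 0 1
      = Set.Ico ((i : ℕ) / (n + 1 : ℕ) : ℝ) (((i : ℕ) + 1) / (n + 1 : ℕ)) := by
    ext x
    simp only [Set.mem_inter_iff, Set.mem_preimage, Set.mem_singleton_iff]
    constructor
    · rintro ⟨h, hx⟩
      rw [Fin.ext_iff, val_cell hx, Nat.floor_eq_iff (by have := hx.1; positivity)] at h
      rw [Set.mem_Ico, div_le_iff₀ hn, lt_div_iff₀ hn]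
      constructor <;> linarith [h.1, h.2]
    · rintro ⟨h1, h2⟩
      rw [div_le_iff₀ hn] at h1
      rw [lt_div_iff₀ hn] at h2
      have h0 : (0 : ℝ) ≤ (i : ℕ) := by positivity
      have hx : x ∈ Set.Ico (0 : ℝ) 1 := by
        constructor
        · by_contra! h; nlinarith
        · by_contra! h; nlinarith
      refine ⟨?_, hx⟩
      rw [Fin.ext_iff, val_cell hx, Nat.floor_eq_iff (by have := hx.1; positivity)]
      constructor <;> linarith
  rw [this, Real.volume_Ico]
  congr 1
  field_simp
  ring

/-- Integrals of functions of the cells of a uniform sample. -/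
lemma integral_cell {𝕜 : Type*} [RCLike 𝕜] (m n : ℕ) (h : (Fin (m - 1) → Fin (n + 1)) → 𝕜) :
    ∫ u, h (fun i => cell n (u i)) ∂uniformSample m
      = (1 / ((n + 1 : ℕ) : 𝕜) ^ (m - 1)) * ∑ x, h x := by
  have hpm : IsProbabilityMeasure ((volume : Measure ℝ).restrict (Set.Icc 0 1)) := ⟨by simp⟩
  have hmeas : Measurable fun (u : Fin (m - 1) → ℝ) i => cell n (u i) :=
    measurable_pi_lambda _ fun i => (measurable_cell n).comp (measurable_pi_apply i)
  have hmap : (uniformSample m).map (fun u i => cell n (u i)) = Measure.pi fun _ =>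
      ((volume : Measure ℝ).restrict (Set.Icc 0 1)).map (cell n) := by
    have hpc := Measure.isProbabilityMeasure_map
      (μ := (volume : Measure ℝ).restrict (Set.Icc 0 1)) (measurable_cell n).aemeasurable
    exact Measure.pi_map_pi fun _ => (measurable_cell n).aemeasurable
  have hpc := Measure.isProbabilityMeasure_map
    (μ := (volume : Measure ℝ).restrict (Set.Icc 0 1)) (measurable_cell n).aemeasurable
  have h1 : ∫ u, h (fun i => cell n (u i)) ∂uniformSample m
      = ∫ x, h x ∂((uniformSample m).map (fun u i => cell n (u i))) :=
    (integral_map hmeas.aemeasurable (Measurable.of_discrete).aestronglyMeasurable).symm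
  rw [h1, hmap, integral_fintype .of_finite, Finset.mul_sum]
  refine Finset.sum_congr rfl fun x _ => ?_
  rw [measureReal_def, Measure.pi_singleton]
  simp only [map_cell_singleton, Finset.prod_const, Finset.card_univ, Fintype.card_fin]
  rw [ENNReal.toReal_pow, ENNReal.toReal_ofReal (by positivity), RCLike.real_smul_eq_coe_mul]
  simp

/-- The set of cells hit by a sample. -/
noncomputable def cellRoots (n : ℕ) {k : ℕ} (u : Fin k → ℝ) : Finset (Fin (n + 1)) :=
  Finset.univ.image fun i => cell n (u i)

/-- Every set of `m - 1` keys occurs as a root set, so bounds proved for root sets of permutations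
carry over to sets of cells. -/
lemma exists_permRoots_eq (hn : m - 1 ≤ n) {R : Finset (Fin n)} (hR : R.card = m - 1) :
    ∃ σ, permRoots m σ = R := by
  obtain ⟨π, hπ⟩ := exists_perm_comp_eq (firstKeys hn 1) (R.orderEmbOfFin hR).toEmbedding
  refine ⟨π, ?_⟩
  have h : firstKeys hn π = (R.orderEmbOfFin hR).toEmbedding := by
    ext i
    rw [← hπ i]
    rfl
  rw [permRoots_eq_map hn, h]
  ext x
  rw [← Finset.mem_coe, Finset.coe_map, Finset.coe_univ, Set.image_univ]
  change x ∈ Set.range (R.orderEmbOfFin hR) ↔ _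
  rw [Finset.range_orderEmbOfFin, Finset.mem_coe]

open Classical in
/-- The expectation of a function of the root keys, as an integral over a uniform sample. -/
lemma expect_permRoots_eq {𝕜 : Type*} [RCLike 𝕜] (hn : m - 1 ≤ n + 1)
    (G : Finset (Fin (n + 1)) → 𝕜) :
    𝔼 σ : Equiv.Perm (Fin (n + 1)), G (permRoots m σ)
      = (((n + 1 : ℕ) : 𝕜) ^ (m - 1) / ((n + 1).descFactorial (m - 1) : ℕ))
        * ∫ u, (if (cellRoots n u).card = m - 1 then G (cellRoots n u) else 0)
            ∂uniformSample m := by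
  have hinj : ∀ x : Fin (m - 1) → Fin (n + 1),
      (Finset.univ.image x).card = m - 1 ↔ Function.Injective x := by
    intro x
    have h := Finset.card_image_iff (s := Finset.univ) (f := x)
    rwa [Finset.card_univ, Fintype.card_fin, Finset.coe_univ, Set.injOn_univ] at h
  -- The cells are independent and uniform; given that they are distinct, they form a uniform tuple
  -- of distinct keys. The prefactor in the statement is the reciprocal of the probability of
  -- distinctness.
  have h1 := integral_cell m n fun x : Fin (m - 1) → Fin (n + 1) =>
    if (Finset.univ.image x).card = m - 1 then G (Finset.univ.image x) else 0
  change ∫ u, (if (cellRoots n u).card = m - 1 then G (cellRoots n u) else 0)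
    ∂uniformSample m = _ at h1
  rw [h1]
  simp only [permRoots_eq_map hn]
  rw [expect_firstKeys hn fun x => G (Finset.univ.map x), Fintype.expect_eq_sum_div_card,
    Fintype.card_embedding_eq, Fintype.card_fin, Fintype.card_fin]
  have h2 : ∑ x : Fin (m - 1) ↪ Fin (n + 1), G (Finset.univ.map x)
      = ∑ x : Fin (m - 1) → Fin (n + 1),
        if (Finset.univ.image x).card = m - 1 then G (Finset.univ.image x) else 0 := by
    simp only [hinj]
    rw [← Finset.sum_filter, ← Finset.sum_subtype_eq_sum_filter]
    have : Finset.subtype (fun x : Fin (m - 1) → Fin (n + 1) => Function.Injective x) Finset.univ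
        = Finset.univ := by ext; simp
    rw [this]
    refine (Fintype.sum_equiv (Equiv.subtypeInjectiveEquivEmbedding _ _) _ _ fun x => ?_).symm
    rw [Finset.map_eq_image]
    rfl
  rw [h2]
  have : (((n + 1 : ℕ) : 𝕜) ^ (m - 1)) ≠ 0 := pow_ne_zero _ (Nat.cast_ne_zero.2 (by omega))
  field_simp

lemma measurable_comp_cellRoots {β : Type*} [MeasurableSpace β] (n k : ℕ)
    (G : Finset (Fin (n + 1)) → β) : Measurable fun u : Fin k → ℝ => G (cellRoots n u) := by
  have hmeas : Measurable fun (u : Fin k → ℝ) i => cell n (u i) :=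
    measurable_pi_lambda _ fun i => (measurable_cell n).comp (measurable_pi_apply i)
  exact (Measurable.of_discrete
    (f := fun x : Fin k → Fin (n + 1) => G (Finset.univ.image x))).comp hmeas

lemma tendsto_pow_div_descFactorial (k : ℕ) :
    Tendsto (fun n : ℕ => (n : ℝ) ^ k / (n.descFactorial k : ℕ)) atTop (𝓝 1) := by
  have h := (isEquivalent_descFactorial k).symm
  rw [Asymptotics.isEquivalent_iff_tendsto_one] at h
  · exact h
  · filter_upwards [eventually_ge_atTop k] with n hn
    exact_mod_cast (Nat.descFactorial_pos.2 hn).ne'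

section Sorted

variable {k : ℕ} {u : Fin k → ℝ}

lemma strictMono_comp_sort (hu : Function.Injective u) : StrictMono (u ∘ Tuple.sort u) :=
  (Tuple.monotone_sort u).strictMono_of_injective (hu.comp (Tuple.sort u).injective)

lemma eventually_strictMono_cell (h01 : ∀ i, u i ∈ Set.Ioo (0 : ℝ) 1)
    (hu : Function.Injective u) :
    ∀ᶠ n in atTop, StrictMono fun j => cell n (u (Tuple.sort u j)) := by
  have h : ∀ i j : Fin k, ∀ᶠ n in atTop, i < j →
      cell n (u (Tuple.sort u i)) < cell n (u (Tuple.sort u j)) := by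
    intro i j
    by_cases hij : i < j
    · have hlt := strictMono_comp_sort hu hij
      simp only [Function.comp_apply] at hlt
      set a := u (Tuple.sort u i)
      set b := u (Tuple.sort u j)
      have ht : Tendsto (fun n : ℕ => ((n + 1 : ℕ) : ℝ) * (b - a)) atTop atTop :=
        (tendsto_natCast_atTop_atTop.comp (tendsto_add_atTop_nat 1)).atTop_mul_const
          (sub_pos.2 hlt)
      filter_upwards [ht.eventually_ge_atTop 1] with n hn _
      have ha := h01 (Tuple.sort u i)
      have hb := h01 (Tuple.sort u j)
      rw [Fin.lt_def, val_cell ⟨ha.1.le, ha.2⟩, val_cell ⟨hb.1.le, hb.2⟩]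
      rw [← Nat.add_one_le_iff, ← Nat.floor_add_one (by have := ha.1; positivity)]
      exact Nat.floor_mono (by change ((n + 1 : ℕ) : ℝ) * a + 1 ≤ ((n + 1 : ℕ) : ℝ) * b; linarith)
    · exact Eventually.of_forall fun n h => absurd h hij
  filter_upwards [eventually_all.2 fun i => eventually_all.2 (h i)] with n hn i j hij
  exact hn i j hij

lemma cellRoots_eq_image_sort (n : ℕ) (u : Fin k → ℝ) :
    cellRoots n u = Finset.univ.image fun j => cell n (u (Tuple.sort u j)) := by
  ext x
  simp only [cellRoots, Finset.mem_image, Finset.mem_univ, true_and]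
  exact ⟨fun ⟨i, hi⟩ => ⟨(Tuple.sort u).symm i, by simpa using hi⟩, fun ⟨i, hi⟩ => ⟨_, hi⟩⟩

lemma card_cellRoots (h : StrictMono fun j => cell n (u (Tuple.sort u j))) :
    (cellRoots n u).card = k := by
  rw [cellRoots_eq_image_sort, Finset.card_image_of_injective _ h.injective, Finset.card_univ,
    Fintype.card_fin]

lemma sum_gap_cellRoots (h01 : ∀ i, u i ∈ Set.Ioo (0 : ℝ) 1)
    (h : StrictMono fun j => cell n (u (Tuple.sort u j))) (j : Fin k) :
    ∑ i ∈ Finset.range (j + 1), gap (cellRoots n u) i + j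
      = ⌊((n + 1 : ℕ) : ℝ) * u (Tuple.sort u j)⌋₊ := by
  have hb := h01 (Tuple.sort u j)
  rw [sum_range_gap_add (card_cellRoots h), ← Finset.orderEmbOfFin_unique (card_cellRoots h)
    (fun x => ?_) h, val_cell ⟨hb.1.le, hb.2⟩]
  rw [cellRoots_eq_image_sort]
  exact Finset.mem_image_of_mem _ (Finset.mem_univ x)

/-- By `sum_gap_cellRoots` the partial sums of the gaps are integer parts of `(n + 1)` times the
order statistics, up to a bounded shift. There are `n + 1` keys here, whence the denominator `n +
2`. -/
lemma tendsto_sum_gap_cellRoots (h01 : ∀ i, u i ∈ Set.Ioo (0 : ℝ) 1) (hu : Function.Injective u)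
    {j : ℕ} (hj : j ≤ k + 1) :
    Tendsto (fun n : ℕ => (∑ i ∈ Finset.range j, ((gap (cellRoots n u) i : ℝ) + 1))
      / ((n + 1 : ℕ) + 1 : ℝ)) atTop (𝓝 (orderStat u j)) := by
  have hstrict := eventually_strictMono_cell h01 hu
  rcases Nat.eq_zero_or_pos j with rfl | hpos
  · simp [orderStat]
  obtain ⟨j, rfl⟩ := Nat.exists_eq_succ_of_ne_zero hpos.ne'
  rw [orderStat, if_neg (by omega)]
  by_cases hjk : j < k
  · rw [dif_pos (by simpa using hjk)]
    set x := u (Tuple.sort u ⟨j, hjk⟩) with hx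
    have hx0 := h01 (Tuple.sort u ⟨j, hjk⟩)
    have h1 : Tendsto (fun n : ℕ => (⌊x * ((n + 1 : ℕ) : ℝ)⌋₊ : ℝ) / ((n + 1 : ℕ) : ℝ)) atTop
        (𝓝 x) :=
      (tendsto_nat_floor_mul_div_atTop hx0.1.le).comp
        (tendsto_natCast_atTop_atTop.comp (tendsto_add_atTop_nat 1))
    have h2 : Tendsto (fun n : ℕ => 1 / ((n + 1 : ℕ) + 1 : ℝ)) atTop (𝓝 0) :=
      tendsto_one_div_add_atTop_nhds_zero_nat.comp (tendsto_add_atTop_nat 1)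
    have h3 : Tendsto (fun n : ℕ => (⌊x * ((n + 1 : ℕ) : ℝ)⌋₊ : ℝ) / ((n + 1 : ℕ) : ℝ)
        * (1 - 1 / ((n + 1 : ℕ) + 1 : ℝ)) + 1 / ((n + 1 : ℕ) + 1 : ℝ)) atTop (𝓝 x) := by
      simpa using (h1.mul (h2.const_sub 1)).add h2
    refine h3.congr' ?_
    filter_upwards [hstrict] with n hn
    have h4 := sum_gap_cellRoots h01 hn ⟨j, hjk⟩
    rw [mul_comm, ← hx] at h4
    have h5 : ∑ i ∈ Finset.range (j + 1), ((gap (cellRoots n u) i : ℝ) + 1)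
        = ⌊x * ((n + 1 : ℕ) : ℝ)⌋₊ + 1 := by
      rw [← h4]
      push_cast
      rw [Finset.sum_add_distrib]
      simp
      ring
    rw [Nat.succ_eq_add_one, h5]
    have : ((n + 1 : ℕ) : ℝ) ≠ 0 := by positivity
    have : ((n + 1 : ℕ) + 1 : ℝ) ≠ 0 := by positivity
    field_simp
    ring
  -- The last partial sum comprises all keys, so the quotient is eventually 1, the conventional
  -- value of the final order statistic.
  · rw [dif_neg (by simpa using hjk)]
    have hjk' : j = k := by omega
    subst hjk'
    refine tendsto_const_nhds.congr' ?_
    filter_upwards [hstrict, eventually_ge_atTop j] with n hn hnj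
    have h4 := sum_gap (m := j + 1) (R := cellRoots n u) (by rw [card_cellRoots hn]; omega)
    rw [card_cellRoots hn] at h4
    have h5 : ∑ i ∈ Finset.range (j + 1), ((gap (cellRoots n u) i : ℝ) + 1)
        = (n + 1 : ℕ) + 1 := by
      rw [Finset.sum_add_distrib, Finset.sum_range (fun i => (gap (cellRoots n u) i : ℝ))]
      have h6 : ∑ i : Fin (j + 1), (gap (cellRoots n u) i : ℝ) = ((n + 1 - j : ℕ) : ℝ) := by
        exact_mod_cast h4
      rw [h6, Nat.cast_sub (by omega)]
      simp
      ring
    rw [Nat.succ_eq_add_one, h5, div_self (by positivity)]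

end Sorted

lemma orderStat_lt {k : ℕ} {u : Fin k → ℝ} (h01 : ∀ i, u i ∈ Set.Ioo (0 : ℝ) 1)
    (hu : Function.Injective u) {j : ℕ} (hj : j ≤ k) : orderStat u j < orderStat u (j + 1) := by
  rw [orderStat, orderStat, if_neg (Nat.succ_ne_zero j)]
  simp only [Nat.add_sub_cancel]
  rcases Nat.eq_zero_or_pos j with rfl | hpos
  · simp only [if_true]
    split_ifs with h
    · exact (h01 _).1
    · exact one_pos
  · rw [if_neg hpos.ne', dif_pos (by omega)]
    split_ifs with h
    · exact strictMono_comp_sort hu (Fin.lt_def.2 (by change j - 1 < j; omega))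
    · exact (h01 _).2

lemma sum_spacing (hm : 2 ≤ m) (u : Fin (m - 1) → ℝ) : ∑ r : Fin m, spacing u r = 1 := by
  have h := Finset.sum_range_sub (fun j => orderStat u j) m
  rw [Finset.sum_range] at h
  rw [show (∑ r : Fin m, spacing u r) = _ from h]
  simp only [orderStat]
  rw [if_neg (by omega), dif_neg (by omega)]
  simp

lemma ae_spacing_pos (hm : 2 ≤ m) :
    ∀ᵐ u ∂uniformSample m, ∀ r : Fin m, 0 < spacing u r := by
  filter_upwards [ae_mem_Ioo m, ae_injective m] with u h1 h2 r
  exact sub_pos.2 (orderStat_lt h1 h2 (by omega))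

lemma ae_tendsto_proportion (hm : 2 ≤ m) : ∀ᵐ u ∂uniformSample m,
    (∀ᶠ n in atTop, (cellRoots n u).card = m - 1) ∧
      ∀ r : Fin m, Tendsto (fun n => proportion (cellRoots n u) r) atTop (𝓝 (spacing u r)) := by
  filter_upwards [ae_mem_Ioo m, ae_injective m] with u h1 h2
  refine ⟨(eventually_strictMono_cell h1 h2).mono fun n hn => card_cellRoots hn, fun r => ?_⟩
  have h3 := tendsto_sum_gap_cellRoots h1 h2 (j := r) (by omega)
  have h4 := tendsto_sum_gap_cellRoots h1 h2 (j := r + 1) (by omega)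
  refine (h4.sub h3).congr fun n => ?_
  rw [Finset.sum_range_succ, proportion]
  ring

/-- Functions of the root keys that converge along the cells of almost every sample converge in
mean. -/
theorem tendsto_expect_permRoots {𝕜 : Type*} [RCLike 𝕜] (hm : 2 ≤ m)
    {G : ∀ n, Finset (Fin n) → 𝕜} {M : ℝ}
    (hG : ∀ n, m ≤ n → ∀ σ : Equiv.Perm (Fin n), ‖G n (permRoots m σ)‖ ≤ M)
    {H : (Fin (m - 1) → ℝ) → 𝕜}
    (hH : ∀ᵐ u ∂uniformSample m, Tendsto (fun n => G (n + 1) (cellRoots n u)) atTop (𝓝 (H u))) :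
    Tendsto (fun n => 𝔼 σ : Equiv.Perm (Fin n), G n (permRoots m σ)) atTop
      (𝓝 (∫ u, H u ∂uniformSample m)) := by
  classical
  rw [← tendsto_add_atTop_iff_nat 1]
  have hM : 0 ≤ M := (norm_nonneg _).trans (hG m le_rfl 1)
  have h1 : Tendsto (fun n : ℕ => ((((n + 1 : ℕ) : ℝ) ^ (m - 1)
      / ((n + 1).descFactorial (m - 1) : ℕ) : ℝ) : 𝕜)) atTop (𝓝 ((1 : ℝ) : 𝕜)) :=
    (RCLike.continuous_ofReal.tendsto _).comp
      ((tendsto_pow_div_descFactorial (m - 1)).comp (tendsto_add_atTop_nat 1))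
  have h2 : Tendsto (fun n => ∫ u, (if m ≤ n + 1 ∧ (cellRoots n u).card = m - 1 then
      G (n + 1) (cellRoots n u) else 0) ∂uniformSample m) atTop
      (𝓝 (∫ u, H u ∂uniformSample m)) := by
    refine tendsto_integral_of_dominated_convergence (fun _ => M) (fun n => ?_)
      (integrable_const _) (fun n => Eventually.of_forall fun u => ?_) ?_
    · exact (measurable_comp_cellRoots n (m - 1) fun R =>
        if m ≤ n + 1 ∧ R.card = m - 1 then G (n + 1) R else 0).aestronglyMeasurable
    · split_ifs with h
      · obtain ⟨σ, hσ⟩ := exists_permRoots_eq (by omega) h.2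
        rw [← hσ]
        exact hG _ h.1 σ
      · simpa using hM
    · filter_upwards [hH, ae_tendsto_proportion hm] with u hu h3
      refine hu.congr' ?_
      filter_upwards [h3.1, eventually_ge_atTop m] with n h4 h5
      rw [if_pos ⟨by omega, h4⟩]
  have h3 := h1.mul h2
  rw [RCLike.ofReal_one, one_mul] at h3
  refine h3.congr' ?_
  filter_upwards [eventually_ge_atTop m] with n hn
  rw [expect_permRoots_eq (by omega)]
  have : m ≤ n + 1 := by omega
  simp only [this, true_and]
  push_cast
  rfl

/-- Sorting is avoided: the spacings are almost sure limits of the proportions, which are functions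
of finitely valued cells. -/
lemma aemeasurable_spacing (hm : 2 ≤ m) (r : Fin m) :
    AEMeasurable (fun u : Fin (m - 1) → ℝ => spacing u r) (uniformSample m) := by
  refine aemeasurable_of_tendsto_metrizable_ae atTop
    (f := fun n u => proportion (cellRoots n u) r) (fun n => ?_) ?_
  · exact (measurable_comp_cellRoots n (m - 1) fun R => proportion R r).aemeasurable
  · filter_upwards [ae_tendsto_proportion hm] with u hu
    exact hu.2 r

lemma ae_spacing_mem (hm : 2 ≤ m) :
    ∀ᵐ u ∂uniformSample m, ∀ r : Fin m, spacing u r ∈ Set.Ioc (0 : ℝ) 1 := by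
  filter_upwards [ae_spacing_pos hm] with u hu r
  refine ⟨hu r, ?_⟩
  rw [← sum_spacing hm u]
  exact Finset.single_le_sum (fun i _ => (hu i).le) (Finset.mem_univ r)

/-- The limit of the exact formula `expect_sum_gap_sq`, which gives 2/(m+1). -/
lemma integral_sum_spacing_sq_le (hm : 2 ≤ m) :
    ∫ u, ∑ r : Fin m, spacing u r ^ 2 ∂uniformSample m ≤ 2 / 3 := by
  have h1 := tendsto_expect_permRoots hm (𝕜 := ℝ) (M := m)
    (G := fun n R => ∑ r : Fin m, proportion R r ^ 2)
    (H := fun u => ∑ r : Fin m, spacing u r ^ 2) (fun n hn σ => ?_) ?_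
  · have h2 : Tendsto (fun n : ℕ => 2 / ((m : ℝ) + 1) * (1 + 1 / ((n : ℝ) + 1))) atTop
        (𝓝 (2 / ((m : ℝ) + 1) * (1 + 0))) :=
      (tendsto_one_div_add_atTop_nhds_zero_nat.const_add 1).const_mul _
    have h3 : (2 / ((m : ℝ) + 1) * (1 + 0)) ≤ 2 / 3 := by
      have : (2 : ℝ) ≤ m := by exact_mod_cast hm
      rw [add_zero, mul_one]
      gcongr
      linarith
    refine (le_of_tendsto_of_tendsto h1 h2 ?_).trans h3
    filter_upwards [eventually_ge_atTop m] with n hn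
    have h4 := expect_sum_gap_sq hm (n := n) (by omega)
    have h5 : 2 / ((m : ℝ) + 1) * (1 + 1 / ((n : ℝ) + 1))
        = 1 / ((n : ℝ) + 1) ^ 2 * (2 / (m + 1) * ((n + 1) * (n + 2))) := by
      field_simp
      ring
    rw [h5, ← h4, Finset.mul_expect]
    refine Finset.expect_le_expect fun σ _ => ?_
    rw [Finset.mul_sum]
    refine Finset.sum_le_sum fun r _ => ?_
    rw [proportion, div_pow, one_div_mul_eq_div]
    gcongr
    nlinarith [Nat.cast_nonneg (α := ℝ) (gap (permRoots m σ) r)]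
  · rw [Real.norm_of_nonneg (by positivity)]
    calc _ ≤ ∑ r : Fin m, (1 : ℝ) := Finset.sum_le_sum fun r _ =>
          pow_le_one₀ (proportion_nonneg _ _) (proportion_le_one _ _)
      _ = m := by simp
  · filter_upwards [ae_tendsto_proportion hm] with u hu
    exact tendsto_finsetSum _ fun r _ => (hu.2 r).pow 2

end MaryTree
-- Characteristic functions of the scaled key path length
/-- The complex number of modulus one and argument `x`. -/
noncomputable def unitExp (x : ℝ) : ℂ := Complex.exp (x * Complex.I)

@[simp] lemma norm_unitExp (x : ℝ) : ‖unitExp x‖ = 1 := Complex.norm_exp_ofReal_mul_I x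

lemma unitExp_add (x y : ℝ) : unitExp (x + y) = unitExp x * unitExp y := by
  rw [unitExp, unitExp, unitExp, ← Complex.exp_add]
  push_cast
  ring_nf

lemma unitExp_sum {ι : Type*} (s : Finset ι) (f : ι → ℝ) :
    unitExp (∑ i ∈ s, f i) = ∏ i ∈ s, unitExp (f i) := by
  simp only [unitExp]
  rw [← Complex.exp_sum, ← Finset.sum_mul]
  push_cast
  rfl

lemma continuous_unitExp : Continuous unitExp := by
  unfold unitExp
  fun_prop

lemma norm_unitExp_sub_le (x y : ℝ) : ‖unitExp x - unitExp y‖ ≤ |x - y| := by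
  have h : unitExp x - unitExp y = unitExp y * (unitExp (x - y) - 1) := by
    rw [mul_sub, ← unitExp_add, add_sub_cancel, mul_one]
  rw [h, norm_mul, norm_unitExp, one_mul, unitExp, mul_comm]
  exact Real.norm_exp_I_mul_ofReal_sub_one_le

/-- For |x| ≤ 1 this is Taylor's formula; for |x| > 1 the trivial bound 2|x| is smaller than 2x². -/
lemma norm_unitExp_sub_one_sub_le (x : ℝ) : ‖unitExp x - 1 - x * Complex.I‖ ≤ 2 * x ^ 2 := by
  have hx : ‖(x : ℂ) * Complex.I‖ = |x| := by simp
  rcases le_or_gt |x| 1 with h | h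
  · have := Complex.norm_exp_sub_one_sub_id_le (x := x * Complex.I) (by rw [hx]; exact h)
    rw [hx, sq_abs] at this
    exact this.trans (by nlinarith [sq_nonneg x])
  · have h1 := norm_unitExp_sub_le x 0
    have h2 : unitExp 0 = 1 := by simp [unitExp]
    rw [h2, sub_zero] at h1
    refine (norm_sub_le _ _).trans ?_
    rw [hx]
    nlinarith [sq_abs x]

lemma norm_prod_sub_prod_le_sum {ι : Type*} (s : Finset ι) {a b : ι → ℂ} (ha : ∀ i, ‖a i‖ ≤ 1)
    (hb : ∀ i, ‖b i‖ ≤ 1) : ‖∏ i ∈ s, a i - ∏ i ∈ s, b i‖ ≤ ∑ i ∈ s, ‖a i - b i‖ := by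
  classical
  induction s using Finset.induction_on with
  | empty => simp
  | insert i s his ih =>
    rw [Finset.prod_insert his, Finset.prod_insert his, Finset.sum_insert his]
    have h : a i * ∏ j ∈ s, a j - b i * ∏ j ∈ s, b j
        = (a i - b i) * ∏ j ∈ s, a j + b i * (∏ j ∈ s, a j - ∏ j ∈ s, b j) := by ring
    rw [h]
    refine (norm_add_le _ _).trans ?_
    rw [norm_mul, norm_mul, norm_prod]
    have h1 : ∏ j ∈ s, ‖a j‖ ≤ 1 := Finset.prod_le_one (fun _ _ => norm_nonneg _) fun j _ => ha j
    have h2 := norm_nonneg (a i - b i)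
    have h3 := norm_nonneg (∏ j ∈ s, a j - ∏ j ∈ s, b j)
    nlinarith [hb i]

lemma norm_expect_le {ι : Type*} (s : Finset ι) (f : ι → ℂ) : ‖𝔼 i ∈ s, f i‖ ≤ 𝔼 i ∈ s, ‖f i‖ := by
  rw [Finset.expect_eq_sum_div_card, Finset.expect_eq_sum_div_card, norm_div]
  simp only [RCLike.norm_natCast]
  exact div_le_div_of_nonneg_right (norm_sum_le _ _) (Nat.cast_nonneg _)

namespace MaryTree

variable {m n : ℕ}

/-- The centered and rescaled key path length. -/
noncomputable def scaledKey (hm : 2 ≤ m) (n : ℕ) (τ : Equiv.Perm (Fin n)) : ℝ :=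
  (keyStat (stats hm (List.ofFn τ)) - meanStat hm keyStat n) / (n + 1)

/-- The characteristic function of the centered and rescaled key path length. -/
noncomputable def keyChar (hm : 2 ≤ m) (n : ℕ) (t : ℝ) : ℂ :=
  𝔼 τ : Equiv.Perm (Fin n), unitExp (t * scaledKey hm n τ)

lemma expect_scaledKey (hm : 2 ≤ m) (n : ℕ) : 𝔼 τ, scaledKey hm n τ = 0 := by
  simp only [scaledKey]
  rw [← Finset.expect_div, expect_sub_meanStat, zero_div]

lemma exists_expect_scaledKey_sq_le (hm : 2 ≤ m) :
    ∃ B : ℝ, 0 ≤ B ∧ ∀ n, 𝔼 τ, scaledKey hm n τ ^ 2 ≤ B := by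
  obtain ⟨M, hM, h⟩ := varStat_keyStat_le hm
  refine ⟨2 * M, by positivity, fun n => ?_⟩
  simp only [scaledKey, div_pow]
  rw [← Finset.expect_div]
  rw [div_le_iff₀ (by positivity)]
  refine (h n).trans ?_
  rw [mul_right_comm, mul_comm]
  have : quad n ≤ ((n : ℝ) + 1) ^ 2 * 2 := by
    unfold quad
    nlinarith [(Nat.cast_nonneg n : (0 : ℝ) ≤ n)]
  nlinarith

lemma norm_keyChar_le_one (hm : 2 ≤ m) (n : ℕ) (t : ℝ) : ‖keyChar hm n t‖ ≤ 1 := by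
  refine (norm_expect_le _ _).trans ?_
  simp

/-- Bounded second moments give the uniform Lipschitz bound, and centring improves it to a quadratic
bound at 0. The quadratic order is essential: a linear bound would lead to the factor ∑V_r = 1,
without contraction. -/
lemma exists_norm_keyChar_sub_le (hm : 2 ≤ m) : ∃ B : ℝ, 0 ≤ B ∧
    (∀ n t s, ‖keyChar hm n t - keyChar hm n s‖ ≤ B * |t - s|) ∧
      ∀ n t, ‖keyChar hm n t - 1‖ ≤ B * t ^ 2 := by
  obtain ⟨B, hB0, hB⟩ := exists_expect_scaledKey_sq_le hm
  refine ⟨1 + 2 * B, by positivity, fun n t s => ?_, fun n t => ?_⟩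
  · rw [keyChar, keyChar, ← Finset.expect_sub_distrib]
    refine (norm_expect_le _ _).trans ?_
    have h : ∀ τ : Equiv.Perm (Fin n), ‖unitExp (t * scaledKey hm n τ)
        - unitExp (s * scaledKey hm n τ)‖ ≤ |t - s| * (1 + scaledKey hm n τ ^ 2) := by
      intro τ
      refine (norm_unitExp_sub_le _ _).trans ?_
      rw [← sub_mul, abs_mul]
      refine mul_le_mul_of_nonneg_left ?_ (abs_nonneg _)
      nlinarith [sq_abs (scaledKey hm n τ), sq_nonneg (|scaledKey hm n τ| - 1)]
    refine (Finset.expect_le_expect fun τ _ => h τ).trans ?_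
    rw [← Finset.mul_expect, Finset.expect_add_distrib, Fintype.expect_const, mul_comm]
    exact mul_le_mul_of_nonneg_right (by linarith [hB n]) (abs_nonneg _)
  · have h : keyChar hm n t - 1 = 𝔼 τ, (unitExp (t * scaledKey hm n τ) - 1
        - (t * scaledKey hm n τ : ℝ) * Complex.I) := by
      have h0 : 𝔼 τ, ((t * scaledKey hm n τ : ℝ) * Complex.I) = 0 := by
        rw [← Finset.expect_mul]
        have h1 : 𝔼 τ, ((t * scaledKey hm n τ : ℝ) : ℂ)
            = ((𝔼 τ, t * scaledKey hm n τ : ℝ) : ℂ) := by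
          rw [Finset.expect_eq_sum_div_card, Finset.expect_eq_sum_div_card]
          push_cast
          rfl
        rw [h1, ← Finset.mul_expect, expect_scaledKey]
        simp
      rw [Finset.expect_sub_distrib, h0, sub_zero, Finset.expect_sub_distrib, Fintype.expect_const,
        keyChar]
    rw [h]
    refine (norm_expect_le _ _).trans ((Finset.expect_le_expect fun τ _ =>
      norm_unitExp_sub_one_sub_le _).trans ?_)
    simp only [mul_pow]
    rw [← Finset.mul_expect, ← Finset.mul_expect]
    nlinarith [hB n, sq_nonneg t, mul_le_mul_of_nonneg_left (hB n) (sq_nonneg t)]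

/-- The contribution of the root to the characteristic function of the key path length. -/
noncomputable def rootChar (hm : 2 ≤ m) (t : ℝ) (R : Finset (Fin n)) : ℂ :=
  unitExp (t * (keyToll hm R / (n + 1)))
    * ∏ r : Fin m, keyChar hm (gap R r) (t * proportion R r)

lemma norm_rootChar_le_one (hm : 2 ≤ m) (t : ℝ) (R : Finset (Fin n)) :
    ‖rootChar hm t R‖ ≤ 1 := by
  rw [rootChar, norm_mul, norm_unitExp, one_mul, norm_prod]
  exact Finset.prod_le_one (fun _ _ => norm_nonneg _) fun r _ => norm_keyChar_le_one hm _ _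

lemma keyChar_rec (hm : 2 ≤ m) (hn : m ≤ n) (t : ℝ) :
    keyChar hm n t = 𝔼 σ : Equiv.Perm (Fin n), rootChar hm t (permRoots m σ) := by
  have hn0 : (n : ℝ) + 1 ≠ 0 := by positivity
  have hm0 : (m : ℝ) ≠ 0 := by positivity
  -- The theorem accepts only products over the subtrees, so the phase of the toll is distributed
  -- evenly over the `m` factors.
  have h := expect_prod_subtrees hm (show m - 1 ≤ n by omega)
    (fun R r x => unitExp (t * (keyToll hm R / (n + 1)) / m)
      * unitExp (t * ((keyStat x - meanStat hm keyStat (gap R r)) / (n + 1))))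
  refine (Finset.expect_congr rfl fun σ _ => ?_).trans (h.trans
    (Finset.expect_congr rfl fun σ _ => ?_))
  · rw [Finset.prod_mul_distrib, ← unitExp_sum, ← unitExp_sum, ← unitExp_add]
    congr 1
    simp only [Finset.sum_const, Finset.card_univ, Fintype.card_fin, nsmul_eq_mul]
    rw [scaledKey, sub_meanStat_eq hm (keyStat_rec hm hn) σ, ← Finset.mul_sum, ← Finset.sum_div]
    change _ * ((centeredSum hm keyStat σ + keyToll hm (permRoots m σ)) / _)
      = _ + _ * (centeredSum hm keyStat σ / _)
    field_simp
    ring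
  · simp only [← Finset.mul_expect]
    rw [Finset.prod_mul_distrib, ← unitExp_sum, rootChar]
    congr 1
    · simp only [Finset.sum_const, Finset.card_univ, Fintype.card_fin, nsmul_eq_mul]
      congr 1
      field_simp
    · refine Finset.prod_congr rfl fun r _ => Finset.expect_congr rfl fun τ _ => ?_
      congr 1
      rw [scaledKey, proportion]
      have : (gap (permRoots m σ) r : ℝ) + 1 ≠ 0 := by positivity
      field_simp

/-- The mean square contraction of the recursion. -/
lemma eq_zero_of_le_integral_spacing (hm : 2 ≤ m) {L : ℝ → ℝ} {C : ℝ} (h0 : ∀ t, 0 ≤ L t)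
    (hC : ∀ t, L t ≤ C * t ^ 2)
    (hL : ∀ t, L t ≤ ∫ u, ∑ r : Fin m, L (t * spacing u r) ∂uniformSample m) (t : ℝ) :
    L t = 0 := by
  have hC0 : 0 ≤ C := by simpa using (h0 1).trans (hC 1)
  have hint : Integrable (fun u => ∑ r : Fin m, spacing u r ^ 2) (uniformSample m) := by
    refine integrable_finsetSum _ fun r _ => ?_
    refine Integrable.of_bound ((aemeasurable_spacing hm r).pow_const 2).aestronglyMeasurable 1 ?_
    filter_upwards [ae_spacing_mem hm] with u hu
    rw [Real.norm_of_nonneg (sq_nonneg _)]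
    exact pow_le_one₀ (hu r).1.le (hu r).2
  have key : ∀ k : ℕ, ∀ t, L t ≤ C * (2 / 3) ^ k * t ^ 2 := by
    intro k
    induction k with
    | zero => simpa using hC
    | succ k ih =>
      intro t
      refine (hL t).trans ?_
      have h1 : ∫ u, ∑ r : Fin m, L (t * spacing u r) ∂uniformSample m
          ≤ ∫ u, (C * (2 / 3) ^ k * t ^ 2) * ∑ r : Fin m, spacing u r ^ 2 ∂uniformSample m := by
        -- No measurability of `L` is required here, since only the upper bound has to be
        -- integrable.
        refine integral_mono_of_nonneg (Eventually.of_forall fun u =>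
          Finset.sum_nonneg fun r _ => h0 _) (hint.const_mul _) (Eventually.of_forall fun u => ?_)
        simp only
        rw [Finset.mul_sum]
        refine Finset.sum_le_sum fun r _ => (ih _).trans (le_of_eq ?_)
        ring
      refine h1.trans ?_
      rw [integral_const_mul]
      refine (mul_le_mul_of_nonneg_left (integral_sum_spacing_sq_le hm) (by positivity)).trans
        (le_of_eq ?_)
      ring
  refine le_antisymm ?_ (h0 t)
  have hlim : Tendsto (fun k : ℕ => C * (2 / 3 : ℝ) ^ k * t ^ 2) atTop (𝓝 (C * 0 * t ^ 2)) :=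
    ((tendsto_pow_atTop_nhds_zero_of_lt_one (by norm_num) (by norm_num)).const_mul C).mul_const _
  have := ge_of_tendsto' hlim fun k => key k t
  simpa using this

/-- The expectation of a bounded function of the root keys is asymptotically an integral over a
uniform sample. -/
lemma tendsto_expect_sub_integral (hm : 2 ≤ m) {G : ∀ n, Finset (Fin n) → ℂ}
    (hG : ∀ n R, ‖G n R‖ ≤ 1) :
    Tendsto (fun n => 𝔼 σ : Equiv.Perm (Fin (n + 1)), G (n + 1) (permRoots m σ)
      - ∫ u, G (n + 1) (cellRoots n u) ∂uniformSample m) atTop (𝓝 0) := by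
  classical
  set I : ℕ → ℂ := fun n => ∫ u, (if (cellRoots n u).card = m - 1 then G (n + 1) (cellRoots n u)
    else 0) ∂uniformSample m with hI
  have hI1 : ∀ n, ‖I n‖ ≤ 1 := by
    intro n
    have h := norm_integral_le_of_norm_le_const (μ := uniformSample m) (C := 1)
      (f := fun u => if (cellRoots n u).card = m - 1 then G (n + 1) (cellRoots n u) else 0)
      (Eventually.of_forall fun u => by split_ifs <;> simp [hG])
    simpa using h
  have h1 : Tendsto (fun n : ℕ => ((((n + 1 : ℕ) : ℝ) ^ (m - 1)
      / ((n + 1).descFactorial (m - 1) : ℕ) : ℝ) : ℂ) - 1) atTop (𝓝 0) := by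
    have h := (Complex.continuous_ofReal.tendsto _).comp
      ((tendsto_pow_div_descFactorial (m - 1)).comp (tendsto_add_atTop_nat 1))
    simpa using h.sub_const 1
  have h2 : Tendsto (fun n : ℕ => (((((n + 1 : ℕ) : ℝ) ^ (m - 1)
      / ((n + 1).descFactorial (m - 1) : ℕ) : ℝ) : ℂ) - 1) * I n) atTop (𝓝 0) := by
    refine h1.zero_mul_isBoundedUnder_le ?_
    exact isBoundedUnder_of ⟨1, fun n => hI1 n⟩
  have hmeas : ∀ n, AEStronglyMeasurable (fun u : Fin (m - 1) → ℝ => G (n + 1) (cellRoots n u))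
      (uniformSample m) := fun n =>
    (measurable_comp_cellRoots n (m - 1) (G (n + 1))).aestronglyMeasurable
  have hmeas' : ∀ n, AEStronglyMeasurable (fun u : Fin (m - 1) → ℝ =>
      if (cellRoots n u).card = m - 1 then G (n + 1) (cellRoots n u) else 0)
      (uniformSample m) := fun n =>
    (measurable_comp_cellRoots n (m - 1)
      fun R => if R.card = m - 1 then G (n + 1) R else 0).aestronglyMeasurable
  have h3 : Tendsto (fun n => I n - ∫ u, G (n + 1) (cellRoots n u) ∂uniformSample m) atTop
      (𝓝 0) := by
    have h4 : Tendsto (fun n => ∫ u, ((if (cellRoots n u).card = m - 1 then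
        G (n + 1) (cellRoots n u) else 0) - G (n + 1) (cellRoots n u)) ∂uniformSample m) atTop
        (𝓝 (∫ _, 0 ∂uniformSample m)) := by
      refine tendsto_integral_of_dominated_convergence (fun _ => 1)
        (fun n => (hmeas' n).sub (hmeas n)) (integrable_const _)
        (fun n => Eventually.of_forall fun u => ?_) ?_
      · split_ifs <;> simp [hG]
      · filter_upwards [ae_tendsto_proportion hm] with u hu
        refine tendsto_const_nhds.congr' ?_
        filter_upwards [hu.1] with n hn
        rw [if_pos hn, sub_self]
    rw [integral_zero] at h4
    refine h4.congr fun n => ?_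
    rw [integral_sub]
    · exact Integrable.of_bound (hmeas' n) 1
        (Eventually.of_forall fun u => by split_ifs <;> simp [hG])
    · exact Integrable.of_bound (hmeas n) 1 (Eventually.of_forall fun u => hG _ _)
  have h5 := h2.add h3
  rw [add_zero] at h5
  refine h5.congr' ?_
  filter_upwards [eventually_ge_atTop m] with n hn
  rw [expect_permRoots_eq (by omega)]
  push_cast
  rw [hI]
  ring

end MaryTree
-- Convergence of the characteristic functions
namespace MaryTree

open EulerOperator

variable {m : ℕ}

lemma continuous_limitToll : Continuous (limitToll (m := m)) := by
  unfold limitToll entropySum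
  have := Real.continuous_mul_log
  exact continuous_const.add (continuous_const.mul (continuous_finsetSum _ fun r _ =>
    this.comp (continuous_apply r)))

lemma ae_tendsto_keyToll (hm : 2 ≤ m) : ∀ᵐ u ∂uniformSample m,
    Tendsto (fun n : ℕ => keyToll hm (cellRoots n u) / ((n + 1 : ℕ) + 1 : ℝ)) atTop
      (𝓝 (limitToll fun r : Fin m => spacing u r)) := by
  obtain ⟨C, hC⟩ := exists_keyToll hm
  filter_upwards [ae_tendsto_proportion hm] with u hu
  have h1 : Tendsto (fun n => limitToll fun r : Fin m => proportion (cellRoots n u) r) atTop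
      (𝓝 (limitToll fun r : Fin m => spacing u r)) :=
    (continuous_limitToll.tendsto _).comp (tendsto_pi_nhds.2 hu.2)
  have h2 : Tendsto (fun n : ℕ => C * (slow hm (n + 1) / ((n + 1 : ℕ) + 1))) atTop (𝓝 0) := by
    simpa using ((tendsto_slow_div hm).comp (tendsto_add_atTop_nat 1)).const_mul C
  have h3 : Tendsto (fun n : ℕ => keyToll hm (cellRoots n u) / ((n + 1 : ℕ) + 1 : ℝ)
      - limitToll fun r : Fin m => proportion (cellRoots n u) r) atTop (𝓝 0) := by
    refine squeeze_zero_norm' ?_ h2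
    filter_upwards [hu.1, eventually_ge_atTop m] with n hn hnm
    obtain ⟨σ, hσ⟩ := exists_permRoots_eq (by omega) hn
    have h4 := hC (n + 1) (by omega) σ
    rw [hσ] at h4
    have h5 : (0 : ℝ) < (n + 1 : ℕ) + 1 := by positivity
    have h6 : keyToll hm (cellRoots n u) / ((n + 1 : ℕ) + 1 : ℝ)
        - limitToll (fun r : Fin m => proportion (cellRoots n u) r)
        = (keyToll hm (cellRoots n u) - ((n + 1 : ℕ) + 1)
          * limitToll (fun r : Fin m => proportion (cellRoots n u) r)) / ((n + 1 : ℕ) + 1) := by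
      field_simp
    rw [h6, Real.norm_eq_abs, abs_div, abs_of_pos h5, ← mul_div_assoc]
    exact div_le_div_of_nonneg_right h4 h5.le
  simpa using h3.add h1

lemma ae_tendsto_gap (hm : 2 ≤ m) : ∀ᵐ u ∂uniformSample m,
    ∀ r : Fin m, Tendsto (fun n => gap (cellRoots n u) r) atTop atTop := by
  filter_upwards [ae_tendsto_proportion hm, ae_spacing_pos hm] with u hu hpos r
  have h1 : Tendsto (fun n : ℕ => ((n + 1 : ℕ) + 1 : ℝ)) atTop atTop :=
    tendsto_atTop_add_const_right _ _
      (tendsto_natCast_atTop_atTop.comp (tendsto_add_atTop_nat 1))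
  have h2 := (hu.2 r).pos_mul_atTop (hpos r) h1
  have h3 : Tendsto (fun n => (gap (cellRoots n u) r : ℝ)) atTop atTop := by
    refine (tendsto_atTop_add_const_right _ (-1) h2).congr fun n => ?_
    rw [proportion, div_mul_cancel₀ _ (by positivity)]
    ring
  exact tendsto_natCast_atTop_iff.1 h3

/-- The contribution of the root, with the limits of the toll and of the sizes inserted. -/
noncomputable def limitRootChar (hm : 2 ≤ m) (t : ℝ) (n : ℕ) (u : Fin (m - 1) → ℝ) : ℂ :=
  unitExp (t * limitToll fun r : Fin m => spacing u r)
    * ∏ r : Fin m, keyChar hm (gap (cellRoots n u) r) (t * spacing u r)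

/-- The uniform Lipschitz bound allows the proportions to be replaced by their limits while the
indices of the characteristic functions still vary. Convergence of the latter is not presupposed. -/
lemma ae_tendsto_rootChar_sub (hm : 2 ≤ m) (t : ℝ) : ∀ᵐ u ∂uniformSample m,
    Tendsto (fun n => ‖rootChar hm t (cellRoots n u) - limitRootChar hm t n u‖) atTop (𝓝 0) := by
  obtain ⟨B, hB0, hB, -⟩ := exists_norm_keyChar_sub_le hm
  filter_upwards [ae_tendsto_keyToll hm, ae_tendsto_proportion hm] with u h1 h2
  have h3 : Tendsto (fun n : ℕ => ‖unitExp (t * (keyToll hm (cellRoots n u)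
      / ((n + 1 : ℕ) + 1 : ℝ))) - unitExp (t * limitToll fun r : Fin m => spacing u r)‖
      + ∑ r : Fin m, B * |t * proportion (cellRoots n u) r - t * spacing u r|) atTop
      (𝓝 (‖unitExp (t * limitToll fun r : Fin m => spacing u r)
        - unitExp (t * limitToll fun r : Fin m => spacing u r)‖
        + ∑ r : Fin m, B * |t * spacing u r - t * spacing u r|)) := by
    refine Tendsto.add ((((continuous_unitExp.tendsto _).comp (h1.const_mul t)).sub_const _).norm)
      (tendsto_finsetSum _ fun r _ => ?_)
    exact ((((h2.2 r).const_mul t).sub_const _).abs).const_mul B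
  simp only [sub_self, norm_zero, abs_zero, mul_zero, Finset.sum_const_zero, add_zero] at h3
  refine squeeze_zero (fun _ => norm_nonneg _) (fun n => ?_) h3
  have hp := norm_prod_sub_prod_le_sum Finset.univ
    (a := fun r : Fin m => keyChar hm (gap (cellRoots n u) r) (t * proportion (cellRoots n u) r))
    (b := fun r : Fin m => keyChar hm (gap (cellRoots n u) r) (t * spacing u r))
    (fun r => norm_keyChar_le_one _ _ _) (fun r => norm_keyChar_le_one _ _ _)
  have hs : ∑ r : Fin m, ‖keyChar hm (gap (cellRoots n u) r) (t * proportion (cellRoots n u) r)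
      - keyChar hm (gap (cellRoots n u) r) (t * spacing u r)‖
      ≤ ∑ r : Fin m, B * |t * proportion (cellRoots n u) r - t * spacing u r| :=
    Finset.sum_le_sum fun r _ => hB _ _ _
  have hq : ‖∏ r : Fin m, keyChar hm (gap (cellRoots n u) r)
      (t * proportion (cellRoots n u) r)‖ ≤ 1 := by
    rw [norm_prod]
    exact Finset.prod_le_one (fun _ _ => norm_nonneg _) fun r _ => norm_keyChar_le_one hm _ _
  rw [rootChar, limitRootChar]
  set a := unitExp (t * (keyToll hm (cellRoots n u) / ((n + 1 : ℕ) + 1 : ℝ)))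
  set b := unitExp (t * limitToll fun r : Fin m => spacing u r) with hb
  set P := ∏ r : Fin m, keyChar hm (gap (cellRoots n u) r) (t * proportion (cellRoots n u) r)
  set Q := ∏ r : Fin m, keyChar hm (gap (cellRoots n u) r) (t * spacing u r)
  have he : a * P - b * Q = (a - b) * P + b * (P - Q) := by ring
  rw [he]
  refine (norm_add_le _ _).trans ?_
  rw [norm_mul, norm_mul, hb, norm_unitExp, one_mul, ← hb]
  exact add_le_add (mul_le_of_le_one_right (norm_nonneg _) hq) (hp.trans hs)

/-- The asymptotic oscillation of the characteristic functions of the key path lengths. -/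
noncomputable def charOsc (hm : 2 ≤ m) (t : ℝ) : ℝ :=
  limsup (fun p : ℕ × ℕ => ‖keyChar hm p.1 t - keyChar hm p.2 t‖) (atTop ×ˢ atTop)

section CharOsc

variable (hm : 2 ≤ m)

lemma isBoundedUnder_charOsc (t : ℝ) : IsBoundedUnder (· ≤ ·) (atTop ×ˢ atTop)
    fun p : ℕ × ℕ => ‖keyChar hm p.1 t - keyChar hm p.2 t‖ :=
  isBoundedUnder_of ⟨1 + 1, fun _ => (norm_sub_le _ _).trans
    (add_le_add (norm_keyChar_le_one _ _ _) (norm_keyChar_le_one _ _ _))⟩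

lemma charOsc_le_of_eventually {t a : ℝ}
    (h : ∀ᶠ p : ℕ × ℕ in atTop ×ˢ atTop, ‖keyChar hm p.1 t - keyChar hm p.2 t‖ ≤ a) :
    charOsc hm t ≤ a :=
  limsup_le_of_le (isBoundedUnder_of (r := (· ≥ ·))
    ⟨0, fun _ => norm_nonneg _⟩).isCoboundedUnder_le h

lemma eventually_lt_of_charOsc_lt {t a : ℝ} (h : charOsc hm t < a) :
    ∀ᶠ p : ℕ × ℕ in atTop ×ˢ atTop, ‖keyChar hm p.1 t - keyChar hm p.2 t‖ < a :=
  eventually_lt_of_limsup_lt h (isBoundedUnder_charOsc hm t)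

lemma charOsc_nonneg (t : ℝ) : 0 ≤ charOsc hm t := by
  by_contra! h
  obtain ⟨p, hp⟩ := (eventually_lt_of_charOsc_lt hm h).exists
  exact absurd hp (not_lt.2 (norm_nonneg _))

lemma charOsc_le_two (t : ℝ) : charOsc hm t ≤ 2 := by
  refine charOsc_le_of_eventually hm (Eventually.of_forall fun p => (norm_sub_le _ _).trans ?_)
  linarith [norm_keyChar_le_one hm p.1 t, norm_keyChar_le_one hm p.2 t]

lemma exists_charOsc_le_sq : ∃ C : ℝ, ∀ t, charOsc hm t ≤ C * t ^ 2 := by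
  obtain ⟨B, -, -, hB⟩ := exists_norm_keyChar_sub_le hm
  refine ⟨2 * B, fun t => charOsc_le_of_eventually hm (Eventually.of_forall fun p => ?_)⟩
  have h : keyChar hm p.1 t - keyChar hm p.2 t
      = (keyChar hm p.1 t - 1) - (keyChar hm p.2 t - 1) := by ring
  rw [h]
  refine (norm_sub_le _ _).trans ?_
  linarith [hB p.1 t, hB p.2 t]

/-- The common Lipschitz bound survives the upper limit. Continuity is what makes the oscillation at
`t * spacing u r` measurable in `u`. -/
lemma continuous_charOsc : Continuous (charOsc hm) := by
  obtain ⟨B, hB0, hB, -⟩ := exists_norm_keyChar_sub_le hm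
  refine (LipschitzWith.of_le_add_mul (Real.toNNReal (2 * B)) fun t s => ?_).continuous
  rw [Real.coe_toNNReal _ (by positivity), Real.dist_eq]
  refine le_of_forall_pos_le_add fun ε hε => charOsc_le_of_eventually hm ?_
  filter_upwards [eventually_lt_of_charOsc_lt hm (lt_add_of_pos_right (charOsc hm s) hε)] with p hp
  have h : keyChar hm p.1 t - keyChar hm p.2 t = (keyChar hm p.1 t - keyChar hm p.1 s)
      + (keyChar hm p.1 s - keyChar hm p.2 s) - (keyChar hm p.2 t - keyChar hm p.2 s) := by ring
  rw [h]
  refine (norm_sub_le _ _).trans ((add_le_add_left (norm_add_le _ _) _).trans ?_)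
  linarith [hB p.1 t s, hB p.2 t s]

lemma aemeasurable_sum_charOsc (t : ℝ) : AEMeasurable
    (fun u : Fin (m - 1) → ℝ => ∑ r : Fin m, charOsc hm (t * spacing u r)) (uniformSample m) :=
  Finset.aemeasurable_fun_sum _ fun r _ => (continuous_charOsc hm).measurable.comp_aemeasurable
    ((aemeasurable_spacing hm r).const_mul t)

lemma integrable_sum_charOsc (t : ℝ) : Integrable
    (fun u : Fin (m - 1) → ℝ => ∑ r : Fin m, charOsc hm (t * spacing u r)) (uniformSample m) := by
  refine Integrable.of_bound (aemeasurable_sum_charOsc hm t).aestronglyMeasurable (∑ _ : Fin m, 2)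
    (Eventually.of_forall fun u => ?_)
  rw [Real.norm_of_nonneg (Finset.sum_nonneg fun _ _ => charOsc_nonneg hm _)]
  exact Finset.sum_le_sum fun _ _ => charOsc_le_two hm _

/-- The oscillation of the contributions of the root is controlled by that of the subtrees. -/
lemma ae_eventually_norm_rootChar_sub_le (t : ℝ) : ∀ᵐ u ∂uniformSample m, ∀ ε > 0,
    ∀ᶠ p : ℕ × ℕ in atTop ×ˢ atTop,
      ‖rootChar hm t (cellRoots p.1 u) - rootChar hm t (cellRoots p.2 u)‖
        ≤ ∑ r : Fin m, charOsc hm (t * spacing u r) + ε := by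
  filter_upwards [ae_tendsto_rootChar_sub hm t, ae_tendsto_gap hm] with u h1 h2 ε hε
  -- One share for each of the `m` subtrees, and two for the passage to `limitRootChar` at both
  -- indices.
  set δ : ℝ := ε / (m + 2) with hδ
  have hδ0 : 0 < δ := by positivity
  have h3 : ∀ r : Fin m, ∀ᶠ p : ℕ × ℕ in atTop ×ˢ atTop,
      ‖keyChar hm (gap (cellRoots p.1 u) r) (t * spacing u r)
        - keyChar hm (gap (cellRoots p.2 u) r) (t * spacing u r)‖
          < charOsc hm (t * spacing u r) + δ := fun r =>
    ((h2 r).prodMap (h2 r)).eventually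
      (eventually_lt_of_charOsc_lt hm (lt_add_of_pos_right _ hδ0))
  have h4 := h1.eventually (gt_mem_nhds hδ0)
  filter_upwards [eventually_all.2 h3, tendsto_fst.eventually h4, tendsto_snd.eventually h4]
    with p h5 h6 h7
  have h8 : ‖limitRootChar hm t p.1 u - limitRootChar hm t p.2 u‖
      ≤ ∑ r : Fin m, (charOsc hm (t * spacing u r) + δ) := by
    rw [limitRootChar, limitRootChar, ← mul_sub, norm_mul, norm_unitExp, one_mul]
    refine (norm_prod_sub_prod_le_sum Finset.univ (fun r => norm_keyChar_le_one _ _ _)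
      (fun r => norm_keyChar_le_one _ _ _)).trans (Finset.sum_le_sum fun r _ => (h5 r).le)
  rw [Finset.sum_add_distrib] at h8
  simp only [Finset.sum_const, Finset.card_univ, Fintype.card_fin, nsmul_eq_mul] at h8
  have h9 : rootChar hm t (cellRoots p.1 u) - rootChar hm t (cellRoots p.2 u)
      = (rootChar hm t (cellRoots p.1 u) - limitRootChar hm t p.1 u)
        + (limitRootChar hm t p.1 u - limitRootChar hm t p.2 u)
        - (rootChar hm t (cellRoots p.2 u) - limitRootChar hm t p.2 u) := by ring
  rw [h9]
  refine (norm_sub_le _ _).trans ((add_le_add_left (norm_add_le _ _) _).trans ?_)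
  have h10 : ε = (m + 2) * δ := by rw [hδ]; field_simp
  rw [h10]
  linarith

lemma measurable_rootChar_cellRoots (t : ℝ) (n : ℕ) :
    Measurable fun u : Fin (m - 1) → ℝ => rootChar hm t (cellRoots n u) :=
  measurable_comp_cellRoots n (m - 1) (rootChar hm t)

/-- A reverse Fatou argument along pairs of indices: the upper limit of the expected differences is
at most the expectation of the pointwise bound on their upper limit. -/
lemma charOsc_le_integral (t : ℝ) : charOsc hm t
    ≤ ∫ u, ∑ r : Fin m, charOsc hm (t * spacing u r) ∂uniformSample m := by
  set S : (Fin (m - 1) → ℝ) → ℝ := fun u => ∑ r : Fin m, charOsc hm (t * spacing u r) with hS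
  set D : ℕ × ℕ → (Fin (m - 1) → ℝ) → ℝ := fun p u =>
    ‖rootChar hm t (cellRoots p.1 u) - rootChar hm t (cellRoots p.2 u)‖ with hD
  have hD2 : ∀ p u, D p u ≤ 2 := fun p u => (norm_sub_le _ _).trans (by
    linarith [norm_rootChar_le_one hm t (cellRoots p.1 u),
      norm_rootChar_le_one hm t (cellRoots p.2 u)])
  have hS0 : ∀ u, 0 ≤ S u := fun u => Finset.sum_nonneg fun _ _ => charOsc_nonneg hm _
  have hDm : ∀ p, Measurable (D p) := fun p =>
    ((measurable_rootChar_cellRoots hm t p.1).sub (measurable_rootChar_cellRoots hm t p.2)).norm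
  have hWm : ∀ p, AEStronglyMeasurable (fun u => max (D p u - S u) 0) (uniformSample m) := fun p =>
    (((hDm p).aemeasurable.sub (aemeasurable_sum_charOsc hm t)).max
      aemeasurable_const).aestronglyMeasurable
  have hWb : ∀ p u, ‖max (D p u - S u) 0‖ ≤ 2 := by
    intro p u
    rw [Real.norm_of_nonneg (le_max_right _ _)]
    exact max_le (by linarith [hD2 p u, hS0 u]) (by norm_num)
  -- Only the excess of `D` over the bound `S` has to vanish, and it does so by dominated
  -- convergence.
  have hW : Tendsto (fun p => ∫ u, max (D p u - S u) 0 ∂uniformSample m) (atTop ×ˢ atTop)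
      (𝓝 (∫ _, 0 ∂uniformSample m)) := by
    refine tendsto_integral_filter_of_dominated_convergence (fun _ => 2)
      (Eventually.of_forall hWm) (Eventually.of_forall fun p => Eventually.of_forall (hWb p))
      (integrable_const _) ?_
    filter_upwards [ae_eventually_norm_rootChar_sub_le hm t] with u hu
    rw [Metric.tendsto_nhds]
    intro ε hε
    filter_upwards [hu (ε / 2) (by positivity)] with p hp
    rw [Real.dist_0_eq_abs, abs_of_nonneg (le_max_right _ _)]
    exact max_lt (by simp only [hD, hS]; linarith) hε
  rw [integral_zero] at hW
  have hDW : ∀ p, ∫ u, D p u ∂uniformSample m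
      ≤ ∫ u, max (D p u - S u) 0 ∂uniformSample m + ∫ u, S u ∂uniformSample m := by
    intro p
    have hi := Integrable.of_bound (hWm p) 2 (Eventually.of_forall (hWb p))
    rw [← integral_add hi (integrable_sum_charOsc hm t)]
    refine integral_mono_of_nonneg (Eventually.of_forall fun u => norm_nonneg _)
      (hi.add (integrable_sum_charOsc hm t)) (Eventually.of_forall fun u => ?_)
    change D p u ≤ max (D p u - S u) 0 + S u
    have := le_max_left (D p u - S u) 0
    linarith
  have hE := tendsto_expect_sub_integral hm (G := fun n => rootChar (n := n) hm t)
    fun n R => norm_rootChar_le_one hm t R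
  have hE2 : ∀ ε > 0, ∀ᶠ n : ℕ in atTop, ‖keyChar hm (n + 1) t
      - ∫ u, rootChar hm t (cellRoots n u) ∂uniformSample m‖ < ε := by
    intro ε hε
    have := hE.norm
    rw [norm_zero] at this
    filter_upwards [this.eventually (gt_mem_nhds hε), eventually_ge_atTop m] with n hn hnm
    rwa [keyChar_rec hm (by omega)]
  refine le_of_forall_pos_le_add fun ε hε => charOsc_le_of_eventually hm ?_
  have h1 : ∀ᶠ p : ℕ × ℕ in atTop ×ˢ atTop,
      ‖keyChar hm (p.1 + 1) t - keyChar hm (p.2 + 1) t‖ ≤ ∫ u, S u ∂uniformSample m + ε := by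
    filter_upwards [tendsto_fst.eventually (hE2 (ε / 3) (by positivity)),
      tendsto_snd.eventually (hE2 (ε / 3) (by positivity)),
      hW.eventually (gt_mem_nhds (show 0 < ε / 3 by positivity))] with p h2 h3 h4
    have hint : ∀ n, Integrable (fun u => rootChar hm t (cellRoots n u)) (uniformSample m) :=
      fun n => Integrable.of_bound (measurable_rootChar_cellRoots hm t n).aestronglyMeasurable 1
        (Eventually.of_forall fun u => norm_rootChar_le_one hm t _)
    have h5 : ‖∫ u, rootChar hm t (cellRoots p.1 u) ∂uniformSample m
        - ∫ u, rootChar hm t (cellRoots p.2 u) ∂uniformSample m‖ ≤ ∫ u, D p u ∂uniformSample m := by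
      rw [← integral_sub (hint _) (hint _)]
      exact norm_integral_le_integral_norm _
    have h6 := hDW p
    have h7 : keyChar hm (p.1 + 1) t - keyChar hm (p.2 + 1) t
        = (keyChar hm (p.1 + 1) t - ∫ u, rootChar hm t (cellRoots p.1 u) ∂uniformSample m)
        + (∫ u, rootChar hm t (cellRoots p.1 u) ∂uniformSample m
          - ∫ u, rootChar hm t (cellRoots p.2 u) ∂uniformSample m)
        - (keyChar hm (p.2 + 1) t - ∫ u, rootChar hm t (cellRoots p.2 u) ∂uniformSample m) := by
      ring
    rw [h7]
    refine (norm_sub_le _ _).trans ((add_le_add_left (norm_add_le _ _) _).trans ?_)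
    linarith
  -- The cells of index `n` belong to trees with `n + 1` keys; this undoes the shift.
  have h8 := ((tendsto_sub_atTop_nat 1).prodMap (tendsto_sub_atTop_nat 1)).eventually h1
  filter_upwards [h8, tendsto_fst.eventually (eventually_ge_atTop 1),
    tendsto_snd.eventually (eventually_ge_atTop 1)] with p hp hp1 hp2
  simp only [Prod.map_fst, Prod.map_snd, Nat.sub_add_cancel hp1, Nat.sub_add_cancel hp2] at hp
  exact hp

/-- The characteristic functions of the key path lengths converge. -/
theorem exists_tendsto_keyChar : ∃ ψ : ℝ → ℂ, ∀ t, Tendsto (fun n => keyChar hm n t) atTop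
    (𝓝 (ψ t)) := by
  obtain ⟨C, hC⟩ := exists_charOsc_le_sq hm
  have h : ∀ t, ∃ z, Tendsto (fun n => keyChar hm n t) atTop (𝓝 z) := by
    intro t
    have h0 := eq_zero_of_le_integral_spacing hm (charOsc_nonneg hm) hC (charOsc_le_integral hm) t
    refine cauchySeq_tendsto_of_complete (Metric.cauchySeq_iff.2 fun ε hε => ?_)
    have h1 := eventually_lt_of_charOsc_lt hm (h0.trans_lt hε)
    rw [prod_atTop_atTop_eq] at h1
    obtain ⟨⟨N, N'⟩, hN⟩ := eventually_atTop.1 h1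
    refine ⟨max N N', fun k hk l hl => ?_⟩
    rw [dist_eq_norm]
    exact hN (k, l) ⟨(le_max_left _ _).trans hk, (le_max_right _ _).trans hl⟩
  choose ψ hψ using h
  exact ⟨ψ, hψ⟩

/-- The limit of the characteristic functions solves the limit equation. -/
lemma eq_integral_of_tendsto_keyChar {ψ : ℝ → ℂ}
    (hψ : ∀ t, Tendsto (fun n => keyChar hm n t) atTop (𝓝 (ψ t))) (t : ℝ) :
    ψ t = ∫ u, unitExp (t * limitToll fun r : Fin m => spacing u r)
      * ∏ r : Fin m, ψ (t * spacing u r) ∂uniformSample m := by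
  have h1 := tendsto_expect_permRoots hm (G := fun n => rootChar (n := n) hm t) (M := 1)
    (fun n _ σ => norm_rootChar_le_one hm t _)
    (H := fun u => unitExp (t * limitToll fun r : Fin m => spacing u r)
      * ∏ r : Fin m, ψ (t * spacing u r)) ?_
  · refine tendsto_nhds_unique (hψ t) (h1.congr' ?_)
    filter_upwards [eventually_ge_atTop m] with n hn
    rw [keyChar_rec hm hn]
  · filter_upwards [ae_tendsto_rootChar_sub hm t, ae_tendsto_gap hm] with u h2 h3
    have h4 : Tendsto (fun n => limitRootChar hm t n u) atTop
        (𝓝 (unitExp (t * limitToll fun r : Fin m => spacing u r)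
          * ∏ r : Fin m, ψ (t * spacing u r))) :=
      (tendsto_finsetProd _ fun r _ => (hψ _).comp (h3 r)).const_mul _
    have h5 := (tendsto_zero_iff_norm_tendsto_zero.2 h2).add h4
    simpa using h5

end CharOsc

end MaryTree
-- The fixed point equation: uniqueness and existence
section LimitLaw

variable {m : ℕ}

lemma integral_uniformPerm {𝕜 : Type*} [RCLike 𝕜] (n : ℕ) (f : Equiv.Perm (Fin n) → 𝕜) :
    ∫ σ, f σ ∂uniformPerm n = 𝔼 σ, f σ := by
  have h : ∀ σ, (uniformPerm n).real {σ} = (Fintype.card (Equiv.Perm (Fin n)) : ℝ)⁻¹ := by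
    intro σ
    rw [measureReal_def, uniformPerm, uniformOn_univ, Measure.count_singleton]
    simp
  rw [integral_fintype .of_finite, Fintype.expect_eq_sum_div_card, div_eq_inv_mul, Finset.mul_sum]
  refine Finset.sum_congr rfl fun σ _ => ?_
  rw [h, RCLike.real_smul_eq_coe_mul]
  simp

/-- The limit toll is a measurable function of the sample. -/
lemma aemeasurable_limitToll_spacing (hm : 2 ≤ m) :
    AEMeasurable (fun u : Fin (m - 1) → ℝ => limitToll fun r : Fin m => spacing u r)
      (uniformSample m) :=
  MaryTree.continuous_limitToll.measurable.comp_aemeasurable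
    (aemeasurable_pi_lambda _ fun r => MaryTree.aemeasurable_spacing hm r)

/-- The characteristic function of the image of a law under the recursion. -/
lemma charFun_keyLawMap (hm : 2 ≤ m) (ν : Measure ℝ) [IsProbabilityMeasure ν] (t : ℝ) :
    charFun (keyLawMap m ν) t = ∫ u, unitExp (t * limitToll fun r : Fin m => spacing u r)
      * ∏ r : Fin m, charFun ν (t * spacing u r) ∂uniformSample m := by
  set μ := (uniformSample m).prod (Measure.pi fun _ : Fin m => ν) with hμ
  have hV : ∀ r : Fin m, AEMeasurable
      (fun p : (Fin (m - 1) → ℝ) × (Fin m → ℝ) => spacing p.1 r) μ := fun r =>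
    (MaryTree.aemeasurable_spacing hm r).comp_quasiMeasurePreserving
      Measure.quasiMeasurePreserving_fst
  have hx : ∀ r : Fin m, Measurable fun p : (Fin (m - 1) → ℝ) × (Fin m → ℝ) => p.2 r := fun r =>
    (measurable_pi_apply r).comp measurable_snd
  have hT : AEMeasurable (fun p : (Fin (m - 1) → ℝ) × (Fin m → ℝ) =>
      limitToll fun r : Fin m => spacing p.1 r) μ :=
    (aemeasurable_limitToll_spacing hm).comp_quasiMeasurePreserving
      Measure.quasiMeasurePreserving_fst
  have hX : AEMeasurable (fun p : (Fin (m - 1) → ℝ) × (Fin m → ℝ) =>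
      (∑ r, spacing p.1 r * p.2 r) + limitToll fun r : Fin m => spacing p.1 r) μ :=
    (Finset.aemeasurable_fun_sum _ fun r _ => (hV r).mul (hx r).aemeasurable).add hT
  have he : keyLawMap m ν = μ.map fun p =>
      (∑ r, spacing p.1 r * p.2 r) + limitToll fun r : Fin m => spacing p.1 r := by
    rw [keyLawMap]
    congr 1
    ext p
    rw [limitToll, entropySum, add_assoc]
  rw [he, charFun_apply_real, integral_map hX (by fun_prop)]
  have h1 : ∀ p : (Fin (m - 1) → ℝ) × (Fin m → ℝ),
      Complex.exp (t * ((∑ r, spacing p.1 r * p.2 r)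
        + limitToll fun r : Fin m => spacing p.1 r : ℝ) * Complex.I)
      = unitExp (t * limitToll fun r : Fin m => spacing p.1 r)
        * ∏ r : Fin m, unitExp (t * spacing p.1 r * p.2 r) := by
    intro p
    rw [← unitExp_sum, ← unitExp_add, unitExp]
    simp only [mul_assoc, ← Finset.mul_sum]
    push_cast
    ring_nf
  simp only [h1]
  rw [integral_prod]
  · refine integral_congr_ae (Eventually.of_forall fun u => ?_)
    simp only
    rw [integral_const_mul, integral_fintype_prod_eq_prod
      (fun r : Fin m => fun x : ℝ => unitExp (t * spacing u r * x))]
    simp only [charFun_apply_real, unitExp]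
    push_cast
    rfl
  · refine Integrable.of_bound (AEMeasurable.aestronglyMeasurable ?_) 1
      (Eventually.of_forall fun p => by simp [norm_prod])
    refine (continuous_unitExp.measurable.comp_aemeasurable (hT.const_mul t)).mul
      (Finset.aemeasurable_fun_prod _ fun r _ => ?_)
    exact continuous_unitExp.measurable.comp_aemeasurable
      (((hV r).const_mul t).mul (hx r).aemeasurable)

lemma exists_norm_charFun_sub_one_le {ν : Measure ℝ} [IsProbabilityMeasure ν]
    (h2 : MemLp (fun x : ℝ => x) 2 ν) (h0 : ∫ x, x ∂ν = 0) :
    ∃ C, ∀ t, ‖charFun ν t - 1‖ ≤ C * t ^ 2 := by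
  have hi1 : Integrable (fun x : ℝ => x) ν := h2.integrable (by norm_num)
  have hi2 : Integrable (fun x : ℝ => x ^ 2) ν := h2.integrable_sq
  refine ⟨2 * ∫ x, x ^ 2 ∂ν, fun t => ?_⟩
  have hmeas : AEStronglyMeasurable (fun x : ℝ => unitExp (t * x)) ν :=
    (continuous_unitExp.comp (continuous_const.mul continuous_id)).aestronglyMeasurable
  have he : Integrable (fun x : ℝ => unitExp (t * x)) ν :=
    Integrable.of_bound hmeas 1 (Eventually.of_forall fun x => by simp)
  have h3 : charFun ν t - 1 = ∫ x, (unitExp (t * x) - 1 - (t * x : ℝ) * Complex.I) ∂ν := by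
    have h4 : ∫ x, ((t * x : ℝ) : ℂ) * Complex.I ∂ν = 0 := by
      rw [integral_mul_const, integral_complex_ofReal, integral_const_mul, h0]
      simp
    have h5 : Integrable (fun x : ℝ => ((t * x : ℝ) : ℂ) * Complex.I) ν :=
      ((hi1.const_mul t).ofReal).mul_const _
    have h6 : Integrable (fun x : ℝ => unitExp (t * x) - 1) ν := he.sub (integrable_const _)
    rw [integral_sub h6 h5, h4, sub_zero,
      integral_sub he (integrable_const _), charFun_apply_real]
    simp [unitExp]
  rw [h3]
  refine (norm_integral_le_of_norm_le (hi2.const_mul (2 * t ^ 2))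
    (Eventually.of_forall fun x => ?_)).trans (le_of_eq ?_)
  · refine (norm_unitExp_sub_one_sub_le _).trans (le_of_eq ?_)
    ring
  · rw [integral_const_mul]
    ring

/-- The recursive distributional equation has at most one centered square integrable solution. -/
theorem IsKeyLimitLaw.unique (hm : 2 ≤ m) {ν ν' : ProbabilityMeasure ℝ} (h : IsKeyLimitLaw m ν)
    (h' : IsKeyLimitLaw m ν') : ν' = ν := by
  obtain ⟨C, hC⟩ := exists_norm_charFun_sub_one_le h.memLp h.mean_zero
  obtain ⟨C', hC'⟩ := exists_norm_charFun_sub_one_le h'.memLp h'.mean_zero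
  have hmeas : ∀ (ρ : ProbabilityMeasure ℝ) (t : ℝ), AEStronglyMeasurable (fun u =>
      unitExp (t * limitToll fun r : Fin m => spacing u r)
        * ∏ r : Fin m, charFun (ρ : Measure ℝ) (t * spacing u r)) (uniformSample m) := by
    intro ρ t
    refine AEMeasurable.aestronglyMeasurable
      ((continuous_unitExp.measurable.comp_aemeasurable
        ((aemeasurable_limitToll_spacing hm).const_mul t)).mul
        (Finset.aemeasurable_fun_prod _ fun r _ => ?_))
    exact continuous_charFun.measurable.comp_aemeasurable
      ((MaryTree.aemeasurable_spacing hm r).const_mul t)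
  have hint : ∀ (ρ : ProbabilityMeasure ℝ) (t : ℝ), Integrable (fun u =>
      unitExp (t * limitToll fun r : Fin m => spacing u r)
        * ∏ r : Fin m, charFun (ρ : Measure ℝ) (t * spacing u r)) (uniformSample m) := by
    intro ρ t
    refine Integrable.of_bound (hmeas ρ t) 1 (Eventually.of_forall fun u => ?_)
    rw [norm_mul, norm_unitExp, one_mul, norm_prod]
    exact Finset.prod_le_one (fun _ _ => norm_nonneg _) fun r _ => norm_charFun_le_one _
  -- The contraction is applied to the distance of the two characteristic functions: the quadratic
  -- bound uses equal means and finite variances, the integral inequality the fixed point equation.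
  have key := MaryTree.eq_zero_of_le_integral_spacing hm
    (L := fun t => ‖charFun (ν' : Measure ℝ) t - charFun (ν : Measure ℝ) t‖) (C := C' + C)
    (fun t => norm_nonneg _) (fun t => ?_) fun t => ?_
  · refine Subtype.ext (Measure.ext_of_charFun (μ := (ν' : Measure ℝ)) (ν := (ν : Measure ℝ))
      (funext fun t => ?_))
    exact sub_eq_zero.1 (norm_eq_zero.1 (key t))
  · have e : charFun (ν' : Measure ℝ) t - charFun (ν : Measure ℝ) t
        = (charFun (ν' : Measure ℝ) t - 1) - (charFun (ν : Measure ℝ) t - 1) := by ring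
    simp only [e]
    refine (norm_sub_le _ _).trans ?_
    linarith [hC t, hC' t]
  · have e1 := charFun_keyLawMap hm (ν : Measure ℝ) t
    have e2 := charFun_keyLawMap hm (ν' : Measure ℝ) t
    rw [h.fixed] at e1
    rw [h'.fixed] at e2
    rw [e1, e2, ← integral_sub (hint ν' t) (hint ν t)]
    refine (norm_integral_le_integral_norm _).trans ?_
    refine integral_mono_of_nonneg (Eventually.of_forall fun u => norm_nonneg _) ?_
      (Eventually.of_forall fun u => ?_)
    · refine integrable_finsetSum _ fun r _ => Integrable.of_bound
        (AEMeasurable.aestronglyMeasurable ?_) 2 (Eventually.of_forall fun u => ?_)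
      · exact ((continuous_charFun.sub continuous_charFun).norm).measurable.comp_aemeasurable
          ((MaryTree.aemeasurable_spacing hm r).const_mul t)
      · rw [norm_norm]
        refine (norm_sub_le _ _).trans ?_
        linarith [norm_charFun_le_one (μ := (ν' : Measure ℝ)) (t * spacing u r),
          norm_charFun_le_one (μ := (ν : Measure ℝ)) (t * spacing u r)]
    · simp only
      rw [← mul_sub, norm_mul, norm_unitExp, one_mul]
      exact norm_prod_sub_prod_le_sum Finset.univ (fun r => norm_charFun_le_one _)
        fun r => norm_charFun_le_one _

/-- The law of the centered and rescaled key path length. -/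
noncomputable def scaledKeyLaw (hm : 2 ≤ m) (n : ℕ) : ProbabilityMeasure ℝ :=
  ⟨(uniformPerm n).map (MaryTree.scaledKey hm n),
    Measure.isProbabilityMeasure_map Measurable.of_discrete.aemeasurable⟩

lemma charFun_scaledKeyLaw (hm : 2 ≤ m) (n : ℕ) (t : ℝ) :
    charFun (scaledKeyLaw hm n : Measure ℝ) t = MaryTree.keyChar hm n t := by
  rw [charFun_apply_real, scaledKeyLaw, ProbabilityMeasure.coe_mk,
    integral_map Measurable.of_discrete.aemeasurable (by fun_prop), integral_uniformPerm,
    MaryTree.keyChar]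
  simp [unitExp]

/-- Probability measures whose characteristic functions converge to a function that is continuous
at zero converge. -/
lemma exists_tendsto_of_tendsto_charFun {μ : ℕ → ProbabilityMeasure ℝ} {ψ : ℝ → ℂ}
    (hψ : ContinuousAt ψ 0)
    (h : ∀ t, Tendsto (fun n => charFun (μ n : Measure ℝ) t) atTop (𝓝 (ψ t))) :
    ∃ ν : ProbabilityMeasure ℝ, Tendsto μ atTop (𝓝 ν) ∧ ∀ t, charFun (ν : Measure ℝ) t = ψ t := by
  -- Continuity at 0 yields tightness, hence a cluster point. Its characteristic function is `ψ` by
  -- passing to the limit along an ultrafilter.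
  have ht := isTightMeasureSet_of_tendsto_charFun hψ h
  have hc : IsCompact (closure (Set.range μ)) := by
    refine isCompact_closure_of_isTightMeasureSet (ht.subset ?_)
    rintro _ ⟨_, ⟨n, rfl⟩, rfl⟩
    exact ⟨n, rfl⟩
  obtain ⟨ν, -, hν⟩ := hc.exists_mapClusterPt (f := atTop) (u := μ)
    (le_principal_iff.2 (mem_map.2 (Eventually.of_forall fun n => subset_closure ⟨n, rfl⟩)))
  obtain ⟨U, hU, hUν⟩ := mapClusterPt_iff_ultrafilter.1 hν
  have hchar : ∀ t, charFun (ν : Measure ℝ) t = ψ t := by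
    intro t
    rw [ProbabilityMeasure.tendsto_iff_forall_integral_rclike_tendsto ℂ] at hUν
    have h1 := hUν (BoundedContinuousFunction.innerProbChar t)
    simp only [← charFun_eq_integral_innerProbChar] at h1
    exact tendsto_nhds_unique h1 ((h t).mono_left hU)
  refine ⟨ν, ProbabilityMeasure.tendsto_of_tendsto_charFun fun t => ?_, hchar⟩
  rw [hchar]
  exact h t

/-- The centered and rescaled key path lengths converge in law to a solution of the recursive
distributional equation. -/
theorem exists_tendsto_scaledKeyLaw (hm : 2 ≤ m) : ∃ ν : ProbabilityMeasure ℝ,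
    IsKeyLimitLaw m ν ∧ Tendsto (scaledKeyLaw hm) atTop (𝓝 ν) := by
  obtain ⟨ψ, hψ⟩ := MaryTree.exists_tendsto_keyChar hm
  obtain ⟨B, hB0, -, hB⟩ := MaryTree.exists_norm_keyChar_sub_le hm
  have hψB : ∀ t, ‖ψ t - 1‖ ≤ B * t ^ 2 := fun t =>
    le_of_tendsto' ((hψ t).sub_const 1).norm fun n => hB n t
  have hψ0 : ψ 0 = 1 := by
    have := hψB 0
    simpa [sub_eq_zero] using this
  have hO : (fun t => ψ t - 1) =O[𝓝 0] fun t : ℝ => ‖t - 0‖ ^ 2 :=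
    Asymptotics.IsBigO.of_bound B (Eventually.of_forall fun t => by simpa using hψB t)
  -- The quadratic bound at 0 provides both the continuity needed for tightness and the vanishing
  -- derivative, that is, the zero mean of the limit.
  have hderiv : HasDerivAt ψ 0 0 := by
    have h1 := (hO.hasFDerivAt (𝕜 := ℝ) (by norm_num)).add_const 1
    simp only [sub_add_cancel] at h1
    simpa using h1.hasDerivAt
  obtain ⟨ν, hν, hνψ⟩ := exists_tendsto_of_tendsto_charFun (μ := scaledKeyLaw hm)
    hderiv.continuousAt fun t => by simpa only [charFun_scaledKeyLaw] using hψ t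
  have hνψ' : charFun (ν : Measure ℝ) = ψ := funext hνψ
  -- The second moment of the limit is at most the lower limit of the uniformly bounded second
  -- moments, by weak convergence.
  have hL2 : MemLp (fun x : ℝ => x) 2 (ν : Measure ℝ) := by
    obtain ⟨A, hA0, hA⟩ := MaryTree.exists_expect_scaledKey_sq_le hm
    have h1 := lintegral_le_liminf_lintegral_of_forall_isOpen_measure_le_liminf_measure
      (μ := (ν : Measure ℝ)) (μs := fun n => (scaledKeyLaw hm n : Measure ℝ))
      (f := fun x : ℝ => x ^ 2) (continuous_pow 2) (fun x => sq_nonneg x)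
      fun G hG => ProbabilityMeasure.le_liminf_measure_open_of_tendsto hν hG
    have h2 : ∀ n, ∫⁻ x, ENNReal.ofReal (x ^ 2) ∂(scaledKeyLaw hm n : Measure ℝ)
        ≤ ENNReal.ofReal A := by
      intro n
      rw [scaledKeyLaw, ProbabilityMeasure.coe_mk, lintegral_map (by fun_prop)
        Measurable.of_discrete, ← ofReal_integral_eq_lintegral_ofReal .of_finite
        (Eventually.of_forall fun _ => sq_nonneg _), integral_uniformPerm]
      exact ENNReal.ofReal_le_ofReal (hA n)
    have h3 := h1.trans ((liminf_le_liminf (Eventually.of_forall h2)).trans (liminf_const _).le)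
    refine (memLp_two_iff_integrable_sq (by fun_prop)).2 ⟨by fun_prop, ?_⟩
    rw [hasFiniteIntegral_iff_ofReal (Eventually.of_forall fun _ => sq_nonneg _)]
    exact h3.trans_lt ENNReal.ofReal_lt_top
  refine ⟨ν, ⟨hL2, ?_, ?_⟩, hν⟩
  · have h1 := iteratedDeriv_charFun_zero (μ := (ν : Measure ℝ)) (n := 1)
      (hL2.mono_exponent (by norm_num))
    rw [iteratedDeriv_one, hνψ', hderiv.deriv] at h1
    simpa using h1.symm
  · have hf : IsFiniteMeasure (keyLawMap m (ν : Measure ℝ)) := by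
      unfold keyLawMap
      infer_instance
    refine Measure.ext_of_charFun (funext fun t => ?_)
    rw [charFun_keyLawMap hm, hνψ', MaryTree.eq_integral_of_tendsto_keyChar hm hψ t]

end LimitLaw
-- Quadratic lower bound for the variance of the key path length
section Moments

variable {m : ℕ}

open MaryTree

/-- If all sample points are close to zero, the limit toll is positive. -/
lemma exists_limitToll_spacing_pos (hm : 2 ≤ m) : ∃ δ : ℝ, 0 < δ ∧
    ∀ u : Fin (m - 1) → ℝ, (∀ i, u i ∈ Set.Ioo (0 : ℝ) δ) →
      0 < limitToll fun r : Fin m => spacing u r := by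
  have hφ := occupancy_pos hm
  -- With this value 2φ·mε = m/(m+1) < 1, so the entropy term cannot cancel the 1 in the toll.
  set ε : ℝ := 1 / (2 * occupancy m * (m + 1)) with hε
  have hε0 : 0 < ε := by positivity
  have hc := Real.continuous_mul_log
  obtain ⟨δ₀, hδ₀, h0⟩ := Metric.continuousAt_iff.1 (hc.continuousAt (x := 0)) ε hε0
  obtain ⟨δ₁, hδ₁, h1⟩ := Metric.continuousAt_iff.1 (hc.continuousAt (x := 1)) ε hε0
  simp only [Real.dist_eq, Real.log_zero, Real.log_one, mul_zero, sub_zero] at h0 h1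
  refine ⟨min δ₀ δ₁, lt_min hδ₀ hδ₁, fun u hu => ?_⟩
  set δ := min δ₀ δ₁ with hδ
  have hδ0 : 0 < δ := lt_min hδ₀ hδ₁
  have hlow : ∀ j ≤ m - 1, orderStat u j ∈ Set.Ico (0 : ℝ) δ := by
    intro j hj
    rw [orderStat]
    split_ifs with h2 h3
    · exact ⟨le_rfl, hδ0⟩
    · exact ⟨(hu _).1.le, (hu _).2⟩
    · omega
  -- All spacings but the last are close to 0 and the last is close to 1; the function x log x
  -- vanishes at both points.
  have hterm : ∀ r : Fin m, |spacing u r * Real.log (spacing u r)| < ε := by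
    intro r
    have ha := hlow r (by omega)
    by_cases hr : (r : ℕ) + 1 ≤ m - 1
    · have hb := hlow (r + 1) hr
      refine h0 ((abs_sub_lt_iff.2 ⟨?_, ?_⟩).trans_le (min_le_left _ δ₁))
      · linarith [ha.1, hb.2]
      · linarith [hb.1, ha.2]
    · have hb : orderStat u ((r : ℕ) + 1) = 1 := by
        rw [orderStat, if_neg (by omega), dif_neg (by omega)]
      refine h1 (lt_of_lt_of_le ?_ (min_le_right δ₀ δ₁))
      rw [spacing, hb, sub_sub_cancel_left, abs_neg, abs_of_nonneg ha.1]
      exact ha.2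
  have hsum : |entropySum fun r : Fin m => spacing u r| ≤ m * ε := by
    refine (Finset.abs_sum_le_sum_abs _ _).trans
      ((Finset.sum_le_sum fun r _ => (hterm r).le).trans ?_)
    simp
  have h2 := neg_le_of_abs_le hsum
  have h3 : 2 * occupancy m * (m * ε) < 1 := by
    rw [hε]
    have : 2 * occupancy m * (m * (1 / (2 * occupancy m * (m + 1)))) = m / (m + 1 : ℝ) := by
      field_simp
    rw [this, div_lt_one (by positivity)]
    linarith
  rw [limitToll]
  have := mul_le_mul_of_nonneg_left h2 (show 0 ≤ 2 * occupancy m by positivity)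
  linarith

lemma ae_abs_limitToll_le (hm : 2 ≤ m) : ∃ C : ℝ, 0 ≤ C ∧ ∀ᵐ u ∂uniformSample m,
    |limitToll fun r : Fin m => spacing u r| ≤ C := by
  refine ⟨1 + 2 * occupancy m * m, by have := occupancy_pos hm; positivity, ?_⟩
  filter_upwards [ae_spacing_mem hm] with u hu
  exact abs_limitToll_le hm (fun r => (hu r).1.le) fun r => (hu r).2

/-- The limit toll is not degenerate. -/
lemma integral_limitToll_sq_pos (hm : 2 ≤ m) :
    0 < ∫ u, (limitToll fun r : Fin m => spacing u r) ^ 2 ∂uniformSample m := by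
  obtain ⟨δ, hδ, hpos⟩ := exists_limitToll_spacing_pos hm
  obtain ⟨C, hC0, hC⟩ := ae_abs_limitToll_le hm
  have hint : Integrable (fun u : Fin (m - 1) → ℝ =>
      (limitToll fun r : Fin m => spacing u r) ^ 2) (uniformSample m) := by
    refine Integrable.of_bound
      ((aemeasurable_limitToll_spacing hm).pow_const 2).aestronglyMeasurable (C ^ 2) ?_
    filter_upwards [hC] with u hu
    rw [Real.norm_of_nonneg (sq_nonneg _)]
    exact sq_le_sq' (neg_le_of_abs_le hu) (le_of_abs_le hu)
  rw [integral_pos_iff_support_of_nonneg (fun _ => sq_nonneg _) hint]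
  have hsub : (Set.univ.pi fun _ : Fin (m - 1) => Set.Ioo (0 : ℝ) δ)
      ⊆ Function.support fun u : Fin (m - 1) → ℝ =>
        (limitToll fun r : Fin m => spacing u r) ^ 2 := by
    intro u hu
    exact pow_ne_zero 2 (hpos u fun i => hu i (Set.mem_univ i)).ne'
  refine lt_of_lt_of_le ?_ (measure_mono hsub)
  rw [uniformSample, Measure.pi_pi, Finset.prod_const]
  refine pos_iff_ne_zero.2 (pow_ne_zero _ (pos_iff_ne_zero.1 ?_))
  rw [Measure.restrict_apply measurableSet_Ioo]
  have h2 : Set.Ioo 0 (min δ 1) ⊆ Set.Ioo 0 δ ∩ Set.Icc (0 : ℝ) 1 := fun x hx =>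
    ⟨⟨hx.1, hx.2.trans_le (min_le_left _ _)⟩, hx.1.le, hx.2.le.trans (min_le_right _ _)⟩
  refine lt_of_lt_of_le ?_ (measure_mono h2)
  rw [Real.volume_Ioo, sub_zero]
  exact ENNReal.ofReal_pos.2 (lt_min hδ one_pos)

/-- The variance of the key path length grows quadratically. -/
lemma exists_le_varStat_keyStat (hm : 2 ≤ m) :
    ∃ c : ℝ, 0 < c ∧ ∀ᶠ n in atTop, c * quad n ≤ varStat hm keyStat n := by
  set I := ∫ u, (limitToll fun r : Fin m => spacing u r) ^ 2 ∂uniformSample m with hI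
  have hI0 : 0 < I := integral_limitToll_sq_pos hm
  obtain ⟨C, hC0, hC⟩ := exists_abs_keyToll_le hm
  have h1 := tendsto_expect_permRoots hm (𝕜 := ℝ) (M := C ^ 2)
    (G := fun n R => (keyToll hm R / (n + 1)) ^ 2)
    (H := fun u => (limitToll fun r : Fin m => spacing u r) ^ 2) (fun n hn σ => ?_) ?_
  -- By `le_varStat` the variance dominates the mean square of the toll, which is asymptotic to
  -- I(n+1)². One factor 2 is spent on the limit, the other on quad n ≤ 2(n+1)².
  · refine ⟨I / 4, by positivity, ?_⟩
    filter_upwards [h1.eventually (lt_mem_nhds (show I / 2 < I by linarith)),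
      eventually_ge_atTop m] with n h2 hn
    have h3 : 𝔼 σ : Equiv.Perm (Fin n), keyToll hm (permRoots m σ) ^ 2 ≤ varStat hm keyStat n :=
      le_varStat hm hn (keyStat_rec hm hn) (c := fun _ => (n - (m - 1) : ℝ)) fun _ => rfl
    simp only [div_pow] at h2
    rw [← Finset.expect_div, lt_div_iff₀ (by positivity)] at h2
    have h4 : quad n ≤ 2 * ((n : ℝ) + 1) ^ 2 := by
      unfold quad
      nlinarith [(Nat.cast_nonneg n : (0 : ℝ) ≤ n)]
    nlinarith
  · rw [Real.norm_of_nonneg (sq_nonneg _)]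
    have h2 : |keyToll hm (permRoots m σ) / ((n : ℝ) + 1)| ≤ C := by
      rw [abs_div, abs_of_pos (by positivity : (0 : ℝ) < n + 1), div_le_iff₀ (by positivity)]
      exact hC n hn σ
    exact sq_le_sq' (neg_le_of_abs_le h2) (le_of_abs_le h2)
  · filter_upwards [ae_tendsto_keyToll hm] with u hu
    exact hu.pow 2

end Moments

/-! ### Correlation, mean square distance and joint convergence -/

section PathLengths

variable {m : ℕ} (hm : 2 ≤ m) (n : ℕ)

open MaryTree

lemma integral_KPL : ∫ τ, KPL hm n τ ∂uniformPerm n = meanStat hm keyStat n :=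
  integral_uniformPerm n _

/-- The centered key path length. -/
noncomputable def centeredKey (σ : Equiv.Perm (Fin n)) : ℝ :=
  KPL hm n σ - ∫ τ, KPL hm n τ ∂uniformPerm n

/-- The centered difference `N_n - φ K_n`. -/
noncomputable def centeredDiff (σ : Equiv.Perm (Fin n)) : ℝ :=
  (NPL hm n σ - occupancy m * KPL hm n σ)
    - ∫ τ, (NPL hm n τ - occupancy m * KPL hm n τ) ∂uniformPerm n

lemma integral_centeredKey_sq :
    ∫ σ, centeredKey hm n σ ^ 2 ∂uniformPerm n = varStat hm keyStat n := by
  simp only [centeredKey, integral_KPL]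
  exact integral_uniformPerm n _

lemma integral_centeredDiff_sq :
    ∫ σ, centeredDiff hm n σ ^ 2 ∂uniformPerm n = varStat hm (diffStat m) n := by
  have h : ∫ τ, (NPL hm n τ - occupancy m * KPL hm n τ) ∂uniformPerm n
      = meanStat hm (diffStat m) n := integral_uniformPerm n _
  simp only [centeredDiff, h]
  exact integral_uniformPerm n _

lemma NPL_sub_integral (σ : Equiv.Perm (Fin n)) :
    NPL hm n σ - ∫ τ, NPL hm n τ ∂uniformPerm n
      = occupancy m * centeredKey hm n σ + centeredDiff hm n σ := by
  rw [centeredKey, centeredDiff, integral_sub .of_finite .of_finite, integral_const_mul]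
  ring

lemma integral_mul_sq_le (f g : Equiv.Perm (Fin n) → ℝ) :
    (∫ σ, f σ * g σ ∂uniformPerm n) ^ 2
      ≤ (∫ σ, f σ ^ 2 ∂uniformPerm n) * ∫ σ, g σ ^ 2 ∂uniformPerm n := by
  simp only [integral_uniformPerm, Fintype.expect_eq_sum_div_card]
  rw [div_pow, div_mul_div_comm, ← sq]
  exact div_le_div_of_nonneg_right (Finset.sum_mul_sq_le_sq_mul_sq _ _ _) (sq_nonneg _)

lemma tendsto_varStat_diffStat_div_varStat : Tendsto
    (fun n => varStat hm (diffStat m) n / varStat hm keyStat n) atTop (𝓝 0) := by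
  obtain ⟨c, hc, h⟩ := exists_le_varStat_keyStat hm
  have h1 := (tendsto_varStat_diffStat hm).const_mul c⁻¹
  rw [mul_zero] at h1
  refine squeeze_zero' (Eventually.of_forall fun n =>
    div_nonneg (varStat_nonneg _ _ _) (varStat_nonneg _ _ _)) ?_ h1
  filter_upwards [h] with n hn
  have hq := quad_pos n
  refine (div_le_div_of_nonneg_left (varStat_nonneg _ _ _) (by positivity) hn).trans (le_of_eq ?_)
  field_simp

/-- The key path length and the node path length are asymptotically perfectly correlated. -/
theorem tendsto_correlation :
    Tendsto (fun n : ℕ => correlation (KPL hm n) (NPL hm n) (uniformPerm n)) atTop (𝓝 1) := by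
  have hφ := occupancy_pos hm
  set v : ℕ → ℝ := fun n => varStat hm keyStat n with hv
  set z : ℕ → ℝ := fun n => varStat hm (diffStat m) n with hz
  set c : ℕ → ℝ := fun n => ∫ σ, centeredKey hm n σ * centeredDiff hm n σ ∂uniformPerm n with hc
  have hz0 : Tendsto (fun n => z n / v n) atTop (𝓝 0) := tendsto_varStat_diffStat_div_varStat hm
  have hvpos : ∀ᶠ n in atTop, 0 < v n := by
    obtain ⟨c, hc, h⟩ := exists_le_varStat_keyStat hm
    filter_upwards [h] with n hn
    have := quad_pos n
    exact lt_of_lt_of_le (by positivity) hn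
  -- By Cauchy–Schwarz, (c/v)² ≤ z/v.
  have hc0 : Tendsto (fun n => c n / v n) atTop (𝓝 0) := by
    refine squeeze_zero_norm' ?_ (by simpa using hz0.sqrt)
    filter_upwards [hvpos] with n hn
    rw [Real.norm_eq_abs]
    refine Real.abs_le_sqrt ?_
    have h := integral_mul_sq_le n (centeredKey hm n) (centeredDiff hm n)
    rw [integral_centeredKey_sq, integral_centeredDiff_sq] at h
    rw [div_pow, div_le_div_iff₀ (by positivity) hn]
    change c n ^ 2 ≤ v n * z n at h
    nlinarith
  -- This is the correlation after division by `v`: the covariance is φv + c and the variance of the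
  -- node path length is φ²v + 2φc + z.
  have hlim : Tendsto (fun n => (occupancy m + c n / v n)
      / √(occupancy m ^ 2 + 2 * occupancy m * (c n / v n) + z n / v n)) atTop (𝓝 1) := by
    have h1 : Tendsto (fun n => (occupancy m + c n / v n)
        / √(occupancy m ^ 2 + 2 * occupancy m * (c n / v n) + z n / v n)) atTop
        (𝓝 ((occupancy m + 0) / √(occupancy m ^ 2 + 2 * occupancy m * 0 + 0))) := by
      refine (hc0.const_add _).div (((hc0.const_mul _).const_add _).add hz0).sqrt ?_
      rw [mul_zero, add_zero, add_zero, Real.sqrt_sq hφ.le]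
      exact hφ.ne'
    rwa [mul_zero, add_zero, add_zero, add_zero, Real.sqrt_sq hφ.le, div_self hφ.ne'] at h1
  refine hlim.congr' ?_
  filter_upwards [hvpos] with n hn
  have e1 : covariance (KPL hm n) (NPL hm n) (uniformPerm n)
      = v n * (occupancy m + c n / v n) := by
    have h1 : covariance (KPL hm n) (NPL hm n) (uniformPerm n)
        = ∫ σ, (occupancy m * centeredKey hm n σ ^ 2
          + centeredKey hm n σ * centeredDiff hm n σ) ∂uniformPerm n := by
      rw [covariance]
      refine integral_congr_ae (Eventually.of_forall fun σ => ?_)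
      simp only
      rw [NPL_sub_integral, ← centeredKey]
      ring
    rw [h1, integral_add .of_finite .of_finite, integral_const_mul, integral_centeredKey_sq,
      mul_add, mul_div_cancel₀ _ hn.ne', mul_comm]
  have e2 : variance (KPL hm n) (uniformPerm n) = v n := by
    rw [variance_eq_integral Measurable.of_discrete.aemeasurable]
    exact integral_centeredKey_sq hm n
  have e3 : variance (NPL hm n) (uniformPerm n)
      = v n * (occupancy m ^ 2 + 2 * occupancy m * (c n / v n) + z n / v n) := by
    have h1 : variance (NPL hm n) (uniformPerm n)
        = ∫ σ, (occupancy m ^ 2 * centeredKey hm n σ ^ 2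
          + 2 * occupancy m * (centeredKey hm n σ * centeredDiff hm n σ)
          + centeredDiff hm n σ ^ 2) ∂uniformPerm n := by
      rw [variance_eq_integral Measurable.of_discrete.aemeasurable]
      refine integral_congr_ae (Eventually.of_forall fun σ => ?_)
      simp only
      rw [NPL_sub_integral]
      ring
    rw [h1, integral_add .of_finite .of_finite, integral_add .of_finite .of_finite,
      integral_const_mul, integral_const_mul, integral_centeredKey_sq, integral_centeredDiff_sq]
    change occupancy m ^ 2 * v n + 2 * occupancy m * c n + z n = _
    field_simp
  rw [correlation, e1, e2, e3, Real.sqrt_mul hn.le, ← mul_assoc, Real.mul_self_sqrt hn.le,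
    mul_div_mul_left _ _ hn.ne']

lemma tendsto_sqrt_varStat_diffStat_div :
    Tendsto (fun n : ℕ => √(varStat hm (diffStat m) n) / n) atTop (𝓝 0) := by
  -- The factor 6 comes from (n+1)(n+2) ≤ 6n² for n ≥ 1.
  have h1 : Tendsto (fun n : ℕ => √(6 * (varStat hm (diffStat m) n / quad n))) atTop (𝓝 0) := by
    simpa using ((tendsto_varStat_diffStat hm).const_mul 6).sqrt
  refine squeeze_zero' (Eventually.of_forall fun n => by positivity) ?_ h1
  filter_upwards [eventually_ge_atTop 1] with n hn
  have hn1 : (1 : ℝ) ≤ n := by exact_mod_cast hn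
  have hv := varStat_nonneg hm (diffStat m) n
  have hq := quad_pos n
  refine Real.le_sqrt_of_sq_le ?_
  rw [div_pow, Real.sq_sqrt hv, ← mul_div_assoc, div_le_div_iff₀ (by positivity) hq]
  have : quad n ≤ 6 * (n : ℝ) ^ 2 := by
    unfold quad
    nlinarith
  nlinarith

/-- The difference between the node path length and a multiple of the key path length has small
fluctuations. -/
theorem isLittleO_lpNorm_centeredDiff :
    (fun n : ℕ => lpNorm (centeredDiff hm n) 2 (uniformPerm n)) =o[atTop] (fun n : ℕ => (n : ℝ)) := by
  have h : ∀ n, lpNorm (centeredDiff hm n) 2 (uniformPerm n) = √(varStat hm (diffStat m) n) := by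
    intro n
    rw [lpNorm_eq_integral_norm_rpow_toReal (by norm_num) (by norm_num)
      Measurable.of_discrete.aestronglyMeasurable, ← integral_centeredDiff_sq, Real.sqrt_eq_rpow]
    simp
  simp only [h]
  refine Asymptotics.isLittleO_of_tendsto' ?_ (tendsto_sqrt_varStat_diffStat_div hm)
  filter_upwards [eventually_ge_atTop 1] with n hn h0
  have : (n : ℝ) ≠ 0 := by positivity
  exact absurd h0 this

lemma integral_abs_le_sqrt (f : Equiv.Perm (Fin n) → ℝ) :
    ∫ σ, |f σ| ∂uniformPerm n ≤ √(∫ σ, f σ ^ 2 ∂uniformPerm n) := by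
  refine Real.le_sqrt_of_sq_le ?_
  simpa using integral_mul_sq_le n (fun σ => |f σ|) fun _ => 1

lemma centeredKey_eq (σ : Equiv.Perm (Fin n)) :
    centeredKey hm n σ = (n + 1) * scaledKey hm n σ := by
  have : (n : ℝ) + 1 ≠ 0 := by positivity
  rw [centeredKey, integral_KPL, scaledKey, mul_div_cancel₀ _ this]
  rfl

/-- Joint convergence in law, given the convergence of the rescaled key path length. -/
theorem tendstoInDistribution_pathLengths {ν : ProbabilityMeasure ℝ}
    (hν : Tendsto (scaledKeyLaw hm) atTop (𝓝 ν)) :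
    TendstoInDistribution
      (fun (n : ℕ) (σ : Equiv.Perm (Fin n)) =>
        ((KPL hm n σ - ∫ τ, KPL hm n τ ∂(uniformPerm n)) / (n : ℝ),
          (NPL hm n σ - ∫ τ, NPL hm n τ ∂(uniformPerm n)) / (n : ℝ)))
      atTop (fun x : ℝ => (x, occupancy m * x)) uniformPerm (ν : Measure ℝ) := by
  have hφ := occupancy_pos hm
  refine ⟨fun n => Measurable.of_discrete.aemeasurable, by fun_prop, ?_⟩
  -- For Lipschitz test functions it suffices that the pair is close in mean to `(x, φx)` evaluated
  -- at the scaled key path length.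
  refine tendsto_iff_forall_lipschitz_integral_tendsto.2 ?_
  rintro F ⟨C, hC⟩ ⟨L, hL⟩
  have hg : Continuous fun x : ℝ => (x, occupancy m * x) := by fun_prop
  have hFm : AEStronglyMeasurable F
      ((ν : Measure ℝ).map fun x : ℝ => (x, occupancy m * x)) :=
    hL.continuous.aestronglyMeasurable
  simp only [ProbabilityMeasure.coe_mk]
  rw [integral_map hg.aemeasurable hFm]
  have h1 : Tendsto (fun n => ∫ σ, F (scaledKey hm n σ, occupancy m * scaledKey hm n σ)
      ∂uniformPerm n) atTop (𝓝 (∫ x, F (x, occupancy m * x) ∂(ν : Measure ℝ))) := by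
    have h2 := (ProbabilityMeasure.tendsto_iff_forall_integral_tendsto.1 hν)
      (BoundedContinuousFunction.mkOfBound ⟨_, hL.continuous.comp hg⟩ C fun x y => hC _ _)
    refine h2.congr fun n => ?_
    rw [scaledKeyLaw, ProbabilityMeasure.coe_mk,
      integral_map Measurable.of_discrete.aemeasurable
        (BoundedContinuousFunction.continuous _).aestronglyMeasurable]
    rfl
  obtain ⟨B, hB0, hB⟩ := exists_expect_scaledKey_sq_le hm
  -- The first term is the cost of normalizing by `n` instead of `n + 1` in both coordinates, the
  -- second the mean distance between the centred N and φK.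
  have h3 : Tendsto (fun n : ℕ => (L : ℝ) * ((1 + occupancy m) * √B * (1 / (n : ℝ))
      + √(varStat hm (diffStat m) n) / n)) atTop (𝓝 0) := by
    have h4 : Tendsto (fun n : ℕ => 1 / (n : ℝ)) atTop (𝓝 0) := tendsto_one_div_atTop_nhds_zero_nat
    simpa using ((h4.const_mul ((1 + occupancy m) * √B)).add
      (tendsto_sqrt_varStat_diffStat_div hm)).const_mul (L : ℝ)
  have h5 : Tendsto (fun n : ℕ => ∫ σ, F ((KPL hm n σ - ∫ τ, KPL hm n τ ∂(uniformPerm n)) / (n : ℝ),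
      (NPL hm n σ - ∫ τ, NPL hm n τ ∂(uniformPerm n)) / (n : ℝ)) ∂uniformPerm n
      - ∫ σ, F (scaledKey hm n σ, occupancy m * scaledKey hm n σ) ∂uniformPerm n) atTop (𝓝 0) := by
    refine squeeze_zero_norm' ?_ h3
    filter_upwards [eventually_ge_atTop 1] with n hn
    have hn0 : (0 : ℝ) < n := by exact_mod_cast hn
    rw [← integral_sub .of_finite .of_finite]
    refine (norm_integral_le_integral_norm _).trans ?_
    have h6 : ∀ σ, ‖F ((KPL hm n σ - ∫ τ, KPL hm n τ ∂(uniformPerm n)) / (n : ℝ),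
        (NPL hm n σ - ∫ τ, NPL hm n τ ∂(uniformPerm n)) / (n : ℝ))
        - F (scaledKey hm n σ, occupancy m * scaledKey hm n σ)‖
        ≤ L * ((1 + occupancy m) * (1 / n) * |scaledKey hm n σ|
          + 1 / n * |centeredDiff hm n σ|) := by
      intro σ
      have h7 := hL.dist_le_mul ((KPL hm n σ - ∫ τ, KPL hm n τ ∂(uniformPerm n)) / (n : ℝ),
        (NPL hm n σ - ∫ τ, NPL hm n τ ∂(uniformPerm n)) / (n : ℝ))
        (scaledKey hm n σ, occupancy m * scaledKey hm n σ)
      rw [Real.dist_eq] at h7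
      refine h7.trans (mul_le_mul_of_nonneg_left ?_ L.2)
      have h8 : (KPL hm n σ - ∫ τ, KPL hm n τ ∂(uniformPerm n)) / (n : ℝ) - scaledKey hm n σ
          = 1 / n * scaledKey hm n σ := by
        rw [← centeredKey, centeredKey_eq]
        field_simp
        ring
      have h9 : (NPL hm n σ - ∫ τ, NPL hm n τ ∂(uniformPerm n)) / (n : ℝ)
          - occupancy m * scaledKey hm n σ
          = occupancy m * (1 / n * scaledKey hm n σ) + 1 / n * centeredDiff hm n σ := by
        rw [NPL_sub_integral, centeredKey_eq]
        field_simp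
        ring
      have h10 : 0 ≤ 1 / (n : ℝ) * |scaledKey hm n σ| := by positivity
      have h11 : 0 ≤ 1 / (n : ℝ) * |centeredDiff hm n σ| := by positivity
      rw [Prod.dist_eq, Real.dist_eq, Real.dist_eq]
      refine max_le ?_ ?_
      · rw [h8, abs_mul, abs_of_pos (by positivity : (0 : ℝ) < 1 / n)]
        nlinarith
      · rw [h9]
        refine (abs_add_le _ _).trans ?_
        rw [abs_mul, abs_mul, abs_mul, abs_of_pos (by positivity : (0 : ℝ) < 1 / n),
          abs_of_pos hφ]
        nlinarith
    refine (integral_mono .of_finite .of_finite h6).trans ?_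
    rw [integral_const_mul, integral_add .of_finite .of_finite, integral_const_mul,
      integral_const_mul]
    refine mul_le_mul_of_nonneg_left (add_le_add ?_ ?_) L.2
    · have h12 : ∫ σ, |scaledKey hm n σ| ∂uniformPerm n ≤ √B := by
        refine (integral_abs_le_sqrt n _).trans (Real.sqrt_le_sqrt ?_)
        rw [integral_uniformPerm]
        exact hB n
      rw [mul_right_comm]
      exact mul_le_mul_of_nonneg_right (mul_le_mul_of_nonneg_left h12 (by positivity))
        (by positivity)
    · rw [one_div_mul_eq_div, ← integral_centeredDiff_sq]
      exact div_le_div_of_nonneg_right (integral_abs_le_sqrt n _) hn0.le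
  have h13 := h5.add h1
  rw [zero_add] at h13
  refine h13.congr fun n => ?_
  rw [sub_add_cancel, integral_map Measurable.of_discrete.aemeasurable
    hL.continuous.aestronglyMeasurable]

end PathLengths

theorem corollary2p5 (m : ℕ) (hm : 2 ≤ m) :
    -- the correlation coefficient of `K_n` and `N_n` tends to one
    Tendsto (fun n : ℕ => correlation (KPL hm n) (NPL hm n) (uniformPerm n)) atTop (𝓝 1) ∧
    -- the `L²` norm of the centered `N_n - φ K_n` is `o(n)`
    (fun n : ℕ =>
        lpNorm (fun σ => (NPL hm n σ - occupancy m * KPL hm n σ)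
          - ∫ τ, (NPL hm n τ - occupancy m * KPL hm n τ) ∂(uniformPerm n)) 2 (uniformPerm n))
      =o[atTop] (fun n : ℕ => (n : ℝ)) ∧
    -- the law `ν` of `K` exists, is unique, and the normalized pair converges to `(K, φ K)`
    ∃ ν : ProbabilityMeasure ℝ,
      IsKeyLimitLaw m ν ∧ (∀ ν' : ProbabilityMeasure ℝ, IsKeyLimitLaw m ν' → ν' = ν) ∧
      TendstoInDistribution
        (fun (n : ℕ) (σ : Equiv.Perm (Fin n)) =>
          ((KPL hm n σ - ∫ τ, KPL hm n τ ∂(uniformPerm n)) / (n : ℝ),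
            (NPL hm n σ - ∫ τ, NPL hm n τ ∂(uniformPerm n)) / (n : ℝ)))
        atTop (fun x : ℝ => (x, occupancy m * x)) uniformPerm (ν : Measure ℝ) := by
  obtain ⟨ν, hν, hlim⟩ := exists_tendsto_scaledKeyLaw hm
  exact ⟨tendsto_correlation hm, isLittleO_lpNorm_centeredDiff hm, ν, hν,
    fun _ h => hν.unique hm h, tendstoInDistribution_pathLengths hm hlim⟩
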